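/- Throughout, manifolds are smooth and Hausdorff, $n\ge 2$, $M$ is an $(n+1)$-dimensional manifold with a smooth torsion-free affine connection $\hat\nabla$, and $f:\Sigma\to M$ is a smooth immersion of an $n$-dimensional manifold ($\Sigma$ is regarded as an immersed hypersurface, and $f$ and $df$ are suppressed from the notation). The second fundamental form of $\Sigma$ is the normal-bundle valued form sending tangent fields $X,Y$ to the projection of $\hat\nabla_XY$ to $TM/T\Sigma$; $\Sigma$ is assumed nondegenerate, that is, this form is nondegenerate at every point. A transverse vector field $N$ along an open $U\subset\Sigma$ induces on $U$ a connection $\nabla$ and a symmetric nondegenerate tensor (metric) $h$ by $\hat\nabla_XY=\nabla_XY+h(X,Y)N$; $\nabla$ depends only on the line field spanned by $N$. A connection $\nabla$ is aligned with a metric $h$ if $n\,h^{pq}\nabla_ph_{qi}=h^{pq}\nabla_ih_{pq}$. The volume density of a metric $k$ is $|\mathrm{vol}_k|(Y_1,\dots,Y_n)=|\det k(Y_i,Y_j)|^{1/2}$. For a volume form (smooth nowhere vanishing $(n+1)$-form) $\Psi$ on $M$ and a transversal $N$, $|\iota(N)\Psi|$ is the density $(Y_1,\dots,Y_n)\mapsto|\Psi(N,Y_1,\dots,Y_n)|$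 on $\Sigma$. A co-orientation of $\Sigma$ is a continuous choice of one of the two sides of $T_p\Sigma$ in $T_pM$. The connection $\hat\nabla$ is projectively flat if every point of $M$ has an open neighbourhood with a smooth one-form $\gamma$ such that the connection $(X,Y)\mapsto\hat\nabla_XY+\gamma(X)Y+\gamma(Y)X$ has zero curvature there. **Theorem 2.14.** 1. There is a unique smooth line field $W$ along $\Sigma$, transverse to $\Sigma$, such that for every open $U\subset\Sigma$ and every nonvanishing smooth section $N$ of $W$ over $U$ the connection $\nabla$ induced on $U$ by $\hat\nabla$ and $W$ is aligned with the metric induced on $U$ by $N$. 2. If $\Sigma$ is co-oriented and $\Psi$ is a volume form on $M$ with $\hat\nabla\Psi=0$, then there is a unique smooth co-oriented section $\nu$ of $W$ over $\Sigma$ such that $|\iota(\nu)\Psi|=|\mathrm{vol}_k|$, where $k$ is the metric induced by $\nu$. 3. If, in addition to the hypotheses of 2, $\hat\nabla$ is projectively flat, then the connection $\nabla$ induced on $\Sigma$ by $\hat\nabla$ and $\nu$ preserves the densities $|\iota(\nu)\Psi|$ and $|\mathrm{vol}_k|$. 4. If $M=\mathbb R^{n+1}$ with its standard flat connection and its standard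 volume form $\Psi$, and $\Sigma$ is co-oriented, then the section $\nu$ of 2 is the classical equiaffine normal of $\Sigma$: a vector field $\nu$ along $\Sigma$ is the one in 2 if and only if it is a smooth co-oriented transversal for which the densities $|\iota(\nu)\Psi|$ and $|\mathrm{vol}_k|$ coincide and are preserved by the connection induced on $\Sigma$ by $\nu$. -/

import Mathlib

open Bundle Set
open scoped Manifold ContDiff

noncomputable section

namespace HypersurfaceGeometry

/-! ### Affine connections and volume forms on an `m`-dimensional manifold -/

section Ambient

variable {m : ℕ} {M : Type*} [TopologicalSpace M] [ChartedSpace (EuclideanSpace ℝ (Fin m)) M]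
  [IsManifold (𝓡 m) ∞ M]

/-- Vector fields on `M` (not necessarily continuous). -/
abbrev VField (m : ℕ) (M : Type*) [TopologicalSpace M]
    [ChartedSpace (EuclideanSpace ℝ (Fin m)) M] : Type _ :=
  Π x : M, TangentSpace (𝓡 m) x

/-- The vector field `X` is smooth on `U`. -/
def IsSmoothFieldOn (X : VField m M) (U : Set M) : Prop :=
  ContMDiffOn (𝓡 m) (𝓡 m).tangent ∞ (fun x ↦ (⟨x, X x⟩ : TangentBundle (𝓡 m) M)) U

/-- The vector field `X` is differentiable at `x`. -/
def IsDiffFieldAt (X : VField m M) (x : M) : Prop :=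
  MDifferentiableAt (𝓡 m) (𝓡 m).tangent (fun y ↦ (⟨y, X y⟩ : TangentBundle (𝓡 m) M)) x

/-- Operators of the type of an affine connection: `D Y x v` stands for `(∇_v Y)(x)`, the order of
arguments of Mathlib's `CovariantDerivative`. -/
abbrev ConnOp (m : ℕ) (M : Type*) [TopologicalSpace M]
    [ChartedSpace (EuclideanSpace ℝ (Fin m)) M] : Type _ :=
  VField m M → Π x : M, TangentSpace (𝓡 m) x →L[ℝ] TangentSpace (𝓡 m) x

/-- The curvature `R(X, Y)Z = ∇_X ∇_Y Z - ∇_Y ∇_X Z - ∇_{[X, Y]} Z`. -/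
def curvature (D : ConnOp m M) (X Y Z : VField m M) (x : M) : TangentSpace (𝓡 m) x :=
  D (fun y ↦ D Z y (Y y)) x (X x) - D (fun y ↦ D Z y (X y)) x (Y x)
    - D Z x (VectorField.mlieBracket (𝓡 m) X Y x)

/-- The projective change of a connection by a one-form `γ`:
`(X, Y) ↦ ∇_X Y + γ(X) Y + γ(Y) X`. -/
def projectiveChange (D : ConnOp m M) (γ : Π x : M, TangentSpace (𝓡 m) x →L[ℝ] ℝ) : ConnOp m M :=
  fun Y x ↦ D Y x + (γ x).smulRight (Y x) + γ x (Y x) • ContinuousLinearMap.id ℝ _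

/-- `γ` is a smooth one-form on the open set `U`: it is smooth on smooth vector fields. -/
def IsSmoothOneFormOn (γ : Π x : M, TangentSpace (𝓡 m) x →L[ℝ] ℝ) (U : Set M) : Prop :=
  ∀ V ⊆ U, IsOpen V → ∀ X : VField m M, IsSmoothFieldOn X V →
    ContMDiffOn (𝓡 m) 𝓘(ℝ, ℝ) ∞ (fun x ↦ γ x (X x)) V

/-- A connection is projectively flat if every point has an open neighbourhood on which it is
projectively equivalent to a flat connection. (A projective change does not alter the torsion.) -/
def IsProjectivelyFlat (D : ConnOp m M) : Prop :=
  ∀ x : M, ∃ U : Set M, IsOpen U ∧ x ∈ U ∧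
    ∃ γ : Π x : M, TangentSpace (𝓡 m) x →L[ℝ] ℝ, IsSmoothOneFormOn γ U ∧
      ∀ X Y Z : VField m M, IsSmoothFieldOn X U → IsSmoothFieldOn Y U → IsSmoothFieldOn Z U →
        ∀ y ∈ U, curvature (projectiveChange D γ) X Y Z y = 0

/-- A volume form: a smooth nowhere vanishing differential form of top degree. Smoothness means
smoothness of all evaluations on smooth local vector fields. -/
structure IsVolumeForm (Ψ : Π x : M, TangentSpace (𝓡 m) x [⋀^Fin m]→ₗ[ℝ] ℝ) : Prop where
  ne_zero : ∀ x, Ψ x ≠ 0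
  smooth : ∀ U : Set M, IsOpen U → ∀ X : Fin m → VField m M, (∀ i, IsSmoothFieldOn (X i) U) →
    ContMDiffOn (𝓡 m) 𝓘(ℝ, ℝ) ∞ (fun x ↦ Ψ x (fun i ↦ X i x)) U

/-- The connection preserves the form `Ψ`:
`v(Ψ(X₁, …, X_m)) = ∑ i, Ψ(X₁, …, ∇_v X_i, …, X_m)`, that is, `∇Ψ = 0`. -/
def PreservesForm (D : ConnOp m M) (Ψ : Π x : M, TangentSpace (𝓡 m) x [⋀^Fin m]→ₗ[ℝ] ℝ) : Prop :=
  ∀ (x : M) (X : Fin m → VField m M), (∀ i, IsDiffFieldAt (X i) x) →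
    ∀ v : TangentSpace (𝓡 m) x,
      mvfderiv (𝓡 m) (fun y ↦ Ψ y (fun i ↦ X i y)) x v =
        ∑ i, Ψ x (Function.update (fun j ↦ X j x) i (D (X i) x v))

/-- Fibrewise bilinear forms on `M`, as functions. -/
abbrev BilinField (m : ℕ) (M : Type*) [TopologicalSpace M]
    [ChartedSpace (EuclideanSpace ℝ (Fin m)) M] : Type _ :=
  Π x : M, TangentSpace (𝓡 m) x → TangentSpace (𝓡 m) x → ℝ

/-- `(∇_X h)(Y, Z) = X(h(Y, Z)) - h(∇_X Y, Z) - h(Y, ∇_X Z)` at the point `x`, for tangent vectors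
`X, Y, Z` at `x`; on the right `Y` and `Z` are extended to local smooth vector fields. -/
def covDerivBilin (D : ConnOp m M) (h : BilinField m M) (x : M) (X Y Z : TangentSpace (𝓡 m) x) :
    ℝ :=
  mvfderiv (𝓡 m) (fun y ↦ h y (FiberBundle.extend (EuclideanSpace ℝ (Fin m)) Y y)
      (FiberBundle.extend (EuclideanSpace ℝ (Fin m)) Z y)) x X
    - h x (D (FiberBundle.extend (EuclideanSpace ℝ (Fin m)) Y) x X) Z
    - h x Y (D (FiberBundle.extend (EuclideanSpace ℝ (Fin m)) Z) x X)

/-- The alignment condition `m h^{pq} ∇_p h_{qi} = h^{pq} ∇_i h_{pq}` at the point `x`, written in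
an arbitrary basis of the tangent space. -/
def IsAlignedAt (D : ConnOp m M) (h : BilinField m M) (x : M) : Prop :=
  ∀ (b : Module.Basis (Fin m) ℝ (TangentSpace (𝓡 m) x)) (Z : TangentSpace (𝓡 m) x),
    let G : Matrix (Fin m) (Fin m) ℝ := (Matrix.of fun i j ↦ h x (b i) (b j))⁻¹
    (m : ℝ) * ∑ p, ∑ q, G p q * covDerivBilin D h x (b p) (b q) Z =
      ∑ p, ∑ q, G p q * covDerivBilin D h x Z (b p) (b q)

/-- Densities on `M`, as functions of `m`-tuples of tangent vectors. -/
abbrev DensityField (m : ℕ) (M : Type*) [TopologicalSpace M]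
    [ChartedSpace (EuclideanSpace ℝ (Fin m)) M] : Type _ :=
  Π x : M, (Fin m → TangentSpace (𝓡 m) x) → ℝ

/-- The volume density `|vol_h|` of a metric `h`:
`(Y₁, …, Y_m) ↦ |det (h(Y_i, Y_j))| ^ (1/2)`. -/
def metricDensity (h : BilinField m M) : DensityField m M :=
  fun x Y ↦ √|(Matrix.of fun i j ↦ h x (Y i) (Y j)).det|

/-- The connection preserves the (positive) density `μ`. If `Y₁, …, Y_m` is a frame at `x` and
`∇_X Y_j = ∑ i, c i j • Y_i`, then `(∇_X μ)(Y₁, …, Y_m) = X(μ(Y₁, …, Y_m)) - tr(c) μ(Y₁, …, Y_m)`;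
this is required to vanish. -/
def PreservesDensity (D : ConnOp m M) (μ : DensityField m M) : Prop :=
  ∀ (x : M) (Y : Fin m → VField m M), (∀ i, IsDiffFieldAt (Y i) x) →
    LinearIndependent ℝ (fun i ↦ Y i x) →
      MDifferentiableAt (𝓡 m) 𝓘(ℝ, ℝ) (fun y ↦ μ y (fun i ↦ Y i y)) x ∧
      ∀ (X : TangentSpace (𝓡 m) x) (c : Matrix (Fin m) (Fin m) ℝ),
        (∀ j, D (Y j) x X = ∑ i, c i j • Y i x) →
          mvfderiv (𝓡 m) (fun y ↦ μ y (fun i ↦ Y i y)) x X = c.trace * μ x (fun i ↦ Y i x)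

end Ambient

/-! ### Immersed hypersurfaces -/

section Hypersurface

variable {n : ℕ} {S : Type*} [TopologicalSpace S] [ChartedSpace (EuclideanSpace ℝ (Fin n)) S]
  {M : Type*} [TopologicalSpace M] [ChartedSpace (EuclideanSpace ℝ (Fin (n + 1))) M]

/-- The differential of `f : S → M` at `p`. -/
abbrev dAt (n : ℕ) {S : Type*} [TopologicalSpace S]
    [ChartedSpace (EuclideanSpace ℝ (Fin n)) S] {M : Type*} [TopologicalSpace M]
    [ChartedSpace (EuclideanSpace ℝ (Fin (n + 1))) M] (f : S → M) (p : S) :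
    TangentSpace (𝓡 n) p →L[ℝ] TangentSpace (𝓡 (n + 1)) (f p) :=
  mfderiv (𝓡 n) (𝓡 (n + 1)) f p

/-- Vector fields along `f : S → M`, that is, sections of the pullback of `TM`. -/
abbrev FieldAlong (n : ℕ) {S : Type*} {M : Type*} [TopologicalSpace M]
    [ChartedSpace (EuclideanSpace ℝ (Fin (n + 1))) M] (f : S → M) : Type _ :=
  Π p : S, TangentSpace (𝓡 (n + 1)) (f p)

/-- Smoothness on `U` of a vector field along `f`. -/
def IsSmoothAlongOn [IsManifold (𝓡 (n + 1)) ∞ M] (f : S → M) (N : FieldAlong n f) (U : Set S) : Prop :=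
  ContMDiffOn (𝓡 n) (𝓡 (n + 1)).tangent ∞
    (fun q ↦ (⟨f q, N q⟩ : TangentBundle (𝓡 (n + 1)) M)) U

section Induced

variable [IsManifold (𝓡 n) ∞ S] [IsManifold (𝓡 (n + 1)) ∞ M]

/-- The pullback connection: the covariant derivative at `p` of a vector field `V` along `f`. Let
`e_i` be the frame of `TM` near `f p` given by the preferred trivialization at `f p`. If
`V(q) = ∑ v^i(q) e_i(f q)`, then
`∇_X V = ∑ dv^i(X) e_i(f p) + ∑ v^i(p) (∇_{df(X)} e_i)(f p)`.
The field `FiberBundle.extend _ (V p)` below is `∑ v^i(p) e_i`. -/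
def covAlong (f : S → M) (D : ConnOp (n + 1) M) (V : FieldAlong n f) (p : S) :
    TangentSpace (𝓡 n) p →L[ℝ] TangentSpace (𝓡 (n + 1)) (f p) :=
  let t := trivializationAt (EuclideanSpace ℝ (Fin (n + 1)))
    (TangentSpace (𝓡 (n + 1)) : M → Type _) (f p)
  t.symmL ℝ (f p) ∘L mvfderiv (𝓡 n) (fun q ↦ (t ⟨f q, V q⟩).2) p
    + D (FiberBundle.extend (EuclideanSpace ℝ (Fin (n + 1))) (V p)) (f p) ∘L dAt n f p

/-- The covariant derivative `∇̂_X Y` for a vector `X` tangent to `S` at `p` and a vector field `Y`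
tangent to `S`; it is a tangent vector of `M`. -/
def covTangent (f : S → M) (D : ConnOp (n + 1) M) (Y : VField n S) (p : S) :
    TangentSpace (𝓡 n) p →L[ℝ] TangentSpace (𝓡 (n + 1)) (f p) :=
  covAlong f D (fun q ↦ dAt n f q (Y q)) p

/-- The second fundamental form, with values in the normal bundle `TM / df(TS)`: the projection of
`∇̂_X Y`. -/
def secondFundamentalForm (f : S → M) (D : ConnOp (n + 1) M) (p : S)
    (X Y : TangentSpace (𝓡 n) p) :
    TangentSpace (𝓡 (n + 1)) (f p) ⧸ (dAt n f p).toLinearMap.range :=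
  Submodule.Quotient.mk
    (covTangent f D (FiberBundle.extend (EuclideanSpace ℝ (Fin n)) Y) p X)

/-- `f` is a smooth immersion whose second fundamental form is nondegenerate everywhere. -/
structure IsNondegenerateImmersion (f : S → M) (D : ConnOp (n + 1) M) : Prop where
  smooth : ContMDiff (𝓡 n) (𝓡 (n + 1)) ∞ f
  injective_differential : ∀ p, Function.Injective (dAt n f p)
  nondegenerate : ∀ (p : S) (X : TangentSpace (𝓡 n) p),
    (∀ Y, secondFundamentalForm f D p X Y = 0) → X = 0

/-- The map `T_p S × ℝ → T_{f p} M`, `(Y, c) ↦ df(Y) + c N`. It is an isomorphism when `f` is an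
immersion and `N` is transverse, and its inverse gives the components of a vector of `M`
along `S` and along `N`. -/
def splitting (f : S → M) (N : FieldAlong n f) (p : S) :
    (TangentSpace (𝓡 n) p × ℝ) →L[ℝ] TangentSpace (𝓡 (n + 1)) (f p) :=
  (dAt n f p).coprod (ContinuousLinearMap.toSpanSingleton ℝ (N p))

/-- The connection `∇` induced on `S` by a transversal `N`:
`∇̂_X Y = ∇_X Y + h(X, Y) N`. -/
def inducedConnection (f : S → M) (D : ConnOp (n + 1) M) (N : FieldAlong n f) : ConnOp n S :=
  fun Y p ↦ ContinuousLinearMap.fst ℝ _ _ ∘L (splitting f N p).inverse ∘L covTangent f D Y p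

/-- The induced connection depends only on the line spanned by the transversal. -/
theorem inducedConnection_eq_of_smul (f : S → M) (D : ConnOp (n + 1) M) (N N' : FieldAlong n f)
    (p : S) (a : ℝ) (ha : a ≠ 0) (h : N' p = a • N p) (Y : VField n S) :
    inducedConnection f D N' Y p = inducedConnection f D N Y p := by
  let e : (TangentSpace (𝓡 n) p × ℝ) ≃L[ℝ] (TangentSpace (𝓡 n) p × ℝ) :=
    (ContinuousLinearEquiv.refl ℝ _).prodCongr
      (ContinuousLinearEquiv.unitsEquivAut ℝ (Units.mk0 a ha))
  have he : splitting f N' p = splitting f N p ∘L (e : _ →L[ℝ] _) := by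
    ext v <;> simp [splitting, e, h]
  unfold inducedConnection
  rw [he, ContinuousLinearMap.inverse_comp_equiv]
  ext v
  simp [e]

/-- The representative `h` of the second fundamental form given by a transversal `N`:
`∇̂_X Y = ∇_X Y + h(X, Y) N`. -/
def inducedMetric (f : S → M) (D : ConnOp (n + 1) M) (N : FieldAlong n f) : BilinField n S :=
  fun p X Y ↦ ((splitting f N p).inverse
    (covTangent f D (FiberBundle.extend (EuclideanSpace ℝ (Fin n)) Y) p X)).2

end Induced

/-- A (smooth) line field along `f` transverse to `f`: a family of complements of the tangent
spaces of `S`, locally spanned by a smooth vector field along `f`. -/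
structure IsTransverseLineField [IsManifold (𝓡 (n + 1)) ∞ M] (f : S → M)
    (W : Π p : S, Submodule ℝ (TangentSpace (𝓡 (n + 1)) (f p))) : Prop where
  isCompl : ∀ p, IsCompl (dAt n f p).toLinearMap.range (W p)
  smooth : ∀ p, ∃ U : Set S, IsOpen U ∧ p ∈ U ∧ ∃ N : FieldAlong n f, IsSmoothAlongOn f N U ∧
    ∀ q ∈ U, W q = Submodule.span ℝ {N q}

/-- `W` is a transverse line field such that the connection induced by any nonvanishing section
of `W` over an open set is aligned with the metric induced by that section. -/
def IsAffineNormalDistribution [IsManifold (𝓡 n) ∞ S] [IsManifold (𝓡 (n + 1)) ∞ M] (f : S → M) (D : ConnOp (n + 1) M)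
    (W : Π p : S, Submodule ℝ (TangentSpace (𝓡 (n + 1)) (f p))) : Prop :=
  IsTransverseLineField f W ∧
    ∀ (U : Set S) (N : FieldAlong n f), IsOpen U → IsSmoothAlongOn f N U →
      (∀ q ∈ U, N q ∈ W q ∧ N q ≠ 0) →
        ∀ p ∈ U, IsAlignedAt (inducedConnection f D N) (inducedMetric f D N) p

/-- A co-orientation of the immersion `f`: for each `p` one of the two open half-spaces of
`T_{f p} M` bounded by the hyperplane `df(T_p S)`, the choice being locally given by a smooth
transversal. -/
structure Coorientation (n : ℕ) {S : Type*} [TopologicalSpace S]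
    [ChartedSpace (EuclideanSpace ℝ (Fin n)) S] {M : Type*} [TopologicalSpace M]
    [ChartedSpace (EuclideanSpace ℝ (Fin (n + 1))) M] [IsManifold (𝓡 (n + 1)) ∞ M] (f : S → M) where
  side : Π p : S, Set (TangentSpace (𝓡 (n + 1)) (f p))
  locally_smooth : ∀ p, ∃ U : Set S, IsOpen U ∧ p ∈ U ∧ ∃ N : FieldAlong n f,
    IsSmoothAlongOn f N U ∧ ∀ q ∈ U, N q ∉ (dAt n f q).toLinearMap.range ∧
      side q = {v | ∃ c : ℝ, 0 < c ∧ ∃ X : TangentSpace (𝓡 n) q, v = c • N q + dAt n f q X}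

/-- The density `|ι(N)Ψ|` on `S`: `(Y₁, …, Y_n) ↦ |Ψ(N, df(Y₁), …, df(Y_n))|`. -/
def transversalDensity (f : S → M)
    (Ψ : Π x : M, TangentSpace (𝓡 (n + 1)) x [⋀^Fin (n + 1)]→ₗ[ℝ] ℝ) (N : FieldAlong n f) :
    DensityField n S :=
  fun p Y ↦ |Ψ (f p) (Matrix.vecCons (N p) (fun i ↦ dAt n f p (Y i)))|

variable [IsManifold (𝓡 n) ∞ S] [IsManifold (𝓡 (n + 1)) ∞ M]

/-- `ν` is a smooth co-oriented section of the line field `W` such that the density `|ι(ν)Ψ|`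
equals the volume density `|vol_k|` of the metric `k` induced by `ν`. -/
structure IsNormalizedSection (f : S → M) (D : ConnOp (n + 1) M)
    (Ψ : Π x : M, TangentSpace (𝓡 (n + 1)) x [⋀^Fin (n + 1)]→ₗ[ℝ] ℝ) (o : Coorientation n f)
    (W : Π p : S, Submodule ℝ (TangentSpace (𝓡 (n + 1)) (f p))) (ν : FieldAlong n f) : Prop where
  smooth : IsSmoothAlongOn f ν univ
  mem_line : ∀ p, ν p ∈ W p
  mem_side : ∀ p, ν p ∈ o.side p
  density_eq : transversalDensity f Ψ ν = metricDensity (inducedMetric f D ν)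

/-- The classical definition of the (co-oriented) equiaffine normal: a smooth co-oriented
transversal `ν` such that the densities `|ι(ν)Ψ|` and `|vol_k|` coincide and are preserved by the
connection induced by `ν`. -/
structure IsClassicalEquiaffineNormal (f : S → M) (D : ConnOp (n + 1) M)
    (Ψ : Π x : M, TangentSpace (𝓡 (n + 1)) x [⋀^Fin (n + 1)]→ₗ[ℝ] ℝ) (o : Coorientation n f)
    (ν : FieldAlong n f) : Prop where
  smooth : IsSmoothAlongOn f ν univ
  mem_side : ∀ p, ν p ∈ o.side p
  density_eq : transversalDensity f Ψ ν = metricDensity (inducedMetric f D ν)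
  preserves_transversalDensity :
    PreservesDensity (inducedConnection f D ν) (transversalDensity f Ψ ν)
  preserves_metricDensity :
    PreservesDensity (inducedConnection f D ν) (metricDensity (inducedMetric f D ν))

end Hypersurface

/-! ### The standard equiaffine structure of `ℝ^m` -/

/-- The standard flat connection on `ℝ^m`: `(∇_v Y)(x)` is the directional derivative of `Y`. -/
def flatConnection (m : ℕ) : CovariantDerivative (𝓡 m) (EuclideanSpace ℝ (Fin m))
    (TangentSpace (𝓡 m) : EuclideanSpace ℝ (Fin m) → Type _) where
  toFun Y x := fderiv ℝ (F := EuclideanSpace ℝ (Fin m)) (fun y ↦ Y y) x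
  isCovariantDerivativeOnUniv := by
    have hd : ∀ (σ : VField m (EuclideanSpace ℝ (Fin m))) x, IsDiffFieldAt σ x →
        DifferentiableAt ℝ (F := EuclideanSpace ℝ (Fin m)) (fun y ↦ σ y) x := by
      intro σ x h
      have := ((mdifferentiableAt_totalSpace _ _).1 h).2
      simp only [trivializationAt_model_space_apply] at this
      exact mdifferentiableAt_iff_differentiableAt.1 this
    constructor
    · intro σ σ' x h h' _
      exact fderiv_add (hd _ _ h) (hd _ _ h')
    · intro σ g x h hg _
      refine (fderiv_smul hg.differentiableAt (hd _ _ h)).trans ?_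
      simp [mvfderiv, mfderiv_eq_fderiv]
      rfl

/-- The standard volume form on `ℝ^m`: the determinant in the standard basis. -/
def standardVolume (m : ℕ) (x : EuclideanSpace ℝ (Fin m)) :
    TangentSpace (𝓡 m) x [⋀^Fin m]→ₗ[ℝ] ℝ :=
  (EuclideanSpace.basisFun (Fin m) ℝ).toBasis.det

end HypersurfaceGeometry

end

/-! Everything rests on how the data of a transversal change under `N' = a N + df(ζ)`. Then `h' =
a⁻¹ h` and `∇' = ∇ - a⁻¹ h ⊗ ζ`. The alignment defect, the one-form `n h^{pq} ∇_p h_{qi} - h^{pq}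
∇_i h_{pq}`, changes by `(n + 2)(n - 1) a⁻¹ h(ζ, ·)`, because its two terms in `da` cancel
(`alignmentDefect_change`). As `n ≥ 2` and `h` is nondegenerate, exactly one `ζ` with `a = 1` kills
the defect, and rescaling an aligned transversal keeps it aligned. So aligned transversals exist
locally (`exists_aligned_transversal`) and are unique up to scale (`eq_smul_of_isAlignedAt`); their
spans glue to `W`.

On `W` only a positive factor is left once a side is chosen. Replacing `N` by `a N` multiplies
`|ι(N)Ψ|` by `a` and `|vol_h|` by `a^(-n/2)`, so in a frame the normalization reads `a^(n+2) = |det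
h| / Ψ(N, …)²`. It has one positive solution, which depends smoothly on the point; uniqueness again
glues the local sections.

For the parallel densities, let `τ` be the connection form of `N` (the `N`-component of `∇̂N`) and
let `T(X) = h^{pq} ∇_X h_{pq}`. If `Ψ` is parallel, then `∇|ι(N)Ψ| = τ ⊗ |ι(N)Ψ|`, while always
`∇|vol_h| = ½ T ⊗ |vol_h|`; hence equal densities force `T = 2τ`. If `∇̂` is projectively flat, its
curvature on tangent vectors `X, Y, Z` is a combination of `X, Y, Z`, so it has no transversal part,
and the traced Codazzi equation (`trace_codazzi`) says that `(n - 1)(T + n τ)` is the defect. For a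
normalized transversal the defect is therefore `(n - 1)(n + 2) τ`: being aligned is the same as
preserving the density (`IsTransversalOn.isAligned_iff`). This one equivalence gives both the
parallelism of the densities and the identification with the classical equiaffine normal of flat
space.

The tensor calculus takes place in charts, where fields along the immersion are maps between
Euclidean spaces and the connection is given by Christoffel symbols. -/

noncomputable section

namespace HypersurfaceGeometry

/-! ### Contractions with a nondegenerate symmetric form -/

section Contraction

variable {ι V : Type*} [Fintype ι] [DecidableEq ι]

/-- The Gram matrix of `h` in the frame `b`. -/
def gram (h : V → V → ℝ) (b : ι → V) : Matrix ι ι ℝ := Matrix.of fun i j ↦ h (b i) (b j)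

/-- The contraction `h^{pq} B_{pq}` in the frame `b`. -/
def contraction (h : V → V → ℝ) (b : ι → V) (B : V → V → ℝ) : ℝ :=
  ∑ p, ∑ q, (gram h b)⁻¹ p q * B (b p) (b q)

/-- The defect of alignment, `n h^{pq} C_{pqi} - h^{pq} C_{ipq}`. -/
def alignmentDefect (h : V → V → ℝ) (b : ι → V) (C : V → V → V → ℝ) (z : V) : ℝ :=
  Fintype.card ι * contraction h b (fun u v ↦ C u v z) - contraction h b (C z)

variable [AddCommGroup V] [Module ℝ V] {h : V →ₗ[ℝ] V →ₗ[ℝ] ℝ}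

/-- A vector in the left kernel of the Gram matrix gives the coefficients of a combination of the `b
i` that is `h`-orthogonal to every basis vector. -/
theorem gram_det_ne_zero (b : Module.Basis ι ℝ V)
    (hnd : ∀ u, (∀ v, h u v = 0) → u = 0) : (gram (fun u v ↦ h u v) b).det ≠ 0 := by
  intro hdet
  obtain ⟨w, hw, hwz⟩ := Matrix.exists_vecMul_eq_zero_iff.2 hdet
  apply hw
  have h0 : ∑ i, w i • b i = 0 := by
    apply hnd
    intro v
    have : h (∑ i, w i • b i) = 0 := by
      apply b.ext
      intro j
      have := congrFun hwz j
      simpa [Matrix.vecMul, dotProduct, gram] using this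
    rw [this]; rfl
  have := Fintype.linearIndependent_iff.1 b.linearIndependent w h0
  ext i; exact this i

variable (b : Module.Basis ι ℝ V) (hdet : (gram (fun u v ↦ h u v) b).det ≠ 0)
include hdet

/-- Raising the index of `h(·, z)` gives back the components of `z`. -/
theorem sum_inv_gram_mul_apply (z : V) (p : ι) :
    ∑ q, (gram (fun u v ↦ h u v) b)⁻¹ p q * h (b q) z = b.repr z p := by
  have hG := Matrix.nonsing_inv_mul (gram (fun u v ↦ h u v) b) (isUnit_iff_ne_zero.2 hdet)
  conv_lhs => rw [← b.sum_repr z]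
  simp only [map_sum, map_smul, smul_eq_mul, Finset.mul_sum]
  rw [Finset.sum_comm]
  have : ∀ r, ∑ q, (gram (fun u v ↦ h u v) b)⁻¹ p q * (b.repr z r * h (b q) (b r)) =
      b.repr z r * (1 : Matrix ι ι ℝ) p r := by
    intro r
    rw [← hG, Matrix.mul_apply, Finset.mul_sum]
    exact Finset.sum_congr rfl fun q _ ↦ by simp [gram]; ring
  simp [this, Matrix.one_apply]

/-- The index rule `h^{pq} α_p h_{qz} = α_z`. Together with `contraction_self` it accounts for every
trace below. -/
theorem contraction_mul_apply (α : V →ₗ[ℝ] ℝ) (z : V) :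
    contraction (fun u v ↦ h u v) b (fun u v ↦ α u * h v z) = α z := by
  unfold contraction
  have : ∀ p, ∑ q, (gram (fun u v ↦ h u v) b)⁻¹ p q * (α (b p) * h (b q) z) =
      b.repr z p * α (b p) := by
    intro p
    rw [← sum_inv_gram_mul_apply b hdet z p, Finset.sum_mul]
    exact Finset.sum_congr rfl fun q _ ↦ by ring
  simp_rw [this]
  conv_rhs => rw [← b.sum_repr z]
  simp only [map_sum, map_smul, smul_eq_mul]

-- The inverse of a symmetric matrix is symmetric, so the two slots of a contraction may be
-- exchanged.
omit hdet in
theorem contraction_swap (hs : ∀ u v, h u v = h v u) (B : V → V → ℝ) :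
    contraction (fun u v ↦ h u v) b (fun u v ↦ B v u) = contraction (fun u v ↦ h u v) b B := by
  unfold contraction
  rw [Finset.sum_comm]
  have hT : (gram (fun u v ↦ h u v) b).transpose = gram (fun u v ↦ h u v) b := by
    ext i j; simp [gram, hs (b i)]
  have : ∀ p q, (gram (fun u v ↦ h u v) b)⁻¹ p q = (gram (fun u v ↦ h u v) b)⁻¹ q p := by
    intro p q
    conv_lhs => rw [← hT, ← Matrix.transpose_nonsing_inv]
    rfl
  exact Finset.sum_congr rfl fun p _ ↦ Finset.sum_congr rfl fun q _ ↦ by rw [this]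

theorem contraction_self (hs : ∀ u v, h u v = h v u) :
    contraction (fun u v ↦ h u v) b (fun u v ↦ h u v) = Fintype.card ι := by
  have hG := Matrix.nonsing_inv_mul (gram (fun u v ↦ h u v) b) (isUnit_iff_ne_zero.2 hdet)
  have : ∀ p, ∑ q, (gram (fun u v ↦ h u v) b)⁻¹ p q * h (b p) (b q) = 1 := by
    intro p
    have := congrFun (congrFun hG p) p
    rw [Matrix.mul_apply, Matrix.one_apply_eq] at this
    rw [← this]
    exact Finset.sum_congr rfl fun q _ ↦ by simp [gram, hs (b p)]
  simp [contraction, this]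

omit hdet in
theorem contraction_add (k B B' : V → V → ℝ) :
    contraction k b (fun u v ↦ B u v + B' u v) = contraction k b B + contraction k b B' := by
  simp [contraction, mul_add, Finset.sum_add_distrib]

omit hdet in
theorem contraction_sub (k B B' : V → V → ℝ) :
    contraction k b (fun u v ↦ B u v - B' u v) = contraction k b B - contraction k b B' := by
  simp [contraction, mul_sub, Finset.sum_sub_distrib]

omit hdet in
theorem contraction_const_mul (k B : V → V → ℝ) (c : ℝ) :
    contraction k b (fun u v ↦ c * B u v) = c * contraction k b B := by
  simp only [contraction, Finset.mul_sum]
  exact Finset.sum_congr rfl fun p _ ↦ Finset.sum_congr rfl fun q _ ↦ by ring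

omit hdet in
theorem contraction_sum {κ : Type*} (s : Finset κ) (k : V → V → ℝ) (B : κ → V → V → ℝ) :
    contraction k b (fun u v ↦ ∑ i ∈ s, B i u v) = ∑ i ∈ s, contraction k b (B i) := by
  classical
  induction s using Finset.induction_on with
  | empty => simp [contraction]
  | insert a s ha ih => simp only [Finset.sum_insert ha, contraction_add, ih]

omit hdet in
theorem contraction_const_mul_left (k B : V → V → ℝ) {c : ℝ} (hc : c ≠ 0) :
    contraction (fun u v ↦ c * k u v) b B = c⁻¹ * contraction k b B := by
  have : gram (fun u v ↦ c * k u v) b = c • gram k b := by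
    ext i j; simp [gram]
  have h2 : (c • gram k b)⁻¹ = c⁻¹ • (gram k b)⁻¹ := by
    -- Nondegeneracy is not needed: a singular matrix has inverse `0` by convention, on both sides.
    by_cases hk : IsUnit (gram k b).det
    · exact Matrix.inv_smul' (k := Units.mk0 c hc) _ hk
    · rw [Matrix.nonsing_inv_apply_not_isUnit _ hk, Matrix.nonsing_inv_apply_not_isUnit, smul_zero]
      rw [Matrix.det_smul]
      rw [isUnit_iff_ne_zero, not_not] at hk ⊢
      simp [hk]
  simp only [contraction, this, h2, Finset.mul_sum, Matrix.smul_apply, smul_eq_mul, mul_assoc]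

/-- A nondegenerate form represents every linear functional. -/
theorem exists_forall_apply_eq (hs : ∀ u v, h u v = h v u) (α : V →ₗ[ℝ] ℝ) :
    h (∑ p, (∑ q, (gram (fun u v ↦ h u v) b)⁻¹ p q * α (b q)) • b p) = α := by
  have hG := Matrix.mul_nonsing_inv (gram (fun u v ↦ h u v) b) (isUnit_iff_ne_zero.2 hdet)
  apply b.ext
  intro r
  have : ∀ p, (∑ q, (gram (fun u v ↦ h u v) b)⁻¹ p q * α (b q)) * h (b p) (b r) =
      ∑ q, α (b q) * ((gram (fun u v ↦ h u v) b) r p * (gram (fun u v ↦ h u v) b)⁻¹ p q) := by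
    intro p
    rw [Finset.sum_mul]
    exact Finset.sum_congr rfl fun q _ ↦ by rw [hs]; simp [gram]; ring
  simp only [map_sum, map_smul, LinearMap.sum_apply, LinearMap.smul_apply, smul_eq_mul, this]
  rw [Finset.sum_comm]
  simp_rw [← Finset.mul_sum, ← Matrix.mul_apply, hG]
  simp [Matrix.one_apply]

/-- Nondegeneracy turns each functional `B (b i)` into some `h(z i, ·)`, so `B` is a sum of products
`α ⊗ h(·, z)`. Each of these has the contraction `α z`, in which no basis occurs. -/
theorem contraction_basis_independent (hs : ∀ u v, h u v = h v u)
    {κ : Type*} [Fintype κ] [DecidableEq κ] (b' : Module.Basis κ ℝ V)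
    (hdet' : (gram (fun u v ↦ h u v) b').det ≠ 0) (B : V →ₗ[ℝ] V →ₗ[ℝ] ℝ) :
    contraction (fun u v ↦ h u v) b' (fun u v ↦ B u v) =
      contraction (fun u v ↦ h u v) b (fun u v ↦ B u v) := by
  have hz : ∀ i, ∃ z, h z = B (b i) := fun i ↦ ⟨_, exists_forall_apply_eq b hdet hs (B (b i))⟩
  choose z hz using hz
  have hB : (fun u v ↦ B u v) = fun u v ↦ ∑ i, b.coord i u * h v (z i) := by
    ext u v
    conv_lhs => rw [← b.sum_repr u]
    simp only [map_sum, map_smul, LinearMap.sum_apply, LinearMap.smul_apply, smul_eq_mul, hs v, hz,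
      Module.Basis.coord_apply]
  rw [hB, contraction_sum, contraction_sum]
  exact Finset.sum_congr rfl fun i _ ↦ by
    rw [contraction_mul_apply b' hdet', contraction_mul_apply b hdet]

/-- Behaviour of the alignment defect under the change of transversal `N ↦ a N + ζ`. -/
theorem alignmentDefect_change (hs : ∀ u v, h u v = h v u) (C : V → V → V → ℝ)
    (α : V →ₗ[ℝ] ℝ) {a : ℝ} (ha : a ≠ 0) (ζ z : V) :
    alignmentDefect (fun u v ↦ a⁻¹ * h u v) b (fun u v w ↦ a⁻¹ * C u v w - (a ^ 2)⁻¹ * (α u * h v w)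
        + (a ^ 2)⁻¹ * (h u v * h ζ w + h u w * h v ζ)) z =
      alignmentDefect (fun u v ↦ h u v) b C z +
        ((Fintype.card ι + 2) * (Fintype.card ι - 1) * a⁻¹) * h ζ z := by
  unfold alignmentDefect
  have ha' := inv_ne_zero ha
  rw [contraction_const_mul_left _ _ _ ha', contraction_const_mul_left _ _ _ ha']
  simp only [contraction_add, contraction_sub, contraction_const_mul]
  rw [contraction_mul_apply b hdet]
  have e1 : contraction (fun u v ↦ h u v) b (fun u v ↦ h u v * h ζ z) =
      Fintype.card ι * h ζ z := by
    rw [← contraction_self b hdet hs, mul_comm, ← contraction_const_mul]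
    simp only [mul_comm]
  have e2 : contraction (fun u v ↦ h u v) b (fun u v ↦ h u z * h v ζ) = h ζ z :=
    contraction_mul_apply b hdet (h.flip z) ζ
  have e4 : contraction (fun u v ↦ h u v) b (fun u v ↦ h z v * h u ζ) = h ζ z := by
    rw [← contraction_swap b hs, hs ζ]
    exact contraction_mul_apply b hdet (h z) ζ
  have e3 : contraction (fun u v ↦ h u v) b (fun u v ↦ h z u * h ζ v) = h ζ z := by
    rw [hs ζ, ← contraction_mul_apply b hdet (h z) ζ]
    simp only [hs ζ]
  -- The form `α` contributes `-n a⁻¹ α z` to the first term of the defect and to the second, and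
  -- drops out. The coefficient of `a⁻¹ h ζ z` is `n (n + 1) - 2 = (n + 2)(n - 1)`.
  rw [e1, e2, e3, e4, contraction_self b hdet hs]
  field_simp
  ring

end Contraction

/-! ### Hypersurfaces in coordinates

`E` and `E'` are the coordinate spaces of the hypersurface and of the ambient manifold, `F` is the
coordinate expression of the immersion, `N` that of a transversal, and `Γ y w u` is the Christoffel
symbol `∇_u w` at `y` of constant fields `u` and `w`. -/

section Coordinates

set_option maxSynthPendingDepth 3

variable {E E' : Type*} [NormedAddCommGroup E] [NormedSpace ℝ E]
  [NormedAddCommGroup E'] [NormedSpace ℝ E']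

/-- The covariant derivative of a field along `F`. -/
def coordCovDeriv (Γ : E' → E' →L[ℝ] E' →L[ℝ] E') (F v : E → E') (x : E) : E →L[ℝ] E' :=
  fderiv ℝ v x + Γ (F x) (v x) ∘L fderiv ℝ F x

/-- The curvature of the connection with Christoffel symbols `Γ` on constant fields. -/
def coordCurvature (Γ : E' → E' →L[ℝ] E' →L[ℝ] E') (y u u' w : E') : E' :=
  fderiv ℝ Γ y u w u' - fderiv ℝ Γ y u' w u + (Γ y (Γ y w u') u - Γ y (Γ y w u) u')

/-- The covariant derivative `∇̂_X Y` of constant tangent fields. -/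
def coordSff (Γ : E' → E' →L[ℝ] E' →L[ℝ] E') (F : E → E') (x : E) : E →L[ℝ] E →L[ℝ] E' :=
  fderiv ℝ (fderiv ℝ F) x + (Γ (F x)).flip.bilinearComp (fderiv ℝ F x) (fderiv ℝ F x)

/-- The map `(Y, c) ↦ dF(Y) + c N`. -/
def coordSplitting (F N : E → E') (x : E) : (E × ℝ) →L[ℝ] E' :=
  (fderiv ℝ F x).coprod (ContinuousLinearMap.toSpanSingleton ℝ (N x))

/-- The component along the hypersurface of an ambient vector. -/
def tangentialPart (F N : E → E') (x : E) : E' →L[ℝ] E :=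
  ContinuousLinearMap.fst ℝ E ℝ ∘L (coordSplitting F N x).inverse

/-- The component along the transversal of an ambient vector. -/
def transversalPart (F N : E → E') (x : E) : E' →L[ℝ] ℝ :=
  ContinuousLinearMap.snd ℝ E ℝ ∘L (coordSplitting F N x).inverse

/-- The induced metric. -/
def coordMetric (Γ : E' → E' →L[ℝ] E' →L[ℝ] E') (F N : E → E') (x : E) : E →L[ℝ] E →L[ℝ] ℝ :=
  ContinuousLinearMap.compL ℝ E E' ℝ (transversalPart F N x) ∘L coordSff Γ F x

/-- The Christoffel symbols of the induced connection. -/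
def coordConn (Γ : E' → E' →L[ℝ] E' →L[ℝ] E') (F N : E → E') (x : E) : E →L[ℝ] E →L[ℝ] E :=
  ContinuousLinearMap.compL ℝ E E' E (tangentialPart F N x) ∘L coordSff Γ F x

/-- The covariant derivative of the induced metric. -/
def coordCubic (Γ : E' → E' →L[ℝ] E' →L[ℝ] E') (F N : E → E') (x : E) (X Y Z : E) : ℝ :=
  fderiv ℝ (coordMetric Γ F N) x X Y Z - coordMetric Γ F N x (coordConn Γ F N x X Y) Z
    - coordMetric Γ F N x Y (coordConn Γ F N x X Z)

/-- The connection form `τ` of the transversal. -/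
def coordConnForm (Γ : E' → E' →L[ℝ] E' →L[ℝ] E') (F N : E → E') (x : E) : E →L[ℝ] ℝ :=
  transversalPart F N x ∘L coordCovDeriv Γ F N x

/-- `F` is a smooth map on the open set `Ω`, and `Γ` are the Christoffel symbols of a smooth
torsion-free connection near its image. -/
structure IsLocalMap (Γ : E' → E' →L[ℝ] E' →L[ℝ] E') (F : E → E') (Ω : Set E) : Prop where
  isOpen : IsOpen Ω
  smooth : ContDiffOn ℝ ∞ F Ω
  smooth_christoffel : ∀ x ∈ Ω, ContDiffAt ℝ ∞ Γ (F x)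
  symm : ∀ x ∈ Ω, ∀ u w, Γ (F x) u w = Γ (F x) w u

/-- `N` is a smooth transversal to `F` on `Ω`. -/
structure IsLocalTransversal (F N : E → E') (Ω : Set E) : Prop where
  smooth : ContDiffOn ℝ ∞ N Ω
  isInvertible : ∀ x ∈ Ω, (coordSplitting F N x).IsInvertible

variable {Γ : E' → E' →L[ℝ] E' →L[ℝ] E'} {F N N' : E → E'} {x : E} {Ω : Set E}

@[simp] theorem coordCovDeriv_apply (v : E → E') (X : E) :
    coordCovDeriv Γ F v x X = fderiv ℝ v x X + Γ (F x) (v x) (fderiv ℝ F x X) := rfl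

theorem coordCovDeriv_congr {v w : E → E'} (h : v =ᶠ[nhds x] w) :
    coordCovDeriv Γ F v x = coordCovDeriv Γ F w x := by
  rw [coordCovDeriv, coordCovDeriv, h.fderiv_eq, h.eq_of_nhds]

@[simp] theorem coordSff_apply (X Y : E) :
    coordSff Γ F x X Y =
      fderiv ℝ (fderiv ℝ F) x X Y + Γ (F x) (fderiv ℝ F x Y) (fderiv ℝ F x X) := rfl

@[simp] theorem coordSplitting_apply (w : E × ℝ) :
    coordSplitting F N x w = fderiv ℝ F x w.1 + w.2 • N x := by
  simp [coordSplitting]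

theorem coordMetric_apply (X Y : E) :
    coordMetric Γ F N x X Y = transversalPart F N x (coordSff Γ F x X Y) := rfl

theorem coordConn_apply (X Y : E) :
    coordConn Γ F N x X Y = tangentialPart F N x (coordSff Γ F x X Y) := rfl

/-! ### Tangential and transversal components at a point -/

section Pointwise

variable (hL : (coordSplitting F N x).IsInvertible)
include hL

theorem inverse_coordSplitting (u : E) (c : ℝ) :
    (coordSplitting F N x).inverse (fderiv ℝ F x u + c • N x) = (u, c) := by
  rw [hL.inverse_apply_eq]; simp

theorem tangentialPart_add (u : E) (c : ℝ) :
    tangentialPart F N x (fderiv ℝ F x u + c • N x) = u := by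
  simp [tangentialPart, inverse_coordSplitting hL]

theorem transversalPart_add (u : E) (c : ℝ) :
    transversalPart F N x (fderiv ℝ F x u + c • N x) = c := by
  simp [transversalPart, inverse_coordSplitting hL]

@[simp] theorem transversalPart_fderiv (u : E) :
    transversalPart F N x (fderiv ℝ F x u) = 0 := by
  simpa using transversalPart_add hL u 0

@[simp] theorem tangentialPart_fderiv (u : E) :
    tangentialPart F N x (fderiv ℝ F x u) = u := by
  simpa using tangentialPart_add hL u 0

@[simp] theorem transversalPart_self : transversalPart F N x (N x) = 1 := by
  simpa using transversalPart_add hL 0 1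

theorem fderiv_tangentialPart_add (w : E') :
    fderiv ℝ F x (tangentialPart F N x w) + transversalPart F N x w • N x = w := by
  have := hL.self_apply_inverse w
  simpa [tangentialPart, transversalPart] using this

theorem coordSff_eq (X Y : E) :
    coordSff Γ F x X Y = fderiv ℝ F x (coordConn Γ F N x X Y) + coordMetric Γ F N x X Y • N x :=
  (fderiv_tangentialPart_add hL _).symm

theorem transversalPart_eq_zero_iff (w : E') :
    transversalPart F N x w = 0 ↔ w ∈ (fderiv ℝ F x).range := by
  constructor
  · intro h
    have := fderiv_tangentialPart_add hL w
    rw [h, zero_smul, add_zero] at this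
    exact ⟨_, this⟩
  · rintro ⟨u, rfl⟩
    exact transversalPart_fderiv hL u

/-- A combination `a N + dF(ζ)` with `a ≠ 0` is again transverse. -/
theorem isInvertible_coordSplitting_change {a : ℝ} {ζ : E} (ha : a ≠ 0)
    (hN' : N' x = a • N x + fderiv ℝ F x ζ) : (coordSplitting F N' x).IsInvertible := by
  -- The new splitting is the old one after the invertible map `(u, c) ↦ (u + c ζ, a c)`.
  have hcomp : coordSplitting F N' x = coordSplitting F N x ∘L
      ((ContinuousLinearMap.fst ℝ E ℝ + (ContinuousLinearMap.snd ℝ E ℝ).smulRight ζ).prod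
        (a • ContinuousLinearMap.snd ℝ E ℝ)) := by
    ext w <;> simp [hN', smul_smul]
    abel
  rw [hcomp]
  refine hL.comp (ContinuousLinearMap.IsInvertible.of_inverse
    (g := (ContinuousLinearMap.fst ℝ E ℝ - (a⁻¹ • ContinuousLinearMap.snd ℝ E ℝ).smulRight ζ).prod
        (a⁻¹ • ContinuousLinearMap.snd ℝ E ℝ)) ?_ ?_)
  · ext w <;> simp [ha]
  · ext w <;> simp [ha]

variable {a : ℝ} {ζ : E} (ha : a ≠ 0) (hN' : N' x = a • N x + fderiv ℝ F x ζ)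
include ha hN'

/-- Substituting `N = a⁻¹ (N' - dF(ζ))` in the Gauss formula `∇̂_X Y = dF(∇_X Y) + h(X, Y) N` gives
the components with respect to `N'`. The same decomposition yields `coordConn_change`. -/
theorem coordMetric_change (X Y : E) :
    coordMetric Γ F N' x X Y = a⁻¹ * coordMetric Γ F N x X Y := by
  have hL' := isInvertible_coordSplitting_change hL ha hN'
  have : coordSff Γ F x X Y = fderiv ℝ F x (coordConn Γ F N x X Y
      - (a⁻¹ * coordMetric Γ F N x X Y) • ζ) + (a⁻¹ * coordMetric Γ F N x X Y) • N' x := by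
    rw [coordSff_eq hL, hN', smul_add, smul_smul, map_sub, map_smul]
    field_simp
    abel
  rw [coordMetric_apply, this, transversalPart_add hL']

theorem coordConn_change (X Y : E) :
    coordConn Γ F N' x X Y =
      coordConn Γ F N x X Y - (a⁻¹ * coordMetric Γ F N x X Y) • ζ := by
  have hL' := isInvertible_coordSplitting_change hL ha hN'
  have : coordSff Γ F x X Y = fderiv ℝ F x (coordConn Γ F N x X Y
      - (a⁻¹ * coordMetric Γ F N x X Y) • ζ) + (a⁻¹ * coordMetric Γ F N x X Y) • N' x := by
    rw [coordSff_eq hL, hN', smul_add, smul_smul, map_sub, map_smul]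
    field_simp
    abel
  rw [coordConn_apply, this, tangentialPart_add hL']

end Pointwise

/-! ### Smooth dependence on the point, and the change of the cubic form -/

section Smooth

namespace IsLocalMap

variable (hF : IsLocalMap Γ F Ω)
include hF

theorem contDiffAt (hx : x ∈ Ω) : ContDiffAt ℝ ∞ F x :=
  hF.smooth.contDiffAt (hF.isOpen.mem_nhds hx)

theorem contDiffAt_fderiv (hx : x ∈ Ω) : ContDiffAt ℝ ∞ (fderiv ℝ F) x :=
  (hF.contDiffAt hx).fderiv_right (m := ∞) (by simp)

theorem contDiffAt_fderiv_fderiv (hx : x ∈ Ω) : ContDiffAt ℝ ∞ (fderiv ℝ (fderiv ℝ F)) x :=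
  (hF.contDiffAt_fderiv hx).fderiv_right (m := ∞) (by simp)

theorem contDiffAt_christoffel (hx : x ∈ Ω) : ContDiffAt ℝ ∞ (fun y ↦ Γ (F y)) x :=
  (hF.smooth_christoffel x hx).comp x (hF.contDiffAt hx)

theorem contDiffAt_coordSff_apply (hx : x ∈ Ω) (X Y : E) :
    ContDiffAt ℝ ∞ (fun y ↦ coordSff Γ F y X Y) x := by
  simp only [coordSff_apply]
  have h1 := hF.contDiffAt_fderiv hx
  have h2 := hF.contDiffAt_fderiv_fderiv hx
  have h3 := hF.contDiffAt_christoffel hx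
  exact ((h2.clm_apply contDiffAt_const).clm_apply contDiffAt_const).add
    ((h3.clm_apply (h1.clm_apply contDiffAt_const)).clm_apply (h1.clm_apply contDiffAt_const))

theorem fderiv_fderiv_symm (hx : x ∈ Ω) (X Y : E) :
    fderiv ℝ (fderiv ℝ F) x X Y = fderiv ℝ (fderiv ℝ F) x Y X :=
  (hF.contDiffAt hx).isSymmSndFDerivAt (by simp; norm_cast) X Y

theorem coordSff_symm (hx : x ∈ Ω) (X Y : E) : coordSff Γ F x X Y = coordSff Γ F x Y X := by
  rw [coordSff_apply, coordSff_apply, hF.fderiv_fderiv_symm hx, hF.symm x hx]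

theorem coordMetric_symm (hx : x ∈ Ω) (X Y : E) :
    coordMetric Γ F N x X Y = coordMetric Γ F N x Y X := by
  rw [coordMetric_apply, coordMetric_apply, hF.coordSff_symm hx]

theorem coordConn_symm (hx : x ∈ Ω) (X Y : E) :
    coordConn Γ F N x X Y = coordConn Γ F N x Y X := by
  rw [coordConn_apply, coordConn_apply, hF.coordSff_symm hx]

end IsLocalMap

/-- Smoothness of an operator-valued map may be tested vector by vector when the source is
finite-dimensional. Applied twice, it handles the bilinear maps `coordMetric` and `coordConn`. -/
theorem contDiffAt_clm_of_apply {D G H : Type*} [NormedAddCommGroup D] [NormedSpace ℝ D]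
    [NormedAddCommGroup G] [NormedSpace ℝ G] [NormedAddCommGroup H] [NormedSpace ℝ H]
    [FiniteDimensional ℝ G] {f : D → G →L[ℝ] H} {s : Set D} (hs : IsOpen s)
    (h : ∀ v, ∀ y ∈ s, ContDiffAt ℝ ∞ (fun z ↦ f z v) y) {y : D} (hy : y ∈ s) :
    ContDiffAt ℝ ∞ f y :=
  (contDiffOn_clm_apply.2 fun v z hz ↦ (h v z hz).contDiffWithinAt).contDiffAt (hs.mem_nhds hy)

variable [FiniteDimensional ℝ E]
  (hF : IsLocalMap Γ F Ω) (hN : IsLocalTransversal F N Ω) (hx : x ∈ Ω)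


include hF in
theorem IsLocalMap.contDiffAt_coordSplitting {N : E → E'} (hN : ContDiffOn ℝ ∞ N Ω) (hx : x ∈ Ω) :
    ContDiffAt ℝ ∞ (coordSplitting F N) x := by
  refine contDiffAt_clm_of_apply hF.isOpen (fun v y hy ↦ ?_) hx
  simp only [coordSplitting_apply]
  exact ((hF.contDiffAt_fderiv hy).clm_apply contDiffAt_const).add
    (contDiffAt_const.smul (hN.contDiffAt (hF.isOpen.mem_nhds hy)))

include hF hN hx

theorem contDiffAt_inverse_coordSplitting :
    ContDiffAt ℝ ∞ (fun y ↦ (coordSplitting F N y).inverse) x := by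
  have : CompleteSpace E := FiniteDimensional.complete ℝ E
  exact (hN.isInvertible x hx).contDiffAt_map_inverse.comp x (hF.contDiffAt_coordSplitting hN.smooth hx)

theorem contDiffAt_transversalPart : ContDiffAt ℝ ∞ (transversalPart F N) x :=
  contDiffAt_const.clm_comp (contDiffAt_inverse_coordSplitting hF hN hx)

theorem contDiffAt_tangentialPart : ContDiffAt ℝ ∞ (tangentialPart F N) x :=
  contDiffAt_const.clm_comp (contDiffAt_inverse_coordSplitting hF hN hx)

theorem contDiffAt_coordMetric : ContDiffAt ℝ ∞ (coordMetric Γ F N) x := by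
  refine contDiffAt_clm_of_apply hF.isOpen (fun X y hy ↦ ?_) hx
  refine contDiffAt_clm_of_apply hF.isOpen (fun Y z hz ↦ ?_) hy
  exact (contDiffAt_transversalPart hF hN hz).clm_apply (hF.contDiffAt_coordSff_apply hz X Y)

theorem contDiffAt_coordConn : ContDiffAt ℝ ∞ (coordConn Γ F N) x := by
  refine contDiffAt_clm_of_apply hF.isOpen (fun X y hy ↦ ?_) hx
  refine contDiffAt_clm_of_apply hF.isOpen (fun Y z hz ↦ ?_) hy
  exact (contDiffAt_tangentialPart hF hN hz).clm_apply (hF.contDiffAt_coordSff_apply hz X Y)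

theorem contDiffAt_coordCubic (X Y Z : E) :
    ContDiffAt ℝ ∞ (fun y ↦ coordCubic Γ F N y X Y Z) x := by
  have h1 := contDiffAt_coordMetric hF hN hx
  have h2 := contDiffAt_coordConn hF hN hx
  have h3 : ContDiffAt ℝ ∞ (fderiv ℝ (coordMetric Γ F N)) x := h1.fderiv_right (m := ∞) (by simp)
  have c : ∀ v : E, ContDiffAt ℝ ∞ (fun _ : E ↦ v) x := fun v ↦ contDiffAt_const
  exact ((((h3.clm_apply (c X)).clm_apply (c Y)).clm_apply (c Z)).sub
    ((h1.clm_apply ((h2.clm_apply (c X)).clm_apply (c Y))).clm_apply (c Z))).sub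
    ((h1.clm_apply (c Y)).clm_apply ((h2.clm_apply (c X)).clm_apply (c Z)))

/-- The covariant derivative of the induced metric after the change of transversal
`N' = a N + dF(ζ)`. -/
theorem coordCubic_change {a : E → ℝ} {ζ : E → E}
    (ha : ContDiffAt ℝ ∞ a x) (ha0 : ∀ y ∈ Ω, a y ≠ 0)
    (hN' : ∀ y ∈ Ω, N' y = a y • N y + fderiv ℝ F y (ζ y)) (X Y Z : E) :
    coordCubic Γ F N' x X Y Z = (a x)⁻¹ * coordCubic Γ F N x X Y Z
      - ((a x) ^ 2)⁻¹ * (fderiv ℝ a x X * coordMetric Γ F N x Y Z)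
      + ((a x) ^ 2)⁻¹ * (coordMetric Γ F N x X Y * coordMetric Γ F N x (ζ x) Z
        + coordMetric Γ F N x X Z * coordMetric Γ F N x Y (ζ x)) := by
  have hmet : coordMetric Γ F N' =ᶠ[nhds x] fun y ↦ (a y)⁻¹ • coordMetric Γ F N y := by
    filter_upwards [hF.isOpen.mem_nhds hx] with y hy
    ext X Y
    simp [coordMetric_change (hN.isInvertible y hy) (ha0 y hy) (hN' y hy)]
  have hd : HasFDerivAt (fun y ↦ (a y)⁻¹ • coordMetric Γ F N y)
      ((a x)⁻¹ • fderiv ℝ (coordMetric Γ F N) x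
        + (-((a x) ^ 2)⁻¹ • fderiv ℝ a x).smulRight (coordMetric Γ F N x)) x := by
    have h1 := ((contDiffAt_coordMetric hF hN hx).differentiableAt (by simp)).hasFDerivAt
    have h2 := (ha.differentiableAt (by simp)).hasFDerivAt
    exact ((hasDerivAt_inv (ha0 x hx)).comp_hasFDerivAt x h2).smul h1
  unfold coordCubic
  rw [hmet.fderiv_eq, hd.fderiv]
  have hL := hN.isInvertible x hx
  -- The term in `da` comes from differentiating `a⁻¹`. The terms in `ζ` come from the correction
  -- `-a⁻¹ h ⊗ ζ` of the connection, multiplied by the factor `a⁻¹` of the new metric.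
  simp only [coordMetric_change hL (ha0 x hx) (hN' x hx), coordConn_change hL (ha0 x hx) (hN' x hx)]
  simp only [add_apply, smul_apply,
    ContinuousLinearMap.smulRight_apply, map_sub, map_smul, sub_apply,
    smul_eq_mul]
  ring

end Smooth

/-! ### Ricci identity and Codazzi equation -/

section Codazzi

/-- The Ricci identity for fields along a map. -/
theorem coordCovDeriv_commute {v : E → E'} (hv : ContDiffAt ℝ ∞ v x) (hF : ContDiffAt ℝ ∞ F x)
    (hΓ : ContDiffAt ℝ ∞ Γ (F x)) (X Y : E) :
    coordCovDeriv Γ F (fun y ↦ coordCovDeriv Γ F v y Y) x X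
      - coordCovDeriv Γ F (fun y ↦ coordCovDeriv Γ F v y X) x Y =
      coordCurvature Γ (F x) (fderiv ℝ F x X) (fderiv ℝ F x Y) (v x) := by
  have hv1 := (hv.differentiableAt (by simp)).hasFDerivAt
  have hF1 := (hF.differentiableAt (by simp)).hasFDerivAt
  have hv2 := ((hv.fderiv_right (m := ∞) (by simp)).differentiableAt (by simp)).hasFDerivAt
  have hF2 := ((hF.fderiv_right (m := ∞) (by simp)).differentiableAt (by simp)).hasFDerivAt
  have hG := (hΓ.differentiableAt (by simp)).hasFDerivAt.comp x hF1
  have key : ∀ Y, HasFDerivAt (fun y ↦ coordCovDeriv Γ F v y Y) _ x := fun Y ↦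
    (hv2.clm_apply (hasFDerivAt_const Y x)).add
      ((hG.clm_apply hv1).clm_apply (hF2.clm_apply (hasFDerivAt_const Y x)))
  -- A covariant derivative involves only the value and the ordinary derivative at `x`; the latter
  -- is supplied by `key`. On antisymmetrizing, the second derivatives of `v` and `F` cancel and
  -- only the curvature remains.
  have key' : ∀ X Y, coordCovDeriv Γ F (fun y ↦ coordCovDeriv Γ F v y Y) x X = _ := fun X Y ↦
    congrArg (fun T : E →L[ℝ] E' ↦ T X + Γ (F x) (coordCovDeriv Γ F v x Y) (fderiv ℝ F x X))
      (key Y).fderiv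
  rw [key', key']
  simp only [coordCovDeriv_apply, coordCurvature, add_apply,
    ContinuousLinearMap.comp_apply, ContinuousLinearMap.flip_apply, map_add,
    Function.comp_apply]
  have sv : fderiv ℝ (fderiv ℝ v) x X Y = fderiv ℝ (fderiv ℝ v) x Y X :=
    hv.isSymmSndFDerivAt (by simp; norm_cast) X Y
  have sF : fderiv ℝ (fderiv ℝ F) x X Y = fderiv ℝ (fderiv ℝ F) x Y X :=
    hF.isSymmSndFDerivAt (by simp; norm_cast) X Y
  simp [sv, sF]
  abel

variable [FiniteDimensional ℝ E]
  (hF : IsLocalMap Γ F Ω) (hN : IsLocalTransversal F N Ω) (hx : x ∈ Ω)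
include hF hN hx

/-- The Gauss formula differentiated once more. The derivative of `N` is left undecomposed: in the
Codazzi equation only its transversal component `τ` matters. -/
theorem coordCovDeriv_coordSff (X Y Z : E) :
    coordCovDeriv Γ F (fun y ↦ coordSff Γ F y Y Z) x X =
      fderiv ℝ F x (fderiv ℝ (coordConn Γ F N) x X Y Z) + coordSff Γ F x X (coordConn Γ F N x Y Z)
        + fderiv ℝ (coordMetric Γ F N) x X Y Z • N x
        + coordMetric Γ F N x Y Z • coordCovDeriv Γ F N x X := by
  have hF2 := ((hF.contDiffAt_fderiv hx).differentiableAt (by simp)).hasFDerivAt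
  have hG := ((contDiffAt_coordConn hF hN hx).differentiableAt (by simp)).hasFDerivAt
  have hh := ((contDiffAt_coordMetric hF hN hx).differentiableAt (by simp)).hasFDerivAt
  have hN1 := ((hN.smooth.contDiffAt (hF.isOpen.mem_nhds hx)).differentiableAt (by simp)).hasFDerivAt
  have heq : (fun y ↦ coordSff Γ F y Y Z) =ᶠ[nhds x] fun y ↦
      fderiv ℝ F y (coordConn Γ F N y Y Z) + coordMetric Γ F N y Y Z • N y := by
    filter_upwards [hF.isOpen.mem_nhds hx] with y hy
    exact coordSff_eq (hN.isInvertible y hy) Y Z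
  have key := (hF2.clm_apply ((hG.clm_apply (hasFDerivAt_const Y x)).clm_apply
    (hasFDerivAt_const Z x))).add
    (((hh.clm_apply (hasFDerivAt_const Y x)).clm_apply (hasFDerivAt_const Z x)).smul hN1)
  have e : coordCovDeriv Γ F (fun y ↦ coordSff Γ F y Y Z) x X = _ :=
    congrArg (fun T : E →L[ℝ] E' ↦ T X + Γ (F x) (coordSff Γ F x Y Z) (fderiv ℝ F x X))
      (heq.fderiv_eq.trans key.fderiv)
  rw [e, coordSff_eq (hN.isInvertible x hx) Y Z]
  simp
  abel

/-- The Codazzi equation. -/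
theorem codazzi (X Y Z : E) :
    (coordCubic Γ F N x X Y Z + coordConnForm Γ F N x X * coordMetric Γ F N x Y Z)
      - (coordCubic Γ F N x Y X Z + coordConnForm Γ F N x Y * coordMetric Γ F N x X Z) =
    transversalPart F N x
      (coordCurvature Γ (F x) (fderiv ℝ F x X) (fderiv ℝ F x Y) (fderiv ℝ F x Z)) := by
  have hZ : ContDiffAt ℝ ∞ (fun y ↦ fderiv ℝ F y Z) x :=
    (hF.contDiffAt_fderiv hx).clm_apply contDiffAt_const
  rw [← coordCovDeriv_commute hZ (hF.contDiffAt hx) (hF.smooth_christoffel x hx) X Y]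
  -- The Ricci identity is applied to the tangent field `dF(Z)` with `Z` constant, whose first
  -- covariant derivative is `∇̂_Y Z`.
  have hB : ∀ Y, (fun y ↦ coordCovDeriv Γ F (fun y ↦ fderiv ℝ F y Z) y Y) =ᶠ[nhds x]
      fun y ↦ coordSff Γ F y Y Z := by
    intro Y
    filter_upwards [hF.isOpen.mem_nhds hx] with y hy
    have hF2 := ((hF.contDiffAt_fderiv hy).differentiableAt (by simp)).hasFDerivAt
    have := (hF2.clm_apply (hasFDerivAt_const Z y)).fderiv
    simp [this]
  have hB' : ∀ X Y, coordCovDeriv Γ F (fun y ↦ coordCovDeriv Γ F (fun y ↦ fderiv ℝ F y Z) y Y) x X =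
      coordCovDeriv Γ F (fun y ↦ coordSff Γ F y Y Z) x X := by
    intro X Y
    rw [coordCovDeriv_congr (hB Y)]
  have hL := hN.isInvertible x hx
  rw [hB', hB', coordCovDeriv_coordSff hF hN hx, coordCovDeriv_coordSff hF hN hx]
  simp only [map_sub, map_add, map_smul, transversalPart_fderiv hL, transversalPart_self hL,
    ← coordMetric_apply, smul_eq_mul]
  have hs := fun X Y ↦ hF.coordMetric_symm (N := N) hx X Y
  have hc := fun X Y ↦ hF.coordConn_symm (N := N) hx X Y
  simp only [coordCubic, coordConnForm, ContinuousLinearMap.comp_apply]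
  -- The induced connection is torsion-free, so the terms `h(∇_X Y, Z)` and `h(∇_Y X, Z)` of the two
  -- cubic forms cancel.
  rw [hc Y X, hs (coordConn Γ F N x X Y) Z]
  ring

end Codazzi

end Coordinates

/-! ### Derivatives of determinants -/

section Determinants

set_option maxSynthPendingDepth 3

variable {D : Type*} [NormedAddCommGroup D] [NormedSpace ℝ D] {x : D}
  {ι : Type*} [Fintype ι] [DecidableEq ι]

/-- The determinant in a basis, as a continuous multilinear map. -/
def continuousDet {E : Type*} [NormedAddCommGroup E] [NormedSpace ℝ E] [FiniteDimensional ℝ E]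
    (b : Module.Basis ι ℝ E) : ContinuousMultilinearMap ℝ (fun _ : ι ↦ E) ℝ where
  toMultilinearMap := b.det.toMultilinearMap
  cont := by
    change Continuous fun v ↦ b.det v
    simp only [Module.Basis.det_apply]
    refine Continuous.matrix_det (continuous_matrix fun i j ↦ ?_)
    exact (LinearMap.continuous_of_finiteDimensional (b.coord i)).comp (continuous_apply j)

theorem hasFDerivAt_basis_det {E : Type*} [NormedAddCommGroup E] [NormedSpace ℝ E]
    [FiniteDimensional ℝ E] (b : Module.Basis ι ℝ E) {v : ι → D → E} {v' : ι → D →L[ℝ] E}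
    (hv : ∀ i, HasFDerivAt (v i) (v' i) x) :
    ∃ L : D →L[ℝ] ℝ, HasFDerivAt (fun z ↦ b.det (fun i ↦ v i z)) L x ∧
      ∀ X, L X = ∑ i, b.det (Function.update (fun j ↦ v j x) i (v' i X)) := by
  refine ⟨_, HasFDerivAt.multilinear_comp (continuousDet b) hv, fun X ↦ ?_⟩
  simp [continuousDet]
  rfl

/-- Jacobi's formula. -/
theorem hasFDerivAt_matrix_det {A : D → Matrix ι ι ℝ} {A' : D → Matrix ι ι ℝ}
    (hA : ∀ i j, ∃ L : D →L[ℝ] ℝ, HasFDerivAt (fun z ↦ A z i j) L x ∧ ∀ X, L X = A' X i j) :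
    ∃ L : D →L[ℝ] ℝ, HasFDerivAt (fun z ↦ (A z).det) L x ∧
      ∀ X, L X = ((A x).adjugate * A' X).trace := by
  choose L hL hLA using hA
  obtain ⟨T, hT, hTX⟩ := hasFDerivAt_basis_det (Pi.basisFun ℝ ι)
    (v := fun i z ↦ A z i) (v' := fun i ↦ ContinuousLinearMap.pi (L i)) (x := x)
    (fun i ↦ hasFDerivAt_pi.2 (hL i))
  refine ⟨T, ?_, fun X ↦ ?_⟩
  · convert hT using 2 with z
    rw [Pi.basisFun_det_apply]
    rfl
  · rw [hTX, Matrix.trace_mul_comm]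
    refine Finset.sum_congr rfl fun i _ ↦ ?_
    rw [Pi.basisFun_det_apply]
    have h1 : ContinuousLinearMap.pi (L i) X = A' X i := funext fun j ↦ hLA i j X
    have h2 : (Function.update (fun j ↦ A x j) i (A' X i) : ι → ι → ℝ) =
      (A x).updateRow i (A' X i) := rfl
    rw [h1, Matrix.diag_apply, Matrix.mul_apply]
    change ((A x).updateRow i (A' X i)).det = _
    -- Cramer's rule: the determinant with row `i` replaced by a vector is the pairing of that
    -- vector with column `i` of the adjugate.
    rw [← Matrix.cramer_transpose_apply, Matrix.cramer_eq_adjugate_mulVec, ← Matrix.adjugate_transpose]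
    exact Finset.sum_congr rfl fun j _ ↦ mul_comm _ _

/-- An off-diagonal coefficient puts a repeated vector into the determinant and contributes zero, so
only the trace of `m` survives. -/
theorem sum_det_update_sum {E : Type*} [AddCommGroup E] [Module ℝ E]
    (b : Module.Basis ι ℝ E) (v : ι → E) (m : Matrix ι ι ℝ) :
    ∑ i, b.det (Function.update v i (∑ k, m k i • v k)) = m.trace * b.det v := by
  have : ∀ i, b.det (Function.update v i (∑ k, m k i • v k)) = m i i * b.det v := by
    intro i
    rw [AlternatingMap.map_update_sum, Finset.sum_eq_single i]
    · rw [AlternatingMap.map_update_smul, Function.update_eq_self, smul_eq_mul]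
    · intro k _ hk
      rw [AlternatingMap.map_update_smul, AlternatingMap.map_update_self _ _ hk.symm, smul_zero]
    · simp
  simp [this, Matrix.trace, Finset.sum_mul]

/-- `g` and `|g|` have the same logarithmic derivative. It is expressed through `k` with `L X = k *
g x`, which is how the derivatives of densities arise. -/
theorem hasFDerivAt_abs_of_log {g : D → ℝ} {L : D →L[ℝ] ℝ} (hg : HasFDerivAt g L x)
    (h0 : g x ≠ 0) : ∃ L' : D →L[ℝ] ℝ, HasFDerivAt (fun z ↦ |g z|) L' x ∧
      ∀ X k, L X = k * g x → L' X = k * |g x| := by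
  refine ⟨_, hg.abs h0, fun X k hk ↦ ?_⟩
  rw [smul_apply, hk, smul_eq_mul, ← sign_mul_self (g x)]
  ring

/-- A square root halves the logarithmic derivative, whence the `2` in the hypothesis. This is the
source of the factor `½` in the derivative of `|vol_h|`. -/
theorem hasFDerivAt_sqrt_abs_of_log {g : D → ℝ} {L : D →L[ℝ] ℝ} (hg : HasFDerivAt g L x)
    (h0 : g x ≠ 0) : ∃ L' : D →L[ℝ] ℝ, HasFDerivAt (fun z ↦ √|g z|) L' x ∧
      ∀ X k, L X = 2 * k * g x → L' X = k * √|g x| := by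
  obtain ⟨L1, hL1, hL1X⟩ := hasFDerivAt_abs_of_log hg h0
  have habs : |g x| ≠ 0 := abs_ne_zero.2 h0
  refine ⟨_, hL1.sqrt habs, fun X k hk ↦ ?_⟩
  rw [smul_apply, hL1X X _ hk, smul_eq_mul]
  have := Real.mul_self_sqrt (abs_nonneg (g x))
  have h2 : √|g x| ≠ 0 := fun h ↦ habs (by rw [← this, h, zero_mul])
  field_simp
  rw [sq, this, mul_comm]

end Determinants

/-! ### Derivatives of the two densities in coordinates -/

section CoordinateDensities

set_option maxSynthPendingDepth 3

variable {E E' : Type*} [NormedAddCommGroup E] [NormedSpace ℝ E] [FiniteDimensional ℝ E]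
  [NormedAddCommGroup E'] [NormedSpace ℝ E']
  {Γ : E' → E' →L[ℝ] E' →L[ℝ] E'} {F N : E → E'} {x : E} {Ω : Set E}

/-- The derivative of the Gram determinant of the induced metric in a frame `y` with
`∇_X y_j = ∑ i, c i j • y_i`. -/
theorem hasFDerivAt_det_gram {ι : Type*} [Fintype ι] [DecidableEq ι]
    (hF : IsLocalMap Γ F Ω) (hN : IsLocalTransversal F N Ω) (hx : x ∈ Ω)
    {y : ι → E → E} (hy : ∀ i, DifferentiableAt ℝ (y i) x)
    (hdet : (gram (fun u v ↦ coordMetric Γ F N x u v) (fun i ↦ y i x)).det ≠ 0) :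
    ∃ L : E →L[ℝ] ℝ, HasFDerivAt
      (fun z ↦ (gram (fun u v ↦ coordMetric Γ F N z u v) (fun i ↦ y i z)).det) L x ∧
      ∀ (X : E) (c : Matrix ι ι ℝ),
        (∀ j, fderiv ℝ (y j) x X + coordConn Γ F N x X (y j x) = ∑ i, c i j • y i x) →
        L X = (contraction (fun u v ↦ coordMetric Γ F N x u v) (fun i ↦ y i x)
            (fun u v ↦ coordCubic Γ F N x X v u) + 2 * c.trace) *
          (gram (fun u v ↦ coordMetric Γ F N x u v) (fun i ↦ y i x)).det := by
  have hh := ((contDiffAt_coordMetric hF hN hx).differentiableAt (by simp)).hasFDerivAt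
  have hy' := fun i ↦ (hy i).hasFDerivAt
  set h := coordMetric Γ F N with hh_def
  obtain ⟨L, hL, hLX⟩ := hasFDerivAt_matrix_det
    (A := fun z ↦ gram (fun u v ↦ h z u v) (fun i ↦ y i z)) (x := x)
    (A' := fun X ↦ Matrix.of fun i j ↦ fderiv ℝ h x X (y i x) (y j x)
      + h x (fderiv ℝ (y i) x X) (y j x) + h x (y i x) (fderiv ℝ (y j) x X))
    (fun i j ↦ ⟨_, (hh.clm_apply (hy' i)).clm_apply (hy' j), fun X ↦ by simp; ring⟩)
  refine ⟨L, hL, fun X c hc ↦ ?_⟩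
  rw [hLX]
  set H := gram (fun u v ↦ h x u v) (fun i ↦ y i x) with hH
  -- By the Leibniz rule the derivative of `h(y_i, y_j)` is `(∇_X h)(y_i, y_j)` plus the terms with
  -- `∇_X y_i` and `∇_X y_j`. The latter form `cᵀ H + H c`, and Jacobi's formula makes `2 tr(c) det
  -- H` of them.
  have hsplit : (Matrix.of fun i j ↦ fderiv ℝ h x X (y i x) (y j x)
      + h x (fderiv ℝ (y i) x X) (y j x) + h x (y i x) (fderiv ℝ (y j) x X)) =
      (Matrix.of fun i j ↦ coordCubic Γ F N x X (y i x) (y j x)) + (c.transpose * H + H * c) := by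
    ext i j
    have e1 : (c.transpose * H) i j = h x (fderiv ℝ (y i) x X + coordConn Γ F N x X (y i x)) (y j x) := by
      rw [hc, Matrix.mul_apply]
      simp [hH, gram]
    have e2 : (H * c) i j = h x (y i x) (fderiv ℝ (y j) x X + coordConn Γ F N x X (y j x)) := by
      rw [hc, Matrix.mul_apply]
      simp [hH, gram, mul_comm]
    simp only [Matrix.add_apply, e1, e2, Matrix.of_apply, coordCubic, map_add, add_apply, ← hh_def]
    ring
  have hu : IsUnit H.det := isUnit_iff_ne_zero.2 hdet
  have hadj : H.adjugate = H.det • H⁻¹ := by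
    rw [Matrix.inv_def, Ring.inverse_eq_inv', smul_smul, mul_inv_cancel₀ hdet, one_smul]
  rw [hsplit, hadj, Matrix.smul_mul, Matrix.trace_smul, Matrix.mul_add, Matrix.mul_add,
    Matrix.trace_add, Matrix.trace_add, ← Matrix.mul_assoc, ← Matrix.mul_assoc,
    Matrix.trace_mul_comm (H⁻¹ * _) H, ← Matrix.mul_assoc, Matrix.mul_nonsing_inv _ hu,
    Matrix.nonsing_inv_mul _ hu, Matrix.one_mul, Matrix.one_mul, Matrix.trace_transpose]
  -- The trace of a product pairs entry `(p, q)` with entry `(q, p)`; this explains the interchanged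
  -- arguments of the cubic form.
  have : (H⁻¹ * Matrix.of fun i j ↦ coordCubic Γ F N x X (y i x) (y j x)).trace =
      contraction (fun u v ↦ h x u v) (fun i ↦ y i x) (fun u v ↦ coordCubic Γ F N x X v u) := by
    simp [Matrix.trace, Matrix.mul_apply, contraction, hH]
  rw [this, smul_eq_mul]
  ring

omit [FiniteDimensional ℝ E] in
/-- The derivative of `μ(N, dF(y₁), …, dF(y_n))` for a parallel volume form with coordinate
expression `μ · det`, in a frame `y` with `∇_X y_j = ∑ i, c i j • y_i`. -/
theorem hasFDerivAt_volume [FiniteDimensional ℝ E'] {n : ℕ}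
    (hF : IsLocalMap Γ F Ω) (hN : IsLocalTransversal F N Ω) (hx : x ∈ Ω)
    (b : Module.Basis (Fin (n + 1)) ℝ E') {μ : E' → ℝ} (hμ : DifferentiableAt ℝ μ (F x))
    (hpar : ∀ w u, fderiv ℝ μ (F x) u * b.det w =
      μ (F x) * ∑ i, b.det (Function.update w i (Γ (F x) (w i) u)))
    {y : Fin n → E → E} (hy : ∀ i, DifferentiableAt ℝ (y i) x)
    (hspan : ⊤ ≤ Submodule.span ℝ (Set.range fun i ↦ y i x)) :
    ∃ L : E →L[ℝ] ℝ, HasFDerivAt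
      (fun z ↦ μ (F z) * b.det (Matrix.vecCons (N z) (fun i ↦ fderiv ℝ F z (y i z)))) L x ∧
      ∀ (X : E) (c : Matrix (Fin n) (Fin n) ℝ),
        (∀ j, fderiv ℝ (y j) x X + coordConn Γ F N x X (y j x) = ∑ i, c i j • y i x) →
        L X = (coordConnForm Γ F N x X + c.trace) *
          (μ (F x) * b.det (Matrix.vecCons (N x) (fun i ↦ fderiv ℝ F x (y i x)))) := by
  have hF1 := ((hF.contDiffAt hx).differentiableAt (by simp)).hasFDerivAt
  have hF2 := ((hF.contDiffAt_fderiv hx).differentiableAt (by simp)).hasFDerivAt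
  have hN1 := ((hN.smooth.contDiffAt (hF.isOpen.mem_nhds hx)).differentiableAt (by simp)).hasFDerivAt
  have hL := hN.isInvertible x hx
  let v : Fin (n + 1) → E → E' := Matrix.vecCons N (fun i z ↦ fderiv ℝ F z (y i z))
  have hv_eq : ∀ z, Matrix.vecCons (N z) (fun i ↦ fderiv ℝ F z (y i z)) = fun i ↦ v i z := by
    intro z
    ext i
    refine Fin.cases ?_ (fun j ↦ ?_) i <;> simp [v]
  have hv : ∀ i, HasFDerivAt (v i) (fderiv ℝ (v i) x) x := by
    intro i
    apply DifferentiableAt.hasFDerivAt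
    refine Fin.cases ?_ (fun j ↦ ?_) i
    · exact hN1.differentiableAt
    · exact (hF2.clm_apply (hy j).hasFDerivAt).differentiableAt
  obtain ⟨T, hT, hTX⟩ := hasFDerivAt_basis_det b hv
  simp only [hv_eq]
  refine ⟨_, (hμ.hasFDerivAt.comp x hF1).mul hT, fun X c hc ↦ ?_⟩
  obtain ⟨s, hs⟩ : ∃ s : Fin n → ℝ, tangentialPart F N x (coordCovDeriv Γ F N x X) =
      ∑ k, s k • y k x := by
    obtain ⟨s, hs⟩ := (Submodule.mem_span_range_iff_exists_fun ℝ).1 (hspan (Submodule.mem_top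
      (x := tangentialPart F N x (coordCovDeriv Γ F N x X))))
    exact ⟨s, hs.symm⟩
  -- The matrix of `∇̂_X` in the ambient frame `N, dF(y₁), …, dF(y_n)`. Its first column holds
  -- `τ(X)` and `s`; the column of `y_j` holds `h(X, y_j)` and then column `j` of `c`. Only the
  -- trace `τ(X) + tr c` enters the result.
  let m : Matrix (Fin (n + 1)) (Fin (n + 1)) ℝ := Matrix.of fun k i ↦
    (Fin.cases (Fin.cases (coordConnForm Γ F N x X) s k)
      (fun j ↦ Fin.cases (coordMetric Γ F N x X (y j x)) (fun k ↦ c k j) k) i : ℝ)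
  have hm : ∀ i, coordCovDeriv Γ F (v i) x X = ∑ k, m k i • v k x := by
    intro i
    rw [Fin.sum_univ_succ]
    refine Fin.cases ?_ (fun j ↦ ?_) i
    · have := (fderiv_tangentialPart_add hL (coordCovDeriv Γ F N x X)).symm
      rw [hs] at this
      simpa [m, v, coordConnForm, add_comm] using this
    · have h1 : fderiv ℝ (v j.succ) x X = fderiv ℝ (fderiv ℝ F) x X (y j x)
          + fderiv ℝ F x (fderiv ℝ (y j) x X) := by
        have : v j.succ = fun z ↦ fderiv ℝ F z (y j z) := by simp [v]
        rw [this, (hF2.clm_apply (hy j).hasFDerivAt).fderiv]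
        simp [add_comm]
      have h2 : coordCovDeriv Γ F (v j.succ) x X =
          fderiv ℝ F x (fderiv ℝ (y j) x X) + coordSff Γ F x X (y j x) := by
        rw [coordCovDeriv_apply, h1, coordSff_apply]
        have : v j.succ x = fderiv ℝ F x (y j x) := by simp [v]
        rw [this]; abel
      rw [h2, coordSff_eq hL, ← add_assoc, ← map_add, hc]
      simp [m, v, add_comm]
  -- Since the form `μ · det` is parallel, the derivative of `μ` supplies exactly the Christoffel
  -- terms that turn the ordinary derivatives of the frame into covariant ones.
  have key : T X * μ (F x) + fderiv ℝ μ (F x) (fderiv ℝ F x X) * b.det (fun i ↦ v i x) =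
      μ (F x) * ∑ i, b.det (Function.update (fun j ↦ v j x) i (coordCovDeriv Γ F (v i) x X)) := by
    rw [hTX, hpar]
    simp only [coordCovDeriv_apply, AlternatingMap.map_update_add, Finset.sum_add_distrib]
    ring
  have htr : m.trace = coordConnForm Γ F N x X + c.trace := by
    rw [Matrix.trace, Fin.sum_univ_succ]
    simp [m, Matrix.trace]
  simp only [hm, sum_det_update_sum b (fun j ↦ v j x) m, htr] at key
  simp only [add_apply, smul_apply, smul_eq_mul, ContinuousLinearMap.comp_apply,
    Function.comp_apply]
  linarith

end CoordinateDensities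

/-! ### Tangent vectors and fields in a chart -/

section Charts

set_option maxSynthPendingDepth 3

variable {m : ℕ} {M : Type*} [TopologicalSpace M] [ChartedSpace (EuclideanSpace ℝ (Fin m)) M]

/-- The coordinate expression of a function in the chart at `p`. -/
def coordFun (m : ℕ) {M : Type*} [TopologicalSpace M]
    [ChartedSpace (EuclideanSpace ℝ (Fin m)) M] {V : Type*} (p : M) (g : M → V) : EuclideanSpace ℝ (Fin m) → V :=
  g ∘ (extChartAt (𝓡 m) p).symm

/-- The coordinates of the point `y` in the chart at `p`. -/
def coordPt (m : ℕ) {M : Type*} [TopologicalSpace M]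
    [ChartedSpace (EuclideanSpace ℝ (Fin m)) M] (p y : M) : EuclideanSpace ℝ (Fin m) := extChartAt (𝓡 m) p y

/-- The domain of the chart at `p`. -/
abbrev chartDom (m : ℕ) {M : Type*} [TopologicalSpace M]
    [ChartedSpace (EuclideanSpace ℝ (Fin m)) M] (p : M) : Set M :=
  (chartAt (EuclideanSpace ℝ (Fin m)) p).source

theorem chartDom_mem_nhds {p y : M} (hy : y ∈ chartDom m p) : chartDom m p ∈ nhds y :=
  (chartAt (EuclideanSpace ℝ (Fin m)) p).open_source.mem_nhds hy

theorem mem_chartDom (p : M) : p ∈ chartDom m p := mem_chart_source _ p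

theorem symm_coordPt {p y : M} (hy : y ∈ chartDom m p) :
    (extChartAt (𝓡 m) p).symm (coordPt m p y) = y :=
  (extChartAt (𝓡 m) p).left_inv (by rwa [extChartAt_source])

@[simp] theorem coordFun_coordPt {V : Type*} {p y : M} (hy : y ∈ chartDom m p) (g : M → V) :
    coordFun m p g (coordPt m p y) = g y := by
  rw [coordFun, Function.comp_apply, symm_coordPt hy]

theorem coordPt_symm {p : M} {x : EuclideanSpace ℝ (Fin m)}
    (hx : x ∈ (extChartAt (𝓡 m) p).target) : coordPt m p ((extChartAt (𝓡 m) p).symm x) = x :=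
  (extChartAt (𝓡 m) p).right_inv hx

theorem symm_mem_chartDom {p : M} {x : EuclideanSpace ℝ (Fin m)}
    (hx : x ∈ (extChartAt (𝓡 m) p).target) : (extChartAt (𝓡 m) p).symm x ∈ chartDom m p := by
  have := (extChartAt (𝓡 m) p).map_target hx
  rwa [extChartAt_source] at this

theorem coordPt_mem_target {p y : M} (hy : y ∈ chartDom m p) :
    coordPt m p y ∈ (extChartAt (𝓡 m) p).target :=
  (extChartAt (𝓡 m) p).map_source (by rwa [extChartAt_source])

theorem continuousAt_coordPt {p y : M} (hy : y ∈ chartDom m p) :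
    ContinuousAt (coordPt m p) y :=
  continuousAt_extChartAt' (by rwa [extChartAt_source])

theorem continuousAt_symm {p y : M} (hy : y ∈ chartDom m p) :
    ContinuousAt (extChartAt (𝓡 m) p).symm (coordPt m p y) :=
  continuousAt_extChartAt_symm' (by rwa [extChartAt_source])

theorem eventually_symm {p y : M} (hy : y ∈ chartDom m p) {P : M → Prop}
    (h : ∀ᶠ z in nhds y, P z) : ∀ᶠ x in nhds (coordPt m p y), P ((extChartAt (𝓡 m) p).symm x) := by
  have := continuousAt_symm hy
  rw [ContinuousAt, symm_coordPt hy] at this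
  exact this.eventually h

theorem eventually_coordFun_eq {V : Type*} {p y : M} (hy : y ∈ chartDom m p) {g g' : M → V}
    (h : g =ᶠ[nhds y] g') : coordFun m p g =ᶠ[nhds (coordPt m p y)] coordFun m p g' :=
  eventually_symm hy h

variable [IsManifold (𝓡 m) ∞ M]
  {V : Type*} [NormedAddCommGroup V] [NormedSpace ℝ V]

theorem mdifferentiableAt_iff_coordFun {p y : M} (hy : y ∈ chartDom m p) {g : M → V} :
    MDifferentiableAt (𝓡 m) 𝓘(ℝ, V) g y ↔ DifferentiableAt ℝ (coordFun m p g) (coordPt m p y) := by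
  rw [mdifferentiableAt_iff_source_of_mem_source hy]
  simp [coordFun, coordPt, mdifferentiableWithinAt_univ, mdifferentiableAt_iff_differentiableAt]

theorem contMDiffAt_iff_coordFun {p y : M} (hy : y ∈ chartDom m p) {g : M → V} :
    ContMDiffAt (𝓡 m) 𝓘(ℝ, V) ∞ g y ↔ ContDiffAt ℝ ∞ (coordFun m p g) (coordPt m p y) := by
  rw [contMDiffAt_iff_source_of_mem_source hy]
  simp [coordFun, coordPt, contMDiffWithinAt_univ, contMDiffAt_iff_contDiffAt]

/-- The coordinates of a tangent vector at `y` in the chart at `p`. -/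
def toCoord (p y : M) : TangentSpace (𝓡 m) y →L[ℝ] EuclideanSpace ℝ (Fin m) :=
  (trivializationAt (EuclideanSpace ℝ (Fin m)) (TangentSpace (𝓡 m) : M → Type _)
    p).continuousLinearMapAt ℝ y

/-- The tangent vector at `y` with given coordinates in the chart at `p`. -/
def ofCoord (p y : M) : EuclideanSpace ℝ (Fin m) →L[ℝ] TangentSpace (𝓡 m) y :=
  (trivializationAt (EuclideanSpace ℝ (Fin m)) (TangentSpace (𝓡 m) : M → Type _) p).symmL ℝ y

theorem toCoord_ofCoord {p y : M} (hy : y ∈ chartDom m p) (w : EuclideanSpace ℝ (Fin m)) :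
    toCoord p y (ofCoord p y w) = w :=
  Trivialization.continuousLinearMapAt_symmL _ hy w

theorem ofCoord_toCoord {p y : M} (hy : y ∈ chartDom m p) (v : TangentSpace (𝓡 m) y) :
    ofCoord p y (toCoord p y v) = v :=
  Trivialization.symmL_continuousLinearMapAt _ hy v

theorem trivializationAt_snd {p y : M} (hy : y ∈ chartDom m p) (v : TangentSpace (𝓡 m) y) :
    (trivializationAt (EuclideanSpace ℝ (Fin m)) (TangentSpace (𝓡 m) : M → Type _) p ⟨y, v⟩).2 =
      toCoord p y v :=
  (congrFun (Trivialization.coe_linearMapAt_of_mem (R := ℝ) _ hy) v).symm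

theorem extend_eq {p : M} (v : TangentSpace (𝓡 m) p) {y : M} (hy : y ∈ chartDom m p) :
    FiberBundle.extend (EuclideanSpace ℝ (Fin m)) v y = ofCoord p y (toCoord p p v) := by
  rw [← trivializationAt_snd (mem_chartDom p), ofCoord]
  exact (Trivialization.symmL_apply (R := ℝ) _ hy _).symm

/-- This links the bundle trivialization, through which tangent vectors get coordinates, with the
derivative of the chart, to which the chain rule applies. -/
theorem toCoord_eq_mfderiv {p y : M} (hy : y ∈ chartDom m p) :
    toCoord p y = mfderiv (𝓡 m) 𝓘(ℝ, EuclideanSpace ℝ (Fin m)) (extChartAt (𝓡 m) p) y :=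
  TangentBundle.continuousLinearMapAt_trivializationAt hy

/-- The coordinate isomorphism between the tangent space at `y` and the model space. -/
def coordEquiv {p y : M} (hy : y ∈ chartDom m p) :
    TangentSpace (𝓡 m) y ≃L[ℝ] EuclideanSpace ℝ (Fin m) :=
  ContinuousLinearEquiv.equivOfInverse (toCoord p y) (ofCoord p y) (ofCoord_toCoord hy)
    (toCoord_ofCoord hy)

@[simp] theorem coordEquiv_apply {p y : M} (hy : y ∈ chartDom m p) (v : TangentSpace (𝓡 m) y) :
    coordEquiv hy v = toCoord p y v := rfl

theorem mfderiv_eq_fderiv_coordFun {p y : M} (hy : y ∈ chartDom m p) {g : M → V}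
    (hg : MDifferentiableAt (𝓡 m) 𝓘(ℝ, V) g y) (v : TangentSpace (𝓡 m) y) :
    mfderiv (𝓡 m) 𝓘(ℝ, V) g y v = fderiv ℝ (coordFun m p g) (coordPt m p y) (toCoord p y v) := by
  have hφ : MDifferentiableAt (𝓡 m) 𝓘(ℝ, EuclideanSpace ℝ (Fin m)) (extChartAt (𝓡 m) p) y :=
    (contMDiffAt_extChartAt' (n := ∞) hy).mdifferentiableAt (by simp)
  have hg' : MDifferentiableAt 𝓘(ℝ, EuclideanSpace ℝ (Fin m)) 𝓘(ℝ, V) (coordFun m p g)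
      (extChartAt (𝓡 m) p y) :=
    mdifferentiableAt_iff_differentiableAt.2 ((mdifferentiableAt_iff_coordFun hy).1 hg)
  have heq : g =ᶠ[nhds y] coordFun m p g ∘ extChartAt (𝓡 m) p := by
    filter_upwards [chartDom_mem_nhds hy] with z hz
    exact (coordFun_coordPt hz g).symm
  rw [heq.mfderiv_eq, mfderiv_comp y hg' hφ, mfderiv_eq_fderiv, toCoord_eq_mfderiv hy]
  rfl

theorem mvfderiv_eq_fderiv_coordFun {p y : M} (hy : y ∈ chartDom m p) {g : M → V}
    (hg : MDifferentiableAt (𝓡 m) 𝓘(ℝ, V) g y) (v : TangentSpace (𝓡 m) y) :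
    mvfderiv (𝓡 m) g y v = fderiv ℝ (coordFun m p g) (coordPt m p y) (toCoord p y v) :=
  mfderiv_eq_fderiv_coordFun hy hg v

/-- The coordinate expression of a vector field in the chart at `p`. -/
def coordField (p : M) (X : VField m M) : EuclideanSpace ℝ (Fin m) → EuclideanSpace ℝ (Fin m) :=
  coordFun m p fun y ↦ toCoord p y (X y)

theorem coordField_coordPt {p y : M} (hy : y ∈ chartDom m p) (X : VField m M) :
    coordField p X (coordPt m p y) = toCoord p y (X y) := coordFun_coordPt hy _

theorem isDiffFieldAt_iff {p y : M} (hy : y ∈ chartDom m p) (X : VField m M) :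
    IsDiffFieldAt X y ↔ DifferentiableAt ℝ (coordField p X) (coordPt m p y) := by
  rw [IsDiffFieldAt, Trivialization.mdifferentiableAt_section_iff (𝓡 m)
    (trivializationAt (EuclideanSpace ℝ (Fin m)) (TangentSpace (𝓡 m) : M → Type _) p) X hy,
    mdifferentiableAt_iff_coordFun hy]
  refine Filter.EventuallyEq.differentiableAt_iff (eventually_coordFun_eq hy ?_)
  filter_upwards [chartDom_mem_nhds hy] with z hz
  exact trivializationAt_snd hz _

theorem contMDiffAt_field_iff {p y : M} (hy : y ∈ chartDom m p) (X : VField m M) :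
    ContMDiffAt (𝓡 m) (𝓡 m).tangent ∞ (fun x ↦ (⟨x, X x⟩ : TangentBundle (𝓡 m) M)) y ↔
      ContDiffAt ℝ ∞ (coordField p X) (coordPt m p y) := by
  rw [Trivialization.contMDiffAt_section_iff
    (trivializationAt (EuclideanSpace ℝ (Fin m)) (TangentSpace (𝓡 m) : M → Type _) p) hy,
    contMDiffAt_iff_coordFun hy]
  have : coordFun m p (fun z ↦ (trivializationAt (EuclideanSpace ℝ (Fin m))
      (TangentSpace (𝓡 m) : M → Type _) p ⟨z, X z⟩).2) =ᶠ[nhds (coordPt m p y)] coordField p X := by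
    refine eventually_coordFun_eq hy ?_
    filter_upwards [chartDom_mem_nhds hy] with z hz
    exact trivializationAt_snd hz _
  exact ⟨fun h ↦ h.congr_of_eventuallyEq this.symm, fun h ↦ h.congr_of_eventuallyEq this⟩

/-- The vector field with constant coordinates `w` in the chart at `p`. -/
def constField (p : M) (w : EuclideanSpace ℝ (Fin m)) : VField m M := fun y ↦ ofCoord p y w

theorem coordField_constField {p y : M} (hy : y ∈ chartDom m p) (w : EuclideanSpace ℝ (Fin m)) :
    coordField p (constField p w) =ᶠ[nhds (coordPt m p y)] fun _ ↦ w := by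
  apply eventually_symm (P := fun z ↦ toCoord p z (constField p w z) = w) hy
  filter_upwards [chartDom_mem_nhds hy] with z hz
  exact toCoord_ofCoord hz w

theorem contMDiffAt_constField {p y : M} (hy : y ∈ chartDom m p) (w : EuclideanSpace ℝ (Fin m)) :
    ContMDiffAt (𝓡 m) (𝓡 m).tangent ∞
      (fun x ↦ (⟨x, constField p w x⟩ : TangentBundle (𝓡 m) M)) y :=
  (contMDiffAt_field_iff hy _).2 (contDiffAt_const.congr_of_eventuallyEq (coordField_constField hy w))

theorem isDiffFieldAt_constField {p y : M} (hy : y ∈ chartDom m p) (w : EuclideanSpace ℝ (Fin m)) :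
    IsDiffFieldAt (constField p w) y :=
  (contMDiffAt_constField hy w).mdifferentiableAt (by simp)

/-- A constant vector field on the model space. -/
def modelField (w : EuclideanSpace ℝ (Fin m)) :
    Π x : EuclideanSpace ℝ (Fin m), TangentSpace 𝓘(ℝ, EuclideanSpace ℝ (Fin m)) x := fun _ ↦ w

theorem contMDiff_modelField (w : EuclideanSpace ℝ (Fin m)) :
    ContMDiff (𝓡 m) (𝓡 m).tangent 1 (fun x ↦ (⟨x, modelField w x⟩ :
      TangentBundle 𝓘(ℝ, EuclideanSpace ℝ (Fin m)) (EuclideanSpace ℝ (Fin m)))) :=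
  contMDiff_vectorSpace_iff_contDiff.2 contDiff_const

/-- Fields with constant coordinates are pullbacks under the chart of constant fields on the model
space, and pullback commutes with the bracket. -/
theorem mlieBracket_constField {p y : M} (hy : y ∈ chartDom m p) (u w : EuclideanSpace ℝ (Fin m)) :
    VectorField.mlieBracket (𝓡 m) (constField p u) (constField p w) y = 0 := by
  have hpull : ∀ w : EuclideanSpace ℝ (Fin m), constField p w =ᶠ[nhds y]
      VectorField.mpullback (𝓡 m) 𝓘(ℝ, EuclideanSpace ℝ (Fin m)) (extChartAt (𝓡 m) p)
        (modelField w) := by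
    intro w
    filter_upwards [chartDom_mem_nhds hy] with z hz
    have : ((coordEquiv hz : TangentSpace (𝓡 m) z ≃L[ℝ] EuclideanSpace ℝ (Fin m)) :
        TangentSpace (𝓡 m) z →L[ℝ] EuclideanSpace ℝ (Fin m)).inverse w = ofCoord p z w := by
      rw [ContinuousLinearMap.inverse_equiv]; rfl
    rw [VectorField.mpullback_apply, ← toCoord_eq_mfderiv hz]
    exact this.symm
  have : IsManifold (𝓡 m) (minSmoothness ℝ 2) M := by
    rw [minSmoothness_of_isRCLikeNormedField]; infer_instance
  rw [(hpull u).mlieBracket_vectorField_eq (hpull w),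
    ← VectorField.mpullback_mlieBracket (n := ∞)
      ((contMDiff_modelField u).mdifferentiable one_ne_zero _)
      ((contMDiff_modelField w).mdifferentiable one_ne_zero _) (contMDiffAt_extChartAt' hy)
      (by simp; norm_cast)]
  have : VectorField.mlieBracket 𝓘(ℝ, EuclideanSpace ℝ (Fin m)) (modelField u) (modelField w) =
      0 := by
    rw [← VectorField.mlieBracketWithin_univ, VectorField.mlieBracketWithin_eq_lieBracketWithin]
    ext x : 1
    change VectorField.lieBracketWithin ℝ (fun _ : EuclideanSpace ℝ (Fin m) ↦ u) (fun _ ↦ w)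
      univ x = 0
    simp [VectorField.lieBracketWithin]
  rw [this, VectorField.mpullback_apply]
  exact map_zero _

end Charts

/-! ### Christoffel symbols -/

section Christoffel

set_option maxSynthPendingDepth 3

variable {m : ℕ} {M : Type*} [TopologicalSpace M] [ChartedSpace (EuclideanSpace ℝ (Fin m)) M]
  [IsManifold (𝓡 m) ∞ M]

theorem isDiffFieldAt_of_smoothOn {X : VField m M} {U : Set M} (hU : IsOpen U)
    (hX : IsSmoothFieldOn X U) {y : M} (hy : y ∈ U) : IsDiffFieldAt X y :=
  (hX.contMDiffAt (hU.mem_nhds hy)).mdifferentiableAt (by simp)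

/-- A vector field smooth near `y` agrees near `y` with a global smooth vector field. -/
theorem exists_global_field [T2Space M] {X : VField m M} {U : Set M} (hU : IsOpen U)
    (hX : IsSmoothFieldOn X U) {y : M} (hy : y ∈ U) :
    ∃ X' : VField m M, IsSmoothFieldOn X' univ ∧ ∀ᶠ z in nhds y, X' z = X z := by
  obtain ⟨χ, -, hχ⟩ := (SmoothBumpFunction.nhds_basis_tsupport (I := 𝓡 m) y).mem_iff.1
    (hU.mem_nhds hy)
  -- The bump function has its closed support in `U`, so off `U` the product vanishes identically
  -- near each point.
  refine ⟨fun z ↦ χ z • X z, fun z _ ↦ ContMDiffAt.contMDiffWithinAt ?_, ?_⟩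
  · by_cases hz : z ∈ U
    · exact (χ.contMDiff z).smul_section (hX.contMDiffAt (hU.mem_nhds hz))
    · have hz' : z ∈ (tsupport χ)ᶜ := fun h ↦ hz (hχ h)
      refine (contMDiff_zeroSection ℝ (TangentSpace (𝓡 m) : M → Type _)
        z).congr_of_eventuallyEq ?_
      filter_upwards [(isClosed_tsupport χ).isOpen_compl.mem_nhds hz'] with w hw
      have : χ w = 0 := image_eq_zero_of_notMem_tsupport hw
      simp [this, zeroSection]
  · filter_upwards [χ.eventuallyEq_one] with z hz
    rw [hz]; simp

/-- The derivative of the constant field `e_i`. -/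
def frameDeriv (D : ConnOp m M) (p : M) (i : Fin m) (x : EuclideanSpace ℝ (Fin m)) :
    EuclideanSpace ℝ (Fin m) →L[ℝ] EuclideanSpace ℝ (Fin m) :=
  toCoord p ((extChartAt (𝓡 m) p).symm x) ∘L
    D (constField p (EuclideanSpace.basisFun (Fin m) ℝ i)) ((extChartAt (𝓡 m) p).symm x) ∘L
    ofCoord p ((extChartAt (𝓡 m) p).symm x)

/-- The Christoffel symbols of the connection `D` in the chart at `p`. -/
def christoffel (D : ConnOp m M) (p : M) (x : EuclideanSpace ℝ (Fin m)) :
    EuclideanSpace ℝ (Fin m) →L[ℝ] EuclideanSpace ℝ (Fin m) →L[ℝ] EuclideanSpace ℝ (Fin m) :=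
  ∑ i, (EuclideanSpace.proj i : EuclideanSpace ℝ (Fin m) →L[ℝ] ℝ).smulRight (frameDeriv D p i x)

theorem christoffel_apply (D : ConnOp m M) (p : M) (x w u : EuclideanSpace ℝ (Fin m)) :
    christoffel D p x w u = ∑ i, w i • frameDeriv D p i x u := by
  simp [christoffel, sum_apply]

variable {D : ConnOp m M}
  (hD : IsCovariantDerivativeOn (I := 𝓡 m) (EuclideanSpace ℝ (Fin m)) D univ)
include hD

/-- The connection in coordinates. -/
theorem toCoord_connection {p y : M} (hy : y ∈ chartDom m p) {X : VField m M}
    (hX : IsDiffFieldAt X y) (v : TangentSpace (𝓡 m) y) :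
    toCoord p y (D X y v) = fderiv ℝ (coordField p X) (coordPt m p y) (toCoord p y v)
      + christoffel D p (coordPt m p y) (toCoord p y (X y)) (toCoord p y v) := by
  -- Subtracting the ordinary derivative in coordinates cancels the Leibniz term. The difference is
  -- tensorial, so it depends only on `X y` and may be computed on the combination of constant
  -- fields with the same value at `y`.
  let Φ : VField m M → EuclideanSpace ℝ (Fin m) := fun X ↦
    toCoord p y (D X y v) - fderiv ℝ (coordField p X) (coordPt m p y) (toCoord p y v)
  have hΦ : TensorialAt (𝓡 m) (EuclideanSpace ℝ (Fin m)) Φ y := by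
    constructor
    · intro g σ hg hσ
      have h1 := (isDiffFieldAt_iff hy σ).1 hσ
      have h2 := (mdifferentiableAt_iff_coordFun hy).1 hg
      have h3 : coordField p (g • σ) = fun x ↦ coordFun m p g x • coordField p σ x := by
        ext1 x
        exact map_smul (toCoord p _) _ _
      have h4 := mvfderiv_eq_fderiv_coordFun hy hg v
      simp only [Φ, h3, hD.leibniz hσ hg]
      rw [fderiv_fun_smul h2 h1]
      simp [h4, coordFun_coordPt hy, coordField_coordPt hy]
      module
    · intro σ σ' hσ hσ'
      have h1 := (isDiffFieldAt_iff hy σ).1 hσ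
      have h2 := (isDiffFieldAt_iff hy σ').1 hσ'
      have h3 : coordField p (σ + σ') = fun x ↦ coordField p σ x + coordField p σ' x := by
        ext1 x
        exact map_add (toCoord p _) _ _
      simp only [Φ, h3, hD.add hσ hσ']
      rw [fderiv_fun_add h1 h2]
      simp
      abel
  have hconst : ∀ i, IsDiffFieldAt (constField p (EuclideanSpace.basisFun (Fin m) ℝ i)) y :=
    fun i ↦ isDiffFieldAt_constField hy _
  set w := toCoord p y (X y) with hw
  have hsmul : ∀ i, IsDiffFieldAt
      ((fun _ : M ↦ w i) • constField p (EuclideanSpace.basisFun (Fin m) ℝ i)) y :=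
    fun i ↦ mdifferentiableAt_const.smul_section (hconst i)
  have hval : X y = ∑ i, w i • constField p (EuclideanSpace.basisFun (Fin m) ℝ i) y := by
    rw [← ofCoord_toCoord hy (X y), ← hw]
    have : w = ∑ i, w i • EuclideanSpace.basisFun (Fin m) ℝ i := by
      conv_lhs => rw [← (EuclideanSpace.basisFun (Fin m) ℝ).sum_repr w]
      simp
    conv_lhs => rw [this]
    simp only [map_sum, map_smul]
    rfl
  have h1 : Φ X = Φ (fun z ↦ ∑ i, ((fun _ : M ↦ w i) •
      constField p (EuclideanSpace.basisFun (Fin m) ℝ i)) z) :=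
    hΦ.pointwise hX (.sum_section fun i _ ↦ hsmul i) hval
  rw [hΦ.sum _ (fun i _ ↦ hsmul i)] at h1
  have h2 : ∀ i, Φ ((fun _ : M ↦ w i) • constField p (EuclideanSpace.basisFun (Fin m) ℝ i)) =
      w i • frameDeriv D p i (coordPt m p y) (toCoord p y v) := by
    intro i
    rw [hΦ.smul mdifferentiableAt_const (hconst i)]
    congr 1
    simp only [Φ, (coordField_constField hy _).fderiv_eq]
    -- `frameDeriv` is evaluated at the point with the coordinates of `y`. That point equals `y`
    -- only through `symm_coordPt`, and the tangent spaces depend on it, so the statement is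
    -- generalized before substituting.
    have : ∀ z, z = y → toCoord p y (D (constField p (EuclideanSpace.basisFun (Fin m) ℝ i)) y v) =
        toCoord p z (D (constField p (EuclideanSpace.basisFun (Fin m) ℝ i)) z
          (ofCoord p z (toCoord p y v))) := by
      rintro _ rfl
      rw [ofCoord_toCoord hy]
    have h0 := this _ (symm_coordPt hy)
    rw [fderiv_fun_const]
    simp only [Pi.zero_apply, zero_apply, sub_zero]
    exact h0
  simp only [h2] at h1
  rw [christoffel_apply, ← h1]
  simp [Φ]

theorem christoffel_eq {p y : M} (hy : y ∈ chartDom m p) (w u : EuclideanSpace ℝ (Fin m)) :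
    christoffel D p (coordPt m p y) w u =
      toCoord p y (D (constField p w) y (ofCoord p y u)) := by
  rw [toCoord_connection hD hy (isDiffFieldAt_constField hy w),
    (coordField_constField hy w).fderiv_eq]
  simp [constField, toCoord_ofCoord hy]

end Christoffel

/-! ### Symmetry and smoothness of the Christoffel symbols -/

section Smoothness

set_option maxSynthPendingDepth 3

variable {m : ℕ} {M : Type*} [TopologicalSpace M] [ChartedSpace (EuclideanSpace ℝ (Fin m)) M]
  [IsManifold (𝓡 m) ∞ M]
  (D : CovariantDerivative (𝓡 m) (EuclideanSpace ℝ (Fin m)) (TangentSpace (𝓡 m) : M → Type _))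

/-- Coordinate fields commute, so vanishing torsion gives `∇_u w = ∇_w u` for them. -/
theorem christoffel_symm (hD : D.torsion = 0) {p y : M} (hy : y ∈ chartDom m p)
    (w u : EuclideanSpace ℝ (Fin m)) :
    christoffel (D : ConnOp m M) p (coordPt m p y) w u =
      christoffel (D : ConnOp m M) p (coordPt m p y) u w := by
  have h := D.isCovariantDerivativeOnUniv
  rw [christoffel_eq h hy, christoffel_eq h hy, ← sub_eq_zero, ← map_sub]
  have := D.torsion_eq_zero_iff.1 hD (isDiffFieldAt_constField hy u) (isDiffFieldAt_constField hy w)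
  rw [mlieBracket_constField hy] at this
  have h2 : D (constField p w) y (ofCoord p y u) - D (constField p u) y (ofCoord p y w) = 0 := this
  rw [h2, map_zero]

/-- Smoothness of the connection is available for global smooth fields. A local field agrees near
`y` with a global one, and a covariant derivative depends only on the germ. -/
theorem contMDiffAt_connection_apply [T2Space M] [CovariantDerivative.ContMDiffCovariantDerivative D ∞]
    {X Y : VField m M} {U : Set M} (hU : IsOpen U) (hX : IsSmoothFieldOn X U)
    (hY : IsSmoothFieldOn Y U) {y : M} (hy : y ∈ U) :
    ContMDiffAt (𝓡 m) (𝓡 m).tangent ∞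
      (fun x ↦ (⟨x, D Y x (X x)⟩ : TangentBundle (𝓡 m) M)) y := by
  obtain ⟨Y', hY', hYY'⟩ := exists_global_field hU hY hy
  have h1 := (CovariantDerivative.ContMDiffCovariantDerivative.contMDiff (cov := D)
    (k := ∞)).contMDiff (σ := Y') hY'
  have h2 := ContMDiffAt.clm_bundle_apply (h1.contMDiffAt Filter.univ_mem)
    (hX.contMDiffAt (hU.mem_nhds hy))
  refine h2.congr_of_eventuallyEq ?_
  filter_upwards [hYY'.eventually_nhds, hU.mem_nhds hy] with z hz hzU
  have := D.isCovariantDerivativeOnUniv.congr_of_eventuallyEq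
    (isDiffFieldAt_of_smoothOn isOpen_univ hY' (mem_univ z))
    (isDiffFieldAt_of_smoothOn hU hY hzU) Filter.univ_mem hz
  simp only [this]

theorem contDiffAt_christoffel [T2Space M] [CovariantDerivative.ContMDiffCovariantDerivative D ∞]
    {p y : M} (hy : y ∈ chartDom m p) :
    ContDiffAt ℝ ∞ (christoffel (D : ConnOp m M) p) (coordPt m p y) := by
  have ho : IsOpen (extChartAt (𝓡 m) p).target := isOpen_extChartAt_target p
  refine contDiffAt_clm_of_apply ho (fun w x hx ↦ contDiffAt_clm_of_apply ho
    (fun u x hx ↦ ?_) hx) (coordPt_mem_target hy)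
  have hz := symm_mem_chartDom hx
  have hX : ∀ w : EuclideanSpace ℝ (Fin m), IsSmoothFieldOn (constField p w) (chartDom m p) :=
    fun w z hz ↦ (contMDiffAt_constField hz w).contMDiffWithinAt
  have h1 := (contMDiffAt_field_iff hz _).1 (contMDiffAt_connection_apply D
    (chartAt (EuclideanSpace ℝ (Fin m)) p).open_source (hX u) (hX w) hz)
  rw [coordPt_symm hx] at h1
  refine h1.congr_of_eventuallyEq ?_
  filter_upwards [ho.mem_nhds hx] with x' hx'
  have := christoffel_eq D.isCovariantDerivativeOnUniv (symm_mem_chartDom hx') w u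
  rwa [coordPt_symm hx'] at this

end Smoothness

/-! ### Projective flatness in coordinates -/

section ProjectivelyFlat

set_option maxSynthPendingDepth 3

variable {m : ℕ} {M : Type*} [TopologicalSpace M] [T2Space M]
  [ChartedSpace (EuclideanSpace ℝ (Fin m)) M] [IsManifold (𝓡 m) ∞ M]
  (D : CovariantDerivative (𝓡 m) (EuclideanSpace ℝ (Fin m)) (TangentSpace (𝓡 m) : M → Type _))

/-- Projective flatness is tested on fields smooth on the whole of `U`, which need not lie in a
chart, whereas `constField` is known to be smooth only on a chart domain. -/
theorem exists_global_constField (y : M) (w : EuclideanSpace ℝ (Fin m)) :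
    ∃ X : VField m M, IsSmoothFieldOn X univ ∧ ∀ᶠ z in nhds y, X z = constField y w z :=
  exists_global_field (chartAt (EuclideanSpace ℝ (Fin m)) y).open_source
    (fun _ hz ↦ (contMDiffAt_constField hz w).contMDiffWithinAt) (mem_chartDom y)

variable [CovariantDerivative.ContMDiffCovariantDerivative D ∞]

/-- The second derivative `∇'_X ∇'_Y Z` for a projective change `∇'` of `D` and fields with
constant coordinates near `y`. -/
theorem toCoord_projectiveChange_iterate {γ : Π x : M, TangentSpace (𝓡 m) x →L[ℝ] ℝ} {y : M}
    {X Y Z : VField m M} {a b w : EuclideanSpace ℝ (Fin m)} (hZ : IsSmoothFieldOn Z univ)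
    (hXa : ∀ᶠ z in nhds y, X z = constField y a z) (hYb : ∀ᶠ z in nhds y, Y z = constField y b z)
    (hZw : ∀ᶠ z in nhds y, Z z = constField y w z)
    (hγY : ContMDiffAt (𝓡 m) 𝓘(ℝ, ℝ) ∞ (fun x ↦ γ x (Y x)) y)
    (hγZ : ContMDiffAt (𝓡 m) 𝓘(ℝ, ℝ) ∞ (fun x ↦ γ x (Z x)) y) :
    ∃ s : ℝ, toCoord y y (projectiveChange (D : ConnOp m M) γ
        (fun z ↦ projectiveChange (D : ConnOp m M) γ Z z (Y z)) y (X y)) =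
      fderiv ℝ (christoffel (D : ConnOp m M) y) (coordPt m y y) a w b
      + christoffel (D : ConnOp m M) y (coordPt m y y)
          (christoffel (D : ConnOp m M) y (coordPt m y y) w b) a
      + fderiv ℝ (coordFun m y fun x ↦ γ x (Y x)) (coordPt m y y) a • w
      + fderiv ℝ (coordFun m y fun x ↦ γ x (Z x)) (coordPt m y y) a • b
      + γ y (Y y) • christoffel (D : ConnOp m M) y (coordPt m y y) w a
      + γ y (Z y) • christoffel (D : ConnOp m M) y (coordPt m y y) b a
      + γ y (X y) • christoffel (D : ConnOp m M) y (coordPt m y y) w b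
      + γ y (X y) • γ y (Y y) • w + γ y (X y) • γ y (Z y) • b + s • a := by
  have hy := mem_chartDom (m := m) y
  have hcov := D.isCovariantDerivativeOnUniv
  set Γ := christoffel (D : ConnOp m M) y with hΓdef
  set A : VField m M := fun z ↦ projectiveChange (D : ConnOp m M) γ Z z (Y z) with hA
  have hc : coordField y A =ᶠ[nhds (coordPt m y y)] fun x ↦ Γ x w b
      + (coordFun m y (fun x ↦ γ x (Y x)) x • w + coordFun m y (fun x ↦ γ x (Z x)) x • b) := by
    have h0 : ∀ᶠ z in nhds y, toCoord y z (A z) = Γ (coordPt m y z) w b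
        + (γ z (Y z) • w + γ z (Z z) • b) := by
      filter_upwards [hYb, hZw.eventually_nhds, chartDom_mem_nhds hy] with z hYz hZz hz
      have e1 : toCoord y z (Z z) = w := by
        rw [hZz.self_of_nhds]; exact toCoord_ofCoord hz w
      have e2 : toCoord y z (Y z) = b := by rw [hYz]; exact toCoord_ofCoord hz b
      have e3 : fderiv ℝ (coordField y Z) (coordPt m y z) = 0 := by
        have : coordField y Z =ᶠ[nhds (coordPt m y z)] fun _ ↦ w := by
          refine Filter.EventuallyEq.trans ?_ (coordField_constField hz w)
          refine eventually_symm (P := fun q ↦ toCoord y q (Z q) = toCoord y q (constField y w q))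
            hz ?_
          filter_upwards [hZz] with q hq
          rw [hq]
        rw [this.fderiv_eq, fderiv_fun_const]; rfl
      have e4 := toCoord_connection hcov hz (isDiffFieldAt_of_smoothOn isOpen_univ hZ (mem_univ z))
        (Y z)
      rw [e1, e2, e3, zero_apply, zero_add] at e4
      simp only [hA, projectiveChange, add_apply, smul_apply, map_add, map_smul,
        ContinuousLinearMap.smulRight_apply, ContinuousLinearMap.id_apply, e1, e2, e4, add_assoc, Γ]
    filter_upwards [eventually_symm hy h0, (isOpen_extChartAt_target y).mem_nhds
      (coordPt_mem_target hy)] with x hx hxt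
    have := coordPt_symm hxt
    rw [this] at hx
    exact hx
  have h1 := (contMDiffAt_iff_coordFun hy).1 hγY
  have h2 := (contMDiffAt_iff_coordFun hy).1 hγZ
  have h3 : ContDiffAt ℝ ∞ Γ (coordPt m y y) := contDiffAt_christoffel D hy
  have d1 := (h1.differentiableAt (by simp)).hasFDerivAt
  have d2 := (h2.differentiableAt (by simp)).hasFDerivAt
  have d3 := (h3.differentiableAt (by simp)).hasFDerivAt
  have dA : HasFDerivAt (coordField y A) _ (coordPt m y y) :=
    (((d3.clm_apply (hasFDerivAt_const w _)).clm_apply (hasFDerivAt_const b _)).add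
      ((d1.smul_const w).add (d2.smul_const b))).congr_of_eventuallyEq hc
  have hAd : IsDiffFieldAt A y := (isDiffFieldAt_iff hy A).2 dA.differentiableAt
  have hXy : toCoord y y (X y) = a := by
    rw [hXa.self_of_nhds]; exact toCoord_ofCoord hy a
  have hAy : toCoord y y (A y) = Γ (coordPt m y y) w b + (γ y (Y y) • w + γ y (Z y) • b) := by
    have := hc.self_of_nhds
    rw [coordField_coordPt hy] at this
    simpa only [coordFun_coordPt hy] using this
  have e := toCoord_connection hcov hy hAd (X y)
  rw [hXy, hAy, dA.fderiv] at e
  -- The summand `γ(A) X` of the outer derivative is a multiple of `a`. Its coefficient may remain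
  -- unspecified, since the curvature is needed only up to combinations of `a`, `b`, `w`.
  refine ⟨γ y (A y), ?_⟩
  simp only [projectiveChange, add_apply, smul_apply, map_add, map_smul,
    ContinuousLinearMap.smulRight_apply, ContinuousLinearMap.id_apply, hXy, hAy, e]
  simp
  module

/-- A projective change alters the curvature only by combinations of its three arguments: after
antisymmetrizing, the terms pairing `γ` with Christoffel symbols cancel by the symmetry of these.
Tangent arguments therefore give a tangent value. -/
theorem IsProjectivelyFlat.coordCurvature_eq (ht : D.torsion = 0)
    (h : IsProjectivelyFlat (D : ConnOp m M)) (y : M) (a b w : EuclideanSpace ℝ (Fin m)) :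
    ∃ r s t : ℝ, coordCurvature (christoffel (D : ConnOp m M) y) (coordPt m y y) a b w =
      r • a + s • b + t • w := by
  have hy := mem_chartDom (m := m) y
  obtain ⟨U, hU, hyU, γ, hγ, hflat⟩ := h y
  obtain ⟨X, hX, hXa⟩ := exists_global_constField y a
  obtain ⟨Y, hY, hYb⟩ := exists_global_constField y b
  obtain ⟨Z, hZ, hZw⟩ := exists_global_constField y w
  have hsm : ∀ X : VField m M, IsSmoothFieldOn X univ →
      ContMDiffAt (𝓡 m) 𝓘(ℝ, ℝ) ∞ (fun x ↦ γ x (X x)) y := fun X hX ↦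
    (hγ U subset_rfl hU X (hX.mono (subset_univ U))).contMDiffAt (hU.mem_nhds hyU)
  have hR := hflat X Y Z (hX.mono (subset_univ U)) (hY.mono (subset_univ U))
    (hZ.mono (subset_univ U)) y hyU
  have hbr : VectorField.mlieBracket (𝓡 m) X Y y = 0 := by
    have h1 : X =ᶠ[nhds y] constField y a := hXa
    have h2 : Y =ᶠ[nhds y] constField y b := hYb
    rw [h1.mlieBracket_vectorField_eq h2, mlieBracket_constField hy]
  obtain ⟨s, hs⟩ := toCoord_projectiveChange_iterate D hZ hXa hYb hZw (hsm Y hY) (hsm Z hZ)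
  obtain ⟨t, htt⟩ := toCoord_projectiveChange_iterate D hZ hYb hXa hZw (hsm X hX) (hsm Z hZ)
  have key := congrArg (toCoord y y) hR
  rw [curvature, hbr, map_zero, sub_zero, map_sub, hs, htt, map_zero] at key
  rw [christoffel_symm D ht hy b a] at key
  -- The coefficients are read off from the difference of the two iterated derivatives.
  refine ⟨fderiv ℝ (coordFun m y fun x ↦ γ x (Z x)) (coordPt m y y) b
      + γ y (Y y) * γ y (Z y) - s,
    t - fderiv ℝ (coordFun m y fun x ↦ γ x (Z x)) (coordPt m y y) a - γ y (X y) * γ y (Z y),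
    fderiv ℝ (coordFun m y fun x ↦ γ x (X x)) (coordPt m y y) b
      - fderiv ℝ (coordFun m y fun x ↦ γ x (Y x)) (coordPt m y y) a, ?_⟩
  rw [coordCurvature, ← sub_eq_zero, ← key]
  module

end ProjectivelyFlat

/-! ### Fields along an immersion in coordinates -/

section Along

set_option maxSynthPendingDepth 3

variable {n : ℕ} {S : Type*} [TopologicalSpace S] [ChartedSpace (EuclideanSpace ℝ (Fin n)) S]
  {M : Type*} [TopologicalSpace M] [ChartedSpace (EuclideanSpace ℝ (Fin (n + 1))) M]

/-- The points of the chart domain at `p` whose image lies in the chart domain at `f p`. -/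
def localDom (n : ℕ) {S : Type*} [TopologicalSpace S] [ChartedSpace (EuclideanSpace ℝ (Fin n)) S]
    {M : Type*} [TopologicalSpace M] [ChartedSpace (EuclideanSpace ℝ (Fin (n + 1))) M] (f : S → M)
    (p : S) : Set S :=
  chartDom n p ∩ f ⁻¹' chartDom (n + 1) (f p)

theorem mem_localDom (f : S → M) (p : S) : p ∈ localDom n f p :=
  ⟨mem_chartDom p, mem_chartDom (f p)⟩

theorem isOpen_localDom {f : S → M} (hf : Continuous f) (p : S) : IsOpen (localDom n f p) :=
  (chartAt (EuclideanSpace ℝ (Fin n)) p).open_source.inter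
    ((chartAt (EuclideanSpace ℝ (Fin (n + 1))) (f p)).open_source.preimage hf)

/-- The coordinate expression of `f` in the charts at `p` and `f p`. -/
def localMap (n : ℕ) {S : Type*} [TopologicalSpace S] [ChartedSpace (EuclideanSpace ℝ (Fin n)) S]
    {M : Type*} [TopologicalSpace M] [ChartedSpace (EuclideanSpace ℝ (Fin (n + 1))) M] (f : S → M)
    (p : S) : EuclideanSpace ℝ (Fin n) → EuclideanSpace ℝ (Fin (n + 1)) :=
  coordFun n p fun q ↦ coordPt (n + 1) (f p) (f q)

/-- The part of the coordinate domain at `p` that corresponds to `U ∩ localDom n f p`. -/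
def coordDom (n : ℕ) {S : Type*} [TopologicalSpace S] [ChartedSpace (EuclideanSpace ℝ (Fin n)) S]
    {M : Type*} [TopologicalSpace M] [ChartedSpace (EuclideanSpace ℝ (Fin (n + 1))) M] (f : S → M)
    (p : S) (U : Set S) : Set (EuclideanSpace ℝ (Fin n)) :=
  (extChartAt (𝓡 n) p).target ∩ (extChartAt (𝓡 n) p).symm ⁻¹' (localDom n f p ∩ U)

theorem coordPt_mem_coordDom {f : S → M} {p q : S} {U : Set S} (hq : q ∈ localDom n f p)
    (hU : q ∈ U) : coordPt n p q ∈ coordDom n f p U := by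
  refine ⟨coordPt_mem_target hq.1, ?_⟩
  rw [mem_preimage, symm_coordPt hq.1]
  exact ⟨hq, hU⟩

theorem exists_of_mem_coordDom {f : S → M} {p : S} {U : Set S} {x : EuclideanSpace ℝ (Fin n)}
    (hx : x ∈ coordDom n f p U) : ∃ q ∈ localDom n f p ∩ U, coordPt n p q = x :=
  ⟨_, hx.2, coordPt_symm hx.1⟩

theorem isOpen_coordDom {f : S → M} (hf : Continuous f) (p : S) {U : Set S} (hU : IsOpen U) :
    IsOpen (coordDom n f p U) :=
  (continuousOn_extChartAt_symm p).isOpen_inter_preimage (isOpen_extChartAt_target p)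
    ((isOpen_localDom hf p).inter hU)

theorem eventually_of_localDom {f : S → M} (hf : Continuous f) {p q : S}
    (hq : q ∈ localDom n f p) {P : EuclideanSpace ℝ (Fin n) → Prop}
    (h : ∀ r ∈ localDom n f p, P (coordPt n p r)) : ∀ᶠ x in nhds (coordPt n p q), P x := by
  filter_upwards [(isOpen_coordDom hf p isOpen_univ).mem_nhds
    (coordPt_mem_coordDom hq (mem_univ q))] with x hx
  obtain ⟨r, hr, rfl⟩ := exists_of_mem_coordDom hx
  exact h r hr.1

variable [IsManifold (𝓡 n) ∞ S] [IsManifold (𝓡 (n + 1)) ∞ M]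

/-- The coordinate expression of a field along `f`. -/
def alongRep (f : S → M) (p : S) (V : FieldAlong n f) :
    EuclideanSpace ℝ (Fin n) → EuclideanSpace ℝ (Fin (n + 1)) :=
  coordFun n p fun q ↦ toCoord (f p) (f q) (V q)

omit [IsManifold (𝓡 n) ∞ S] [IsManifold (𝓡 (n + 1)) ∞ M] in
theorem localMap_coordPt {f : S → M} {p q : S} (hq : q ∈ localDom n f p) :
    localMap n f p (coordPt n p q) = coordPt (n + 1) (f p) (f q) := coordFun_coordPt hq.1 _

omit [IsManifold (𝓡 n) ∞ S] in
theorem alongRep_coordPt {f : S → M} {p q : S} (hq : q ∈ localDom n f p) (V : FieldAlong n f) :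
    alongRep f p V (coordPt n p q) = toCoord (f p) (f q) (V q) := coordFun_coordPt hq.1 _

/-- Differentiability of a field along `f`. -/
def IsDiffAlongAt (f : S → M) (V : FieldAlong n f) (q : S) : Prop :=
  MDifferentiableAt (𝓡 n) (𝓡 (n + 1)).tangent
    (fun r ↦ (⟨f r, V r⟩ : TangentBundle (𝓡 (n + 1)) M)) q

/-- The transition from the coordinates at `f q` to the coordinates at `f p`, along `f`. -/
def transition (n : ℕ) {S : Type*} {M : Type*} [TopologicalSpace M]
    [ChartedSpace (EuclideanSpace ℝ (Fin (n + 1))) M] [IsManifold (𝓡 (n + 1)) ∞ M] (f : S → M)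
    (p q r : S) :
    EuclideanSpace ℝ (Fin (n + 1)) →L[ℝ] EuclideanSpace ℝ (Fin (n + 1)) :=
  toCoord (f p) (f r) ∘L ofCoord (f q) (f r)

variable {f : S → M} (hf : ContMDiff (𝓡 n) (𝓡 (n + 1)) ∞ f) {p q : S}
include hf

theorem contDiffAt_localMap (hq : q ∈ localDom n f p) :
    ContDiffAt ℝ ∞ (localMap n f p) (coordPt n p q) :=
  (contMDiffAt_iff_coordFun hq.1).1 ((contMDiffAt_extChartAt' hq.2).comp q hf.contMDiffAt)

theorem isDiffAlongAt_iff (hq : q ∈ localDom n f p) (V : FieldAlong n f) :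
    IsDiffAlongAt f V q ↔ DifferentiableAt ℝ (alongRep f p V) (coordPt n p q) := by
  have hs : (fun r ↦ (⟨f r, V r⟩ : TangentBundle (𝓡 (n + 1)) M)) q ∈
      (trivializationAt (EuclideanSpace ℝ (Fin (n + 1)))
        (TangentSpace (𝓡 (n + 1)) : M → Type _) (f p)).source :=
    (Trivialization.mem_source _).2 hq.2
  rw [IsDiffAlongAt, Trivialization.mdifferentiableAt_totalSpace_iff (𝓡 (n + 1))
    (trivializationAt (EuclideanSpace ℝ (Fin (n + 1))) (TangentSpace (𝓡 (n + 1)) : M → Type _)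
      (f p)) (fun r ↦ (⟨f r, V r⟩ : TangentBundle (𝓡 (n + 1)) M)) hs,
    and_iff_right (hf.contMDiffAt.mdifferentiableAt (by simp)), mdifferentiableAt_iff_coordFun hq.1]
  refine Filter.EventuallyEq.differentiableAt_iff (eventually_coordFun_eq hq.1 ?_)
  filter_upwards [(isOpen_localDom hf.continuous p).mem_nhds hq] with z hz
  exact trivializationAt_snd hz.2 _

theorem contMDiffAt_along_iff (hq : q ∈ localDom n f p) (V : FieldAlong n f) :
    ContMDiffAt (𝓡 n) (𝓡 (n + 1)).tangent ∞
        (fun r ↦ (⟨f r, V r⟩ : TangentBundle (𝓡 (n + 1)) M)) q ↔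
      ContDiffAt ℝ ∞ (alongRep f p V) (coordPt n p q) := by
  have hs : (fun r ↦ (⟨f r, V r⟩ : TangentBundle (𝓡 (n + 1)) M)) q ∈
      (trivializationAt (EuclideanSpace ℝ (Fin (n + 1)))
        (TangentSpace (𝓡 (n + 1)) : M → Type _) (f p)).source :=
    (Trivialization.mem_source _).2 hq.2
  rw [Trivialization.contMDiffAt_iff
    (e := trivializationAt (EuclideanSpace ℝ (Fin (n + 1)))
      (TangentSpace (𝓡 (n + 1)) : M → Type _) (f p))
      (f := fun r ↦ (⟨f r, V r⟩ : TangentBundle (𝓡 (n + 1)) M)) hs,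
    and_iff_right hf.contMDiffAt, contMDiffAt_iff_coordFun hq.1]
  have : coordFun n p (fun z ↦ (trivializationAt (EuclideanSpace ℝ (Fin (n + 1)))
      (TangentSpace (𝓡 (n + 1)) : M → Type _) (f p) ⟨f z, V z⟩).2) =ᶠ[nhds (coordPt n p q)]
        alongRep f p V := by
    refine eventually_coordFun_eq hq.1 ?_
    filter_upwards [(isOpen_localDom hf.continuous p).mem_nhds hq] with z hz
    exact trivializationAt_snd hz.2 _
  exact ⟨fun h ↦ h.congr_of_eventuallyEq this.symm, fun h ↦ h.congr_of_eventuallyEq this⟩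

theorem contDiffOn_alongRep {V : FieldAlong n f} {U : Set S} (hU : IsOpen U)
    (hV : IsSmoothAlongOn f V U) (p : S) :
    ContDiffOn ℝ ∞ (alongRep f p V) (coordDom n f p U) := by
  intro x hx
  obtain ⟨q, hq, rfl⟩ := exists_of_mem_coordDom hx
  exact ((contMDiffAt_along_iff hf hq.1 V).1
    (hV.contMDiffAt (hU.mem_nhds hq.2))).contDiffWithinAt

theorem toCoord_dAt (hq : q ∈ localDom n f p) (Y : TangentSpace (𝓡 n) q) :
    toCoord (f p) (f q) (dAt n f q Y) =
      fderiv ℝ (localMap n f p) (coordPt n p q) (toCoord p q Y) := by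
  have h1 : MDifferentiableAt (𝓡 (n + 1)) 𝓘(ℝ, EuclideanSpace ℝ (Fin (n + 1)))
      (extChartAt (𝓡 (n + 1)) (f p)) (f q) :=
    (contMDiffAt_extChartAt' (n := ∞) hq.2).mdifferentiableAt (by simp)
  have h2 : MDifferentiableAt (𝓡 n) (𝓡 (n + 1)) f q := hf.contMDiffAt.mdifferentiableAt (by simp)
  have h3 := mfderiv_eq_fderiv_coordFun hq.1 (h1.comp q h2) Y
  rw [mfderiv_comp q h1 h2, ← toCoord_eq_mfderiv hq.2] at h3
  exact h3

omit [IsManifold (𝓡 n) ∞ S] [IsManifold (𝓡 (n + 1)) ∞ M] in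
/-- The coordinate expression of the composition of a function on `M` with `f`. -/
theorem coordFun_comp_eventuallyEq {V : Type*} (hq : q ∈ localDom n f p) (g : M → V) :
    coordFun n p (g ∘ f) =ᶠ[nhds (coordPt n p q)]
      coordFun (n + 1) (f p) g ∘ localMap n f p := by
  refine eventually_of_localDom hf.continuous hq fun r hr ↦ ?_
  rw [coordFun_coordPt hr.1, Function.comp_apply, Function.comp_apply, localMap_coordPt hr,
    coordFun_coordPt hr.2]

theorem contDiffAt_transition (hq : q ∈ localDom n f p) :
    ContDiffAt ℝ ∞ (coordFun n p (transition n f p q)) (coordPt n p q) := by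
  let U : Set S := f ⁻¹' chartDom (n + 1) (f q)
  have hU : IsOpen U :=
    ((chartAt (EuclideanSpace ℝ (Fin (n + 1))) (f q)).open_source.preimage hf.continuous)
  refine contDiffAt_clm_of_apply (isOpen_coordDom hf.continuous p hU) (fun w x hx ↦ ?_)
    (coordPt_mem_coordDom hq (mem_chartDom (f q)))
  obtain ⟨r, ⟨hr, hrU⟩, rfl⟩ := exists_of_mem_coordDom hx
  have h1 := (contMDiffAt_field_iff hr.2 _).1 (contMDiffAt_constField hrU w)
  rw [← localMap_coordPt hr] at h1
  exact (h1.comp _ (contDiffAt_localMap hf hr)).congr_of_eventuallyEq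
    (coordFun_comp_eventuallyEq hf hr fun z ↦ toCoord (f p) z (constField (f q) w z))

/-- `covAlong` at `q` uses the trivialization at `f q`, whereas computations use one fixed chart at
`f p`. The product rule for the transition between them gives two terms, the first of which is
matched by `fderiv_extend_comp`. -/
theorem fderiv_alongRep (hq : q ∈ localDom n f p) {V : FieldAlong n f} (hV : IsDiffAlongAt f V q)
    (X : EuclideanSpace ℝ (Fin n)) :
    fderiv ℝ (alongRep f p V) (coordPt n p q) X =
      fderiv ℝ (coordFun n p (transition n f p q)) (coordPt n p q) X (toCoord (f q) (f q) (V q)) +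
        transition n f p q q
          (fderiv ℝ (coordFun n p fun r ↦ toCoord (f q) (f r) (V r)) (coordPt n p q) X) := by
  have hqq := mem_localDom (n := n) f q
  have hw : DifferentiableAt ℝ (coordFun n p fun r ↦ toCoord (f q) (f r) (V r)) (coordPt n p q) :=
    (mdifferentiableAt_iff_coordFun hq.1).1
      ((mdifferentiableAt_iff_coordFun hqq.1).2 ((isDiffAlongAt_iff hf hqq V).1 hV))
  have hH : DifferentiableAt ℝ (coordFun n p (transition n f p q)) (coordPt n p q) :=
    (contDiffAt_transition hf hq).differentiableAt (by simp)
  have hrep : alongRep f p V =ᶠ[nhds (coordPt n p q)] fun y ↦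
      coordFun n p (transition n f p q) y (coordFun n p (fun r ↦ toCoord (f q) (f r) (V r)) y) := by
    refine eventually_symm (P := fun r ↦ toCoord (f p) (f r) (V r) =
      transition n f p q r (toCoord (f q) (f r) (V r))) hq.1 ?_
    filter_upwards [(isOpen_localDom hf.continuous q).mem_nhds hqq] with r hr
    exact congrArg (toCoord (f p) (f r)) (ofCoord_toCoord hr.2 (V r)).symm
  rw [hrep.fderiv_eq, (hH.hasFDerivAt.clm_apply hw.hasFDerivAt).fderiv,
    coordFun_coordPt hq.1, coordFun_coordPt hq.1, add_apply]
  exact add_comm _ _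

/-- In the chart at `f p`, the extension of `v` has along `f` the coordinates of `v` transported by
the transition; only the transition varies. -/
theorem fderiv_extend_comp (hq : q ∈ localDom n f p) (v : TangentSpace (𝓡 (n + 1)) (f q))
    (X : EuclideanSpace ℝ (Fin n)) :
    fderiv ℝ (coordField (f p) (FiberBundle.extend (EuclideanSpace ℝ (Fin (n + 1))) v))
      (localMap n f p (coordPt n p q)) (fderiv ℝ (localMap n f p) (coordPt n p q) X) =
      fderiv ℝ (coordFun n p (transition n f p q)) (coordPt n p q) X (toCoord (f q) (f q) v) := by
  have hqq := mem_localDom (n := n) f q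
  have hfield : IsDiffFieldAt (FiberBundle.extend (EuclideanSpace ℝ (Fin (n + 1))) v) (f q) :=
    FiberBundle.mdifferentiableAt_extend (𝓡 (n + 1)) (EuclideanSpace ℝ (Fin (n + 1))) v
  have hH : DifferentiableAt ℝ (coordFun n p (transition n f p q)) (coordPt n p q) :=
    (contDiffAt_transition hf hq).differentiableAt (by simp)
  have hconst : (fun y ↦ coordFun n p (transition n f p q) y (toCoord (f q) (f q) v))
      =ᶠ[nhds (coordPt n p q)]
      coordField (f p) (FiberBundle.extend (EuclideanSpace ℝ (Fin (n + 1))) v) ∘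
        localMap n f p := by
    refine Filter.EventuallyEq.trans ?_ (coordFun_comp_eventuallyEq hf hq _)
    refine eventually_symm (P := fun r ↦ transition n f p q r (toCoord (f q) (f q) v) =
      toCoord (f p) (f r) (FiberBundle.extend (EuclideanSpace ℝ (Fin (n + 1))) v (f r))) hq.1 ?_
    filter_upwards [(isOpen_localDom hf.continuous q).mem_nhds hqq] with r hr
    exact congrArg (toCoord (f p) (f r)) (extend_eq v hr.2).symm
  have e1 := (isDiffFieldAt_iff hq.2 _).1 hfield
  rw [← localMap_coordPt hq] at e1
  have e2 := (hH.hasFDerivAt.clm_apply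
    (hasFDerivAt_const (toCoord (f q) (f q) v) (coordPt n p q))).fderiv
  have e3 := e1.hasFDerivAt.comp (coordPt n p q)
    ((contDiffAt_localMap hf hq).differentiableAt (by simp)).hasFDerivAt
  rw [hconst.fderiv_eq, e3.fderiv] at e2
  have := DFunLike.congr_fun e2 X
  simpa using this

/-- The pullback connection in the charts at `p` and `f p`. -/
theorem toCoord_covAlong {D : ConnOp (n + 1) M}
    (hD : IsCovariantDerivativeOn (I := 𝓡 (n + 1)) (EuclideanSpace ℝ (Fin (n + 1))) D univ)
    (hq : q ∈ localDom n f p) {V : FieldAlong n f} (hV : IsDiffAlongAt f V q)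
    (X : TangentSpace (𝓡 n) q) :
    toCoord (f p) (f q) (covAlong f D V q X) =
      coordCovDeriv (christoffel D (f p)) (localMap n f p) (alongRep f p V) (coordPt n p q)
        (toCoord p q X) := by
  have hqq := mem_localDom (n := n) f q
  have hw : MDifferentiableAt (𝓡 n) 𝓘(ℝ, EuclideanSpace ℝ (Fin (n + 1)))
      (fun r ↦ toCoord (f q) (f r) (V r)) q :=
    (mdifferentiableAt_iff_coordFun hqq.1).2 ((isDiffAlongAt_iff hf hqq V).1 hV)
  have hfield : IsDiffFieldAt (FiberBundle.extend (EuclideanSpace ℝ (Fin (n + 1))) (V q)) (f q) :=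
    FiberBundle.mdifferentiableAt_extend (𝓡 (n + 1)) (EuclideanSpace ℝ (Fin (n + 1))) (V q)
  have h2 := toCoord_connection hD hq.2 hfield (dAt n f q X)
  rw [toCoord_dAt hf hq, ← localMap_coordPt hq, fderiv_extend_comp hf hq,
    FiberBundle.extend_apply_self, ← alongRep_coordPt hq] at h2
  have h4 : mvfderiv (𝓡 n) (fun r ↦ (trivializationAt (EuclideanSpace ℝ (Fin (n + 1)))
      (TangentSpace (𝓡 (n + 1)) : M → Type _) (f q) ⟨f r, V r⟩).2) q X =
      fderiv ℝ (coordFun n p fun r ↦ toCoord (f q) (f r) (V r)) (coordPt n p q)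
        (toCoord p q X) := by
    have e1 : (fun r ↦ (trivializationAt (EuclideanSpace ℝ (Fin (n + 1)))
      (TangentSpace (𝓡 (n + 1)) : M → Type _) (f q) ⟨f r, V r⟩).2) =ᶠ[nhds q]
        fun r ↦ toCoord (f q) (f r) (V r) := by
      filter_upwards [(isOpen_localDom hf.continuous q).mem_nhds hqq] with r hr
      exact trivializationAt_snd hr.2 _
    have := mfderiv_eq_fderiv_coordFun hq.1 hw X
    rw [mvfderiv, e1.mfderiv_eq]
    exact this
  have h5 : covAlong f D V q X = ofCoord (f q) (f q) (mvfderiv (𝓡 n)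
      (fun r ↦ (trivializationAt (EuclideanSpace ℝ (Fin (n + 1)))
      (TangentSpace (𝓡 (n + 1)) : M → Type _) (f q) ⟨f r, V r⟩).2) q X) +
      D (FiberBundle.extend (EuclideanSpace ℝ (Fin (n + 1))) (V q)) (f q) (dAt n f q X) := rfl
  -- The derivative of the components and that of the local frame, the two parts of `covAlong`, add
  -- up to the derivative of the coordinate expression in the chart at `f p`; the Christoffel term
  -- is left over.
  rw [h5, map_add, h4, h2, coordCovDeriv_apply, fderiv_alongRep hf hq hV, ← add_assoc]
  congr 1
  exact add_comm _ _

end Along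

/-! ### The induced objects in coordinates -/

section InducedCoordinates

set_option maxSynthPendingDepth 3

theorem isInvertible_of_injective {V W : Type*} [NormedAddCommGroup V] [NormedSpace ℝ V]
    [FiniteDimensional ℝ V] [NormedAddCommGroup W] [NormedSpace ℝ W] [FiniteDimensional ℝ W]
    (L : V →L[ℝ] W) (hL : Function.Injective L)
    (h : Module.finrank ℝ V = Module.finrank ℝ W) : L.IsInvertible :=
  ⟨(LinearEquiv.ofInjectiveOfFinrankEq (L : V →ₗ[ℝ] W) hL h).toContinuousLinearEquiv, by
    ext v; rfl⟩

variable {n : ℕ} {S : Type*} [TopologicalSpace S] [ChartedSpace (EuclideanSpace ℝ (Fin n)) S]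
  {M : Type*} [TopologicalSpace M] [ChartedSpace (EuclideanSpace ℝ (Fin (n + 1))) M]
  {f : S → M} {N : FieldAlong n f} {p q : S}

theorem splitting_apply (Y : TangentSpace (𝓡 n) q) (c : ℝ) :
    splitting f N q (Y, c) = dAt n f q Y + c • N q := by
  simp [splitting]

theorem isInvertible_splitting_iff (hinj : Function.Injective (dAt n f q)) :
    (splitting f N q).IsInvertible ↔ N q ∉ (dAt n f q).toLinearMap.range := by
  constructor
  · rintro h ⟨u, hu⟩
    have h1 : splitting f N q (u, -1) = splitting f N q (0, 0) := by
      rw [splitting_apply, splitting_apply, ← hu]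
      simp
    have h2 := h.injective h1
    simp at h2
  · intro h
    have hi : Function.Injective (splitting f N q) := by
      rw [injective_iff_map_eq_zero]
      rintro ⟨u, c⟩ huc
      rw [splitting_apply] at huc
      have hc : c = 0 := by
        by_contra hc
        refine h ⟨-(c⁻¹ • u), ?_⟩
        have : c⁻¹ • (dAt n f q u + c • N q) = 0 := by rw [huc, smul_zero]
        rw [smul_add, smul_smul, inv_mul_cancel₀ hc, one_smul] at this
        change dAt n f q (-(c⁻¹ • u)) = N q
        rw [map_neg, map_smul]
        exact (eq_neg_of_add_eq_zero_right this).symm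
      rw [hc, zero_smul, add_zero] at huc
      rw [hinj (huc.trans (map_zero _).symm), hc]
      rfl
    -- An injective map between spaces of dimension `n + 1` is invertible; the tangent spaces are,
    -- by definition, the model spaces named here.
    exact isInvertible_of_injective (V := EuclideanSpace ℝ (Fin n) × ℝ)
      (W := EuclideanSpace ℝ (Fin (n + 1))) (splitting f N q) hi (by simp)

variable [IsManifold (𝓡 n) ∞ S] [IsManifold (𝓡 (n + 1)) ∞ M]
  (hf : ContMDiff (𝓡 n) (𝓡 (n + 1)) ∞ f)
include hf

/-- The coordinate isomorphisms intertwine the two splittings, so invertibility and the components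
of a vector can be read in any admissible charts. -/
theorem splitting_eq (hq : q ∈ localDom n f p) :
    splitting f N q = ((coordEquiv hq.2).symm : _ →L[ℝ] _) ∘L
      coordSplitting (localMap n f p) (alongRep f p N) (coordPt n p q) ∘L
        (((coordEquiv hq.1).prodCongr (ContinuousLinearEquiv.refl ℝ ℝ) :
          (TangentSpace (𝓡 n) q × ℝ) ≃L[ℝ] (EuclideanSpace ℝ (Fin n) × ℝ)) : _ →L[ℝ] _) := by
  refine ContinuousLinearMap.ext fun w ↦ ?_
  apply (coordEquiv hq.2).injective
  obtain ⟨Y, c⟩ := w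
  simp only [ContinuousLinearMap.comp_apply, ContinuousLinearEquiv.coe_coe,
    ContinuousLinearEquiv.apply_symm_apply, ContinuousLinearEquiv.prodCongr_apply,
    ContinuousLinearEquiv.refl_apply, coordEquiv_apply, coordSplitting_apply]
  rw [splitting_apply, map_add, map_smul, toCoord_dAt hf hq, alongRep_coordPt hq]

theorem isInvertible_splitting_iff_coord (hq : q ∈ localDom n f p) :
    (splitting f N q).IsInvertible ↔
      (coordSplitting (localMap n f p) (alongRep f p N) (coordPt n p q)).IsInvertible := by
  rw [splitting_eq hf hq, ContinuousLinearMap.isInvertible_equiv_comp,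
    ContinuousLinearMap.isInvertible_comp_equiv]

theorem inverse_splitting_apply (hq : q ∈ localDom n f p) (u : TangentSpace (𝓡 (n + 1)) (f q)) :
    (splitting f N q).inverse u =
      (ofCoord p q (tangentialPart (localMap n f p) (alongRep f p N) (coordPt n p q)
        (toCoord (f p) (f q) u)),
        transversalPart (localMap n f p) (alongRep f p N) (coordPt n p q)
        (toCoord (f p) (f q) u)) := by
  rw [splitting_eq hf hq, ContinuousLinearMap.inverse_equiv_comp,
    ContinuousLinearMap.inverse_comp_equiv]
  rfl

theorem isDiffAlongAt_dAt (hq : q ∈ localDom n f p) {Y : VField n S} (hY : IsDiffFieldAt Y q) :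
    HasFDerivAt (alongRep f p fun r ↦ dAt n f r (Y r))
      ((fderiv ℝ (localMap n f p) (coordPt n p q)) ∘L
          fderiv ℝ (coordField p Y) (coordPt n p q)
        + (fderiv ℝ (fderiv ℝ (localMap n f p)) (coordPt n p q)).flip (toCoord p q (Y q)))
      (coordPt n p q) := by
  have h1 := ((isDiffFieldAt_iff hq.1 Y).1 hY).hasFDerivAt
  have h2 := (((contDiffAt_localMap hf hq).fderiv_right (m := ∞) (by simp)).differentiableAt
    (by simp)).hasFDerivAt
  have h3 := h2.clm_apply h1
  rw [coordField_coordPt hq.1] at h3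
  refine h3.congr_of_eventuallyEq ?_
  refine eventually_of_localDom hf.continuous hq fun r hr ↦ ?_
  rw [alongRep_coordPt hr, toCoord_dAt hf hr]
  simp only [coordField_coordPt hr.1]

section Connection

variable {D : ConnOp (n + 1) M}
  (hD : IsCovariantDerivativeOn (I := 𝓡 (n + 1)) (EuclideanSpace ℝ (Fin (n + 1))) D univ)
include hD

/-- The derivative of the components of `Y` enters only tangentially. It therefore drops out of the
metric (`inducedMetric_eq`) and becomes the derivative term of the connection
(`toCoord_inducedConnection`). -/
theorem toCoord_covTangent (hq : q ∈ localDom n f p) {Y : VField n S} (hY : IsDiffFieldAt Y q)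
    (X : TangentSpace (𝓡 n) q) :
    toCoord (f p) (f q) (covTangent f D Y q X) =
      fderiv ℝ (localMap n f p) (coordPt n p q)
        (fderiv ℝ (coordField p Y) (coordPt n p q) (toCoord p q X)) +
      coordSff (christoffel D (f p)) (localMap n f p) (coordPt n p q) (toCoord p q X)
        (toCoord p q (Y q)) := by
  have h := isDiffAlongAt_dAt hf hq hY
  rw [covTangent, toCoord_covAlong hf hD hq ((isDiffAlongAt_iff hf hq _).2 h.differentiableAt),
    coordCovDeriv_apply, h.fderiv, alongRep_coordPt hq, toCoord_dAt hf hq, coordSff_apply]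
  simp [add_assoc]

theorem inducedMetric_eq (hq : q ∈ localDom n f p) (hN : (splitting f N q).IsInvertible)
    (X Y : TangentSpace (𝓡 n) q) :
    inducedMetric f D N q X Y = coordMetric (christoffel D (f p)) (localMap n f p)
      (alongRep f p N) (coordPt n p q) (toCoord p q X) (toCoord p q Y) := by
  have hY : IsDiffFieldAt (FiberBundle.extend (EuclideanSpace ℝ (Fin n)) Y) q :=
    FiberBundle.mdifferentiableAt_extend (𝓡 n) (EuclideanSpace ℝ (Fin n)) Y
  rw [inducedMetric, inverse_splitting_apply hf hq, toCoord_covTangent hf hD hq hY,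
    FiberBundle.extend_apply_self]
  dsimp only
  rw [map_add,
    transversalPart_fderiv ((isInvertible_splitting_iff_coord hf hq).1 hN), zero_add]
  rfl

theorem toCoord_inducedConnection (hq : q ∈ localDom n f p) (hN : (splitting f N q).IsInvertible)
    {Y : VField n S} (hY : IsDiffFieldAt Y q) (X : TangentSpace (𝓡 n) q) :
    toCoord p q (inducedConnection f D N Y q X) =
      fderiv ℝ (coordField p Y) (coordPt n p q) (toCoord p q X) +
      coordConn (christoffel D (f p)) (localMap n f p) (alongRep f p N) (coordPt n p q)
        (toCoord p q X) (toCoord p q (Y q)) := by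
  have h1 : inducedConnection f D N Y q X = ((splitting f N q).inverse (covTangent f D Y q X)).1 :=
    rfl
  rw [h1, inverse_splitting_apply hf hq, toCoord_covTangent hf hD hq hY,
    toCoord_ofCoord hq.1, map_add,
    tangentialPart_fderiv ((isInvertible_splitting_iff_coord hf hq).1 hN)]
  rfl

omit hD in
theorem isLocalTransversal_alongRep {U : Set S} (hU : IsOpen U) (hN : IsSmoothAlongOn f N U)
    (hNt : ∀ q ∈ U, (splitting f N q).IsInvertible) (p : S) :
    IsLocalTransversal (localMap n f p) (alongRep f p N) (coordDom n f p U) where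
  smooth := contDiffOn_alongRep hf hU hN p
  isInvertible := by
    intro x hx
    obtain ⟨q, hq, rfl⟩ := exists_of_mem_coordDom hx
    exact (isInvertible_splitting_iff_coord hf hq.1).1 (hNt q hq.2)

end Connection

section Torsionfree

variable [T2Space M] (D : CovariantDerivative (𝓡 (n + 1)) (EuclideanSpace ℝ (Fin (n + 1)))
    (TangentSpace (𝓡 (n + 1)) : M → Type _))
  [CovariantDerivative.ContMDiffCovariantDerivative D ∞]

theorem isLocalMap_localMap (ht : D.torsion = 0) (p : S) {U : Set S} (hU : IsOpen U) :
    IsLocalMap (christoffel (D : ConnOp (n + 1) M) (f p)) (localMap n f p)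
      (coordDom n f p U) where
  isOpen := isOpen_coordDom hf.continuous p hU
  smooth := by
    intro x hx
    obtain ⟨q, hq, rfl⟩ := exists_of_mem_coordDom hx
    exact (contDiffAt_localMap hf hq.1).contDiffWithinAt
  smooth_christoffel := by
    intro x hx
    obtain ⟨q, hq, rfl⟩ := exists_of_mem_coordDom hx
    rw [localMap_coordPt hq.1]
    exact contDiffAt_christoffel D hq.1.2
  symm := by
    intro x hx u w
    obtain ⟨q, hq, rfl⟩ := exists_of_mem_coordDom hx
    rw [localMap_coordPt hq.1]
    exact christoffel_symm D ht hq.1.2 u w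

/-- The extensions of `Y` and `Z` need not be constant in the chart at `p`. Their derivatives,
produced by the product rule, are cancelled by the same derivatives inside `∇_X Y` and `∇_X Z`. -/
theorem covDerivBilin_induced_eq (ht : D.torsion = 0) {U : Set S} (hU : IsOpen U)
    (hN : IsSmoothAlongOn f N U) (hNt : ∀ q ∈ U, (splitting f N q).IsInvertible)
    (hq : q ∈ localDom n f p) (hqU : q ∈ U) (X Y Z : TangentSpace (𝓡 n) q) :
    covDerivBilin (inducedConnection f D N) (inducedMetric f D N) q X Y Z =
      coordCubic (christoffel (D : ConnOp (n + 1) M) (f p)) (localMap n f p) (alongRep f p N)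
        (coordPt n p q) (toCoord p q X) (toCoord p q Y) (toCoord p q Z) := by
  have hcov := D.isCovariantDerivativeOnUniv
  set Γ := christoffel (D : ConnOp (n + 1) M) (f p) with hΓ
  set F := localMap n f p
  set N' := alongRep f p N
  have hF := isLocalMap_localMap hf D ht p hU
  have hN' := isLocalTransversal_alongRep hf hU hN hNt p
  have hx := coordPt_mem_coordDom hq hqU
  have hmet := ((contDiffAt_coordMetric hF hN' hx).differentiableAt (by simp)).hasFDerivAt
  have hdiff : ∀ Y : TangentSpace (𝓡 n) q,
      IsDiffFieldAt (FiberBundle.extend (EuclideanSpace ℝ (Fin n)) Y) q := fun Y ↦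
    FiberBundle.mdifferentiableAt_extend (𝓡 n) (EuclideanSpace ℝ (Fin n)) Y
  have hconn : ∀ Y : TangentSpace (𝓡 n) q, toCoord p q
      (inducedConnection f D N (FiberBundle.extend (EuclideanSpace ℝ (Fin n)) Y) q X) =
      fderiv ℝ (coordField p (FiberBundle.extend (EuclideanSpace ℝ (Fin n)) Y)) (coordPt n p q)
        (toCoord p q X) +
      coordConn Γ F N' (coordPt n p q) (toCoord p q X) (toCoord p q Y) := by
    intro Y
    rw [toCoord_inducedConnection hf hcov hq (hNt q hqU) (hdiff Y), FiberBundle.extend_apply_self]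
  have hfun : coordFun n p (fun y ↦ inducedMetric f D N y
      (FiberBundle.extend (EuclideanSpace ℝ (Fin n)) Y y)
      (FiberBundle.extend (EuclideanSpace ℝ (Fin n)) Z y)) =ᶠ[nhds (coordPt n p q)]
      fun x ↦ coordMetric Γ F N' x
        (coordField p (FiberBundle.extend (EuclideanSpace ℝ (Fin n)) Y) x)
        (coordField p (FiberBundle.extend (EuclideanSpace ℝ (Fin n)) Z) x) := by
    filter_upwards [hF.isOpen.mem_nhds hx] with x hxU
    obtain ⟨r, hr, rfl⟩ := exists_of_mem_coordDom hxU
    rw [coordField_coordPt hr.1.1, coordField_coordPt hr.1.1, coordFun_coordPt hr.1.1,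
      inducedMetric_eq hf hcov hr.1 (hNt r hr.2)]
  have hder := (hmet.clm_apply ((isDiffFieldAt_iff hq.1 _).1 (hdiff Y)).hasFDerivAt).clm_apply
    ((isDiffFieldAt_iff hq.1 _).1 (hdiff Z)).hasFDerivAt
  have hder' := hder.congr_of_eventuallyEq hfun
  have hmd := (mdifferentiableAt_iff_coordFun hq.1).2 hder'.differentiableAt
  rw [covDerivBilin, mvfderiv_eq_fderiv_coordFun hq.1 hmd, hder'.fderiv,
    inducedMetric_eq hf hcov hq (hNt q hqU), inducedMetric_eq hf hcov hq (hNt q hqU), hconn, hconn,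
    coordCubic, coordField_coordPt hq.1, coordField_coordPt hq.1, FiberBundle.extend_apply_self,
    FiberBundle.extend_apply_self]
  simp [Γ, F, N']
  ring

end Torsionfree

end InducedCoordinates

/-! ### Alignment in coordinates -/

section CoordAlignment

set_option maxSynthPendingDepth 3

variable {E E' : Type*} [NormedAddCommGroup E] [NormedSpace ℝ E]
  [NormedAddCommGroup E'] [NormedSpace ℝ E']
  {Γ : E' → E' →L[ℝ] E' →L[ℝ] E'} {F N N' : E → E'} {x : E} {Ω : Set E}
  {ι : Type*} [Fintype ι] [DecidableEq ι]

/-- The Gram matrix of the induced metric. -/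
def coordGram (Γ : E' → E' →L[ℝ] E' →L[ℝ] E') (F N : E → E') (b : ι → E) (x : E) :
    Matrix ι ι ℝ :=
  gram (fun u v ↦ coordMetric Γ F N x u v) b

/-- The defect of alignment of the induced connection. -/
def coordDefect (Γ : E' → E' →L[ℝ] E' →L[ℝ] E') (F N : E → E') (b : ι → E) (x z : E) : ℝ :=
  alignmentDefect (fun u v ↦ coordMetric Γ F N x u v) b (coordCubic Γ F N x) z

/-- `(Y, Z) ↦ (∇_X h)(Y, Z)` as a bilinear map. -/
def cubicRight (Γ : E' → E' →L[ℝ] E' →L[ℝ] E') (F N : E → E') (x X : E) : E →ₗ[ℝ] E →ₗ[ℝ] ℝ :=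
  LinearMap.mk₂ ℝ (coordCubic Γ F N x X)
    (fun u v w ↦ by simp [coordCubic]; ring) (fun c u v ↦ by simp [coordCubic]; ring)
    (fun u v w ↦ by simp [coordCubic]; ring) (fun c u v ↦ by simp [coordCubic]; ring)

/-- `(X, Y) ↦ (∇_X h)(Y, Z)` as a bilinear map. -/
def cubicLeft (Γ : E' → E' →L[ℝ] E' →L[ℝ] E') (F N : E → E') (x Z : E) : E →ₗ[ℝ] E →ₗ[ℝ] ℝ :=
  LinearMap.mk₂ ℝ (fun X Y ↦ coordCubic Γ F N x X Y Z)
    (fun u v w ↦ by simp [coordCubic]; ring) (fun c u v ↦ by simp [coordCubic]; ring)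
    (fun u v w ↦ by simp [coordCubic]; ring) (fun c u v ↦ by simp [coordCubic]; ring)

/-- The defect of alignment as a linear form. -/
def defectForm (Γ : E' → E' →L[ℝ] E' →L[ℝ] E') (F N : E → E') (b : ι → E) (x : E) :
    E →ₗ[ℝ] ℝ where
  toFun := coordDefect Γ F N b x
  map_add' u v := by
    have h1 : ∀ X Y, coordCubic Γ F N x X Y (u + v) =
        coordCubic Γ F N x X Y u + coordCubic Γ F N x X Y v := fun X Y ↦
      (cubicRight Γ F N x X Y).map_add u v
    have h2 : ∀ Y Z, coordCubic Γ F N x (u + v) Y Z =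
        coordCubic Γ F N x u Y Z + coordCubic Γ F N x v Y Z := fun Y Z ↦ by
      simp [coordCubic]; ring
    have h3 : coordCubic Γ F N x (u + v) =
        fun Y Z ↦ coordCubic Γ F N x u Y Z + coordCubic Γ F N x v Y Z := by ext Y Z; exact h2 Y Z
    simp only [coordDefect, alignmentDefect, h1, h3]
    simp only [contraction, mul_add, Finset.sum_add_distrib]
    ring
  map_smul' c u := by
    have h1 : ∀ X Y, coordCubic Γ F N x X Y (c • u) = c * coordCubic Γ F N x X Y u := fun X Y ↦
      (cubicRight Γ F N x X Y).map_smul c u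
    have h3 : coordCubic Γ F N x (c • u) = fun Y Z ↦ c * coordCubic Γ F N x u Y Z := by
      ext Y Z; simp [coordCubic]; ring
    simp only [coordDefect, alignmentDefect, h1, h3, RingHom.id_apply, smul_eq_mul]
    simp only [contraction, Finset.mul_sum, mul_left_comm _ c, mul_sub]

section Smooth

variable [FiniteDimensional ℝ E]

omit [FiniteDimensional ℝ E] in
theorem contDiffAt_det {A : E → Matrix ι ι ℝ} (hA : ∀ i j, ContDiffAt ℝ ∞ (fun y ↦ A y i j) x) :
    ContDiffAt ℝ ∞ (fun y ↦ (A y).det) x := by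
  simp only [Matrix.det_apply]
  exact ContDiffAt.sum fun σ _ ↦ (contDiffAt_prod fun i _ ↦ hA _ _).const_smul _

-- By Cramer's rule an entry of the inverse is a polynomial in the entries divided by the
-- determinant.
omit [FiniteDimensional ℝ E] in
theorem contDiffAt_inv_apply {A : E → Matrix ι ι ℝ}
    (hA : ∀ i j, ContDiffAt ℝ ∞ (fun y ↦ A y i j) x) (hdet : (A x).det ≠ 0) (p q : ι) :
    ContDiffAt ℝ ∞ (fun y ↦ (A y)⁻¹ p q) x := by
  simp only [Matrix.inv_def, Matrix.smul_apply, Matrix.adjugate_apply, smul_eq_mul,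
    Ring.inverse_eq_inv']
  refine ((contDiffAt_det hA).inv hdet).mul (contDiffAt_det fun i j ↦ ?_)
  simp only [Matrix.updateRow_apply]
  split_ifs
  · exact contDiffAt_const
  · exact hA i j

variable (hF : IsLocalMap Γ F Ω) (hN : IsLocalTransversal F N Ω) (hx : x ∈ Ω)
include hF hN hx

omit [Fintype ι] [DecidableEq ι] in
theorem contDiffAt_coordGram (b : ι → E) (i j : ι) :
    ContDiffAt ℝ ∞ (fun y ↦ coordGram Γ F N b y i j) x :=
  ((contDiffAt_coordMetric hF hN hx).clm_apply contDiffAt_const).clm_apply contDiffAt_const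

theorem contDiffAt_coordDefect {b : ι → E} (hdet : (coordGram Γ F N b x).det ≠ 0) (z : E) :
    ContDiffAt ℝ ∞ (fun y ↦ coordDefect Γ F N b y z) x := by
  have hG := contDiffAt_inv_apply (contDiffAt_coordGram hF hN hx b) hdet
  have hC := contDiffAt_coordCubic hF hN hx
  unfold coordDefect alignmentDefect contraction
  refine ContDiffAt.sub (contDiffAt_const.mul ?_) ?_
  · exact ContDiffAt.sum fun p _ ↦ ContDiffAt.sum fun q _ ↦ (hG p q).mul (hC _ _ _)
  · exact ContDiffAt.sum fun p _ ↦ ContDiffAt.sum fun q _ ↦ (hG p q).mul (hC _ _ _)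

/-- Behaviour of the defect under a change of transversal. -/
theorem coordDefect_change (hN' : IsLocalTransversal F N' Ω) (b : Module.Basis ι ℝ E)
    (hdet : (coordGram Γ F N b x).det ≠ 0) (z : E) :
    coordDefect Γ F N' b x z = coordDefect Γ F N b x z +
      ((Fintype.card ι + 2) * (Fintype.card ι - 1) * (transversalPart F N x (N' x))⁻¹) *
        coordMetric Γ F N x (tangentialPart F N x (N' x)) z := by
  -- The function `a` and the field `ζ` are the components of `N'` in the splitting given by `N`.
  have hdec : ∀ y ∈ Ω, N' y = transversalPart F N y (N' y) • N y +
      fderiv ℝ F y (tangentialPart F N y (N' y)) := fun y hy ↦ by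
    rw [add_comm]
    exact (fderiv_tangentialPart_add (hN.isInvertible y hy) (N' y)).symm
  -- If `a` vanished, `N'` would be tangent, although its component along itself is `1`.
  have ha0 : ∀ y ∈ Ω, transversalPart F N y (N' y) ≠ 0 := by
    intro y hy h0
    obtain ⟨u, hu⟩ := (transversalPart_eq_zero_iff (hN.isInvertible y hy) (N' y)).1 h0
    have hL' := hN'.isInvertible y hy
    have h1 := transversalPart_self hL'
    rw [← hu] at h1
    exact zero_ne_one ((transversalPart_fderiv hL' u).symm.trans h1)
  have ha : ContDiffAt ℝ ∞ (fun y ↦ transversalPart F N y (N' y)) x :=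
    (contDiffAt_transversalPart hF hN hx).clm_apply
      (hN'.smooth.contDiffAt (hF.isOpen.mem_nhds hx))
  have hc := fun X Y Z ↦ coordCubic_change (N' := N') (ζ := fun y ↦ tangentialPart F N y (N' y))
    hF hN hx ha ha0 hdec X Y Z
  have hm := fun X Y ↦ coordMetric_change (Γ := Γ) (hN.isInvertible x hx) (ha0 x hx) (hdec x hx) X Y
  have key := alignmentDefect_change (h := (coordMetric Γ F N x).toLinearMap₁₂) b hdet
    (fun u v ↦ hF.coordMetric_symm hx u v) (coordCubic Γ F N x)
    (fderiv ℝ (fun y ↦ transversalPart F N y (N' y)) x).toLinearMap (ha0 x hx)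
    (tangentialPart F N x (N' x)) z
  have hmm : (fun u v ↦ coordMetric Γ F N' x u v) =
    fun u v ↦ (transversalPart F N x (N' x))⁻¹ * coordMetric Γ F N x u v := by
    ext u v; exact hm u v
  rw [coordDefect, hmm]
  refine Eq.trans ?_ key
  congr 1
  ext X Y Z
  exact hc X Y Z

end Smooth

end CoordAlignment

/-! ### The affine normal distribution -/

section AffineNormal

set_option maxSynthPendingDepth 3

variable {n : ℕ} {S : Type*} [TopologicalSpace S] [ChartedSpace (EuclideanSpace ℝ (Fin n)) S]
  {M : Type*} [TopologicalSpace M] [ChartedSpace (EuclideanSpace ℝ (Fin (n + 1))) M]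
  {f : S → M} {N N' : FieldAlong n f} {p q : S} {U U' : Set S}
  [IsManifold (𝓡 n) ∞ S] [IsManifold (𝓡 (n + 1)) ∞ M]

theorem not_surjective_of_finrank_lt {V W : Type*} [NormedAddCommGroup V] [NormedSpace ℝ V]
    [FiniteDimensional ℝ V] [NormedAddCommGroup W] [NormedSpace ℝ W] (L : V →L[ℝ] W)
    (h : Module.finrank ℝ V < Module.finrank ℝ W) : ¬ Function.Surjective L := fun hL ↦
  h.not_ge (LinearMap.finrank_le_finrank_of_surjective (f := (L : V →ₗ[ℝ] W)) hL)

/-- `N` is a smooth transversal along the open set `U`. -/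
structure IsTransversalOn [IsManifold (𝓡 (n + 1)) ∞ M] (f : S → M) (N : FieldAlong n f)
    (U : Set S) : Prop where
  isOpen : IsOpen U
  smooth : IsSmoothAlongOn f N U
  isInvertible : ∀ q ∈ U, (splitting f N q).IsInvertible

omit [IsManifold (𝓡 n) ∞ S] in
theorem IsTransversalOn.mono (h : IsTransversalOn f N U) (hU' : IsOpen U') (hs : U' ⊆ U) :
    IsTransversalOn f N U' :=
  ⟨hU', h.smooth.mono hs, fun q hq ↦ h.isInvertible q (hs hq)⟩

omit [IsManifold (𝓡 n) ∞ S] [IsManifold (𝓡 (n + 1)) ∞ M] in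
theorem transversal_decomposition (hN : (splitting f N q).IsInvertible)
    (v : TangentSpace (𝓡 (n + 1)) (f q)) :
    dAt n f q ((splitting f N q).inverse v).1 + ((splitting f N q).inverse v).2 • N q = v := by
  rw [← splitting_apply]
  exact hN.self_apply_inverse v

/-- The standard basis of the coordinate space. -/
abbrev stdBasis (n : ℕ) : Module.Basis (Fin n) ℝ (EuclideanSpace ℝ (Fin n)) :=
  (EuclideanSpace.basisFun (Fin n) ℝ).toBasis

section

variable {D : ConnOp (n + 1) M} (hS : IsNondegenerateImmersion f D)
include hS

/-- `h(X, Y) = 0` says that `∇̂_X Y` is tangent, that is, that the normal-bundle valued form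
vanishes on `X, Y`. -/
theorem inducedMetric_nondegenerate (hN : (splitting f N q).IsInvertible)
    (X : TangentSpace (𝓡 n) q) (h : ∀ Y, inducedMetric f D N q X Y = 0) : X = 0 := by
  refine hS.nondegenerate q X fun Y ↦ ?_
  have h1 := h Y
  rw [secondFundamentalForm, Submodule.Quotient.mk_eq_zero]
  have h2 := transversal_decomposition hN
    (covTangent f D (FiberBundle.extend (EuclideanSpace ℝ (Fin n)) Y) q X)
  rw [inducedMetric] at h1
  rw [h1, zero_smul, add_zero] at h2
  exact ⟨_, h2⟩

variable (hD : IsCovariantDerivativeOn (I := 𝓡 (n + 1)) (EuclideanSpace ℝ (Fin (n + 1))) D univ)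
include hD

theorem coordMetric_nondegenerate (hq : q ∈ localDom n f p) (hN : (splitting f N q).IsInvertible)
    (u : EuclideanSpace ℝ (Fin n)) (h : ∀ v, coordMetric (christoffel D (f p)) (localMap n f p)
      (alongRep f p N) (coordPt n p q) u v = 0) : u = 0 := by
  have h1 := inducedMetric_nondegenerate hS hN (ofCoord p q u) fun Y ↦ by
    rw [inducedMetric_eq hS.smooth hD hq hN, toCoord_ofCoord hq.1]; exact h _
  rw [← toCoord_ofCoord hq.1 u, h1, map_zero]

theorem coordGram_det_ne_zero (hq : q ∈ localDom n f p) (hN : (splitting f N q).IsInvertible)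
    {ι : Type*} [Fintype ι] [DecidableEq ι] (b : Module.Basis ι ℝ (EuclideanSpace ℝ (Fin n))) :
    (coordGram (christoffel D (f p)) (localMap n f p) (alongRep f p N) b
      (coordPt n p q)).det ≠ 0 :=
  gram_det_ne_zero (h := (coordMetric (christoffel D (f p)) (localMap n f p) (alongRep f p N)
    (coordPt n p q)).toLinearMap₁₂) b (coordMetric_nondegenerate hS hD hq hN)

omit hD in
/-- Transversals exist locally. -/
theorem exists_isTransversalOn (p : S) : ∃ U, p ∈ U ∧ ∃ N : FieldAlong n f, IsTransversalOn f N U := by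
  have hf := hS.smooth
  have hpp := mem_localDom (n := n) f p
  -- By dimension some vector at `f p` is transverse; it is extended with constant ambient
  -- coordinates.
  obtain ⟨v, hv⟩ : ∃ v : TangentSpace (𝓡 (n + 1)) (f p), v ∉ (dAt n f p).toLinearMap.range := by
    by_contra! h
    exact not_surjective_of_finrank_lt (V := EuclideanSpace ℝ (Fin n))
      (W := EuclideanSpace ℝ (Fin (n + 1))) (dAt n f p) (by simp) fun v ↦ h v
  let N : FieldAlong n f := fun q ↦ constField (f p) (toCoord (f p) (f p) v) (f q)
  have hrep : ∀ q ∈ localDom n f p, alongRep f p N (coordPt n p q) = toCoord (f p) (f p) v := by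
    intro q hq
    rw [alongRep_coordPt hq]
    exact toCoord_ofCoord hq.2 _
  have hsm : ∀ q ∈ localDom n f p, ContDiffAt ℝ ∞ (alongRep f p N) (coordPt n p q) := by
    intro q hq
    exact contDiffAt_const.congr_of_eventuallyEq (eventually_of_localDom hf.continuous hq hrep)
  have hNp : (splitting f N p).IsInvertible := by
    rw [isInvertible_splitting_iff (hS.injective_differential p)]
    have : N p = v := ofCoord_toCoord hpp.2 v
    rwa [this]
  have hcont : ContinuousAt (coordSplitting (localMap n f p) (alongRep f p N))
      (coordPt n p p) := by
    have h1 := ((contDiffAt_localMap hf hpp).fderiv_right (m := ∞) (by simp)).continuousAt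
    have h2 := (hsm p hpp).continuousAt
    refine continuousAt_clm_apply.2 fun w ↦ ?_
    simp only [coordSplitting_apply]
    exact (h1.clm_apply continuousAt_const).add (continuousAt_const.fun_smul h2)
  -- Invertible operators form an open set, so the extension stays transverse near `p`.
  have hopen : ∀ᶠ x in nhds (coordPt n p p),
      (coordSplitting (localMap n f p) (alongRep f p N) x).IsInvertible := by
    refine hcont.eventually ?_
    obtain ⟨e, he⟩ := (isInvertible_splitting_iff_coord hf hpp).1 hNp
    have := ContinuousLinearEquiv.nhds e
    rw [he] at this
    filter_upwards [this] with L hL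
    obtain ⟨e', he'⟩ := hL
    exact ⟨e', he'⟩
  have hev : ∀ᶠ q in nhds p, q ∈ localDom n f p ∧ (splitting f N q).IsInvertible := by
    filter_upwards [(continuousAt_coordPt hpp.1).eventually hopen,
      (isOpen_localDom hf.continuous p).mem_nhds hpp] with q h1 h2
    exact ⟨h2, (isInvertible_splitting_iff_coord hf h2).2 h1⟩
  obtain ⟨U, hU, hUo, hpU⟩ := eventually_nhds_iff.1 hev
  exact ⟨U, hpU, N, hUo, fun q hq ↦ ((contMDiffAt_along_iff hf (hU q hq).1 N).2
    (hsm q (hU q hq).1)).contMDiffWithinAt, fun q hq ↦ (hU q hq).2⟩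

end

variable [T2Space M] {D : CovariantDerivative (𝓡 (n + 1)) (EuclideanSpace ℝ (Fin (n + 1)))
    (TangentSpace (𝓡 (n + 1)) : M → Type _)}
  [CovariantDerivative.ContMDiffCovariantDerivative D ∞]
  (ht : D.torsion = 0) (hS : IsNondegenerateImmersion f D)
include ht hS

/-- Alignment in coordinates. -/
theorem isAlignedAt_iff (hN : IsTransversalOn f N U) (hq : q ∈ localDom n f p) (hqU : q ∈ U) :
    IsAlignedAt (inducedConnection f D N) (inducedMetric f D N) q ↔
      ∀ z, coordDefect (christoffel (D : ConnOp (n + 1) M) (f p)) (localMap n f p)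
        (alongRep f p N) (stdBasis n) (coordPt n p q) z = 0 := by
  have hcov := D.isCovariantDerivativeOnUniv
  have hf := hS.smooth
  have hF := isLocalMap_localMap hf D ht p hN.isOpen
  have hx := coordPt_mem_coordDom hq hqU
  have hNq := hN.isInvertible q hqU
  set Γ := christoffel (D : ConnOp (n + 1) M) (f p)
  set F := localMap n f p
  set N' := alongRep f p N
  set x := coordPt n p q
  have hdet : ∀ b : Module.Basis (Fin n) ℝ (EuclideanSpace ℝ (Fin n)),
      (gram (fun u v ↦ coordMetric Γ F N' x u v) b).det ≠ 0 := fun b ↦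
    coordGram_det_ne_zero hS hcov hq hNq b
  have hsymm : ∀ u v, (coordMetric Γ F N' x).toLinearMap₁₂ u v =
      (coordMetric Γ F N' x).toLinearMap₁₂ v u := fun u v ↦ hF.coordMetric_symm hx u v
  -- the defect does not depend on the basis
  have hind : ∀ (b : Module.Basis (Fin n) ℝ (EuclideanSpace ℝ (Fin n))) z,
      alignmentDefect (fun u v ↦ coordMetric Γ F N' x u v) b (coordCubic Γ F N' x) z =
        coordDefect Γ F N' (stdBasis n) x z := by
    intro b z
    have h1 := contraction_basis_independent (h := (coordMetric Γ F N' x).toLinearMap₁₂)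
      (stdBasis n) (hdet (stdBasis n)) hsymm b (hdet b) (cubicLeft Γ F N' x z)
    have h2 := contraction_basis_independent (h := (coordMetric Γ F N' x).toLinearMap₁₂)
      (stdBasis n) (hdet (stdBasis n)) hsymm b (hdet b) (cubicRight Γ F N' x z)
    exact congrArg₂ (fun s t : ℝ ↦ Fintype.card (Fin n) * s - t) h1 h2
  -- A basis of the tangent space becomes a basis of the coordinate space, which `hind` then
  -- exchanges for the standard one.
  have hb : ∀ (b : Module.Basis (Fin n) ℝ (TangentSpace (𝓡 n) q)) (Z : TangentSpace (𝓡 n) q),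
      ((n : ℝ) * ∑ i, ∑ j, (Matrix.of fun i j ↦ inducedMetric f D N q (b i) (b j))⁻¹ i j *
          covDerivBilin (inducedConnection f D N) (inducedMetric f D N) q (b i) (b j) Z =
        ∑ i, ∑ j, (Matrix.of fun i j ↦ inducedMetric f D N q (b i) (b j))⁻¹ i j *
          covDerivBilin (inducedConnection f D N) (inducedMetric f D N) q Z (b i) (b j)) ↔
      coordDefect Γ F N' (stdBasis n) x (toCoord p q Z) = 0 := by
    intro b Z
    rw [← hind (b.map (coordEquiv hq.1).toLinearEquiv)]
    simp only [inducedMetric_eq hf hcov hq hNq,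
      covDerivBilin_induced_eq hf D ht hN.isOpen hN.smooth hN.isInvertible hq hqU]
    rw [alignmentDefect, Fintype.card_fin, sub_eq_zero]
    rfl
  constructor
  · intro h z
    have := (hb ((stdBasis n).map (coordEquiv hq.1).symm.toLinearEquiv) (ofCoord p q z)).1
      (h _ _)
    rwa [toCoord_ofCoord hq.1] at this
  · intro h b Z
    exact (hb b Z).2 (h _)

variable (hn : 2 ≤ n)

/-- The change of the defect from one transversal to another. -/
theorem coordDefect_transversal_change (hN : IsTransversalOn f N U) (hN' : IsTransversalOn f N' U)
    (hq : q ∈ localDom n f p) (hqU : q ∈ U) (z : EuclideanSpace ℝ (Fin n)) :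
    coordDefect (christoffel (D : ConnOp (n + 1) M) (f p)) (localMap n f p)
        (alongRep f p N') (stdBasis n) (coordPt n p q) z =
      coordDefect (christoffel (D : ConnOp (n + 1) M) (f p)) (localMap n f p)
        (alongRep f p N) (stdBasis n) (coordPt n p q) z +
      ((n + 2) * (n - 1) * ((splitting f N q).inverse (N' q)).2⁻¹) *
        coordMetric (christoffel (D : ConnOp (n + 1) M) (f p)) (localMap n f p)
        (alongRep f p N) (coordPt n p q) (toCoord p q ((splitting f N q).inverse (N' q)).1) z := by
  have hcov := D.isCovariantDerivativeOnUniv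
  have hf := hS.smooth
  have := coordDefect_change (isLocalMap_localMap hf D ht p hN.isOpen)
    (isLocalTransversal_alongRep hf hN.isOpen hN.smooth hN.isInvertible p)
    (coordPt_mem_coordDom hq hqU)
    (isLocalTransversal_alongRep hf hN'.isOpen hN'.smooth hN'.isInvertible p) (stdBasis n)
    (coordGram_det_ne_zero hS hcov hq (hN.isInvertible q hqU) (stdBasis n)) z
  rw [this, Fintype.card_fin, inverse_splitting_apply hf hq, toCoord_ofCoord hq.1,
    alongRep_coordPt hq]

omit ht hS [T2Space M] [IsManifold (𝓡 n) ∞ S] [IsManifold (𝓡 (n + 1)) ∞ M] in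
theorem inverse_splitting_snd_ne_zero (hinj : Function.Injective (dAt n f q))
    (hN : (splitting f N q).IsInvertible) (hN' : (splitting f N' q).IsInvertible) :
    ((splitting f N q).inverse (N' q)).2 ≠ 0 := by
  intro h0
  have := transversal_decomposition hN (N' q)
  rw [h0, zero_smul, add_zero] at this
  exact (isInvertible_splitting_iff hinj).1 hN' ⟨_, this⟩

include hn

/-- Aligned transversals are unique up to scale. -/
theorem eq_smul_of_isAlignedAt (hN : IsTransversalOn f N U) (hN' : IsTransversalOn f N' U)
    (hqU : q ∈ U) (h : IsAlignedAt (inducedConnection f D N) (inducedMetric f D N) q)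
    (h' : IsAlignedAt (inducedConnection f D N') (inducedMetric f D N') q) :
    ∃ a : ℝ, a ≠ 0 ∧ N' q = a • N q := by
  have hcov := D.isCovariantDerivativeOnUniv
  have hq := mem_localDom (n := n) f q
  have ha := inverse_splitting_snd_ne_zero (hS.injective_differential q) (hN.isInvertible q hqU)
    (hN'.isInvertible q hqU)
  refine ⟨_, ha, ?_⟩
  -- Both defects vanish, so `(n + 2)(n - 1) a⁻¹ h(ζ, ·) = 0` for the tangential component `ζ` of
  -- `N'`. The factor is nonzero because `n ≥ 2`, and `h` is nondegenerate.
  have hz : toCoord q q ((splitting f N q).inverse (N' q)).1 = 0 := by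
    refine coordMetric_nondegenerate hS hcov hq (hN.isInvertible q hqU) _ fun z ↦ ?_
    have h1 := coordDefect_transversal_change ht hS hN hN' hq hqU z
    rw [(isAlignedAt_iff ht hS hN' hq hqU).1 h', (isAlignedAt_iff ht hS hN hq hqU).1 h,
      zero_add] at h1
    have h2 : ((n : ℝ) + 2) * (n - 1) ≠ 0 := by
      have : (2 : ℝ) ≤ n := by exact_mod_cast hn
      exact mul_ne_zero (by linarith) (by linarith)
    exact (mul_eq_zero.1 h1.symm).resolve_left (mul_ne_zero h2 (inv_ne_zero ha))
  have hz' : ((splitting f N q).inverse (N' q)).1 = 0 := by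
    rw [← ofCoord_toCoord hq.1 ((splitting f N q).inverse (N' q)).1, hz, map_zero]
  have := transversal_decomposition (hN.isInvertible q hqU) (N' q)
  rw [hz', map_zero, zero_add] at this
  exact this.symm

omit hn in
/-- Multiples of aligned transversals are aligned. -/
theorem isAlignedAt_of_smul (hN : IsTransversalOn f N U) (hN' : IsTransversalOn f N' U)
    (hqU : q ∈ U) (h : IsAlignedAt (inducedConnection f D N) (inducedMetric f D N) q) {a : ℝ}
    (ha : N' q = a • N q) :
    IsAlignedAt (inducedConnection f D N') (inducedMetric f D N') q := by
  have hq := mem_localDom (n := n) f q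
  rw [isAlignedAt_iff ht hS hN' hq hqU]
  intro z
  -- The tangential component is zero, so the defect does not change.
  have hinv : (splitting f N q).inverse (N' q) = (0, a) := by
    rw [(hN.isInvertible q hqU).inverse_apply_eq, splitting_apply, ha, map_zero, zero_add]
  rw [coordDefect_transversal_change ht hS hN hN' hq hqU z,
    (isAlignedAt_iff ht hS hN hq hqU).1 h, hinv]
  simp

/-- Aligned transversals exist locally. -/
theorem exists_aligned_transversal (p : S) : ∃ U, p ∈ U ∧ ∃ N : FieldAlong n f, IsTransversalOn f N U ∧
    ∀ q ∈ U, IsAlignedAt (inducedConnection f D N) (inducedMetric f D N) q := by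
  have hcov := D.isCovariantDerivativeOnUniv
  have hf := hS.smooth
  obtain ⟨U₀, hpU₀, N, hN₀⟩ := exists_isTransversalOn hS p
  set U := localDom n f p ∩ U₀ with hU
  have hpU : p ∈ U := ⟨mem_localDom f p, hpU₀⟩
  have hN : IsTransversalOn f N U :=
    hN₀.mono ((isOpen_localDom hf.continuous p).inter hN₀.isOpen) inter_subset_right
  have hF := isLocalMap_localMap hf D ht p hN.isOpen
  have hNt := isLocalTransversal_alongRep hf hN.isOpen hN.smooth hN.isInvertible p
  let Γ := christoffel (D : ConnOp (n + 1) M) (f p)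
  let F := localMap n f p
  let N₁ := alongRep f p N
  -- The solution of `h(ζ, ·) = -defect / ((n + 2)(n - 1))`, written with the inverse Gram matrix so
  -- that its smoothness is visible. With `a = 1`, the transversal `N + df(ζ)` then has zero defect.
  let ζ : EuclideanSpace ℝ (Fin n) → EuclideanSpace ℝ (Fin n) := fun x ↦
    ∑ i, (∑ j, (coordGram Γ F N₁ (stdBasis n) x)⁻¹ i j *
      (-(((n : ℝ) + 2) * (n - 1))⁻¹ * coordDefect Γ F N₁ (stdBasis n) x (stdBasis n j))) •
        stdBasis n i
  have hdet : ∀ q ∈ U, (coordGram Γ F N₁ (stdBasis n) (coordPt n p q)).det ≠ 0 := fun q hq ↦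
    coordGram_det_ne_zero hS hcov hq.1 (hN.isInvertible q hq) (stdBasis n)
  have hζ : ∀ q ∈ U, ContDiffAt ℝ ∞ ζ (coordPt n p q) := by
    intro q hq
    have hx := coordPt_mem_coordDom hq.1 hq
    refine ContDiffAt.sum fun i _ ↦ (ContDiffAt.sum fun j _ ↦ ?_).fun_smul contDiffAt_const
    exact (contDiffAt_inv_apply (contDiffAt_coordGram hF hNt hx (stdBasis n)) (hdet q hq) i j).mul
      (contDiffAt_const.mul (contDiffAt_coordDefect hF hNt hx (hdet q hq) _))
  have hζ' : ∀ q ∈ U, ∀ z, coordMetric Γ F N₁ (coordPt n p q) (ζ (coordPt n p q)) z =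
      -(((n : ℝ) + 2) * (n - 1))⁻¹ * coordDefect Γ F N₁ (stdBasis n) (coordPt n p q) z := by
    intro q hq z
    have hx := coordPt_mem_coordDom hq.1 hq
    have := exists_forall_apply_eq (h := (coordMetric Γ F N₁ (coordPt n p q)).toLinearMap₁₂)
      (stdBasis n) (hdet q hq) (fun u v ↦ hF.coordMetric_symm hx u v)
      (-(((n : ℝ) + 2) * (n - 1))⁻¹ • defectForm Γ F N₁ (stdBasis n) (coordPt n p q))
    exact LinearMap.congr_fun this z
  let N' : FieldAlong n f := fun q ↦ N q + dAt n f q (ofCoord p q (ζ (coordPt n p q)))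
  have hinv : ∀ q ∈ U, (splitting f N q).inverse (N' q) = (ofCoord p q (ζ (coordPt n p q)), 1) := by
    intro q hq
    rw [(hN.isInvertible q hq).inverse_apply_eq, splitting_apply, one_smul]
    exact add_comm _ _
  have hN' : IsTransversalOn f N' U := by
    refine ⟨hN.isOpen, fun q hq ↦ ContMDiffAt.contMDiffWithinAt ?_, fun q hq ↦ ?_⟩
    · rw [contMDiffAt_along_iff hf hq.1]
      have hx := coordPt_mem_coordDom hq.1 hq
      have h1 : ContDiffAt ℝ ∞ (fun x ↦ N₁ x + fderiv ℝ F x (ζ x)) (coordPt n p q) :=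
        (hNt.smooth.contDiffAt (hF.isOpen.mem_nhds hx)).add
          ((hF.contDiffAt_fderiv hx).clm_apply (hζ q hq))
      refine h1.congr_of_eventuallyEq ?_
      refine eventually_of_localDom hf.continuous hq.1 fun r hr ↦ ?_
      dsimp only [N₁, F, N']
      rw [alongRep_coordPt hr, alongRep_coordPt hr, map_add, toCoord_dAt hf hr,
        toCoord_ofCoord hr.1]
    · rw [isInvertible_splitting_iff (hS.injective_differential q)]
      intro hr
      refine (isInvertible_splitting_iff (hS.injective_differential q)).1 (hN.isInvertible q hq) ?_
      have : N q = N' q - dAt n f q (ofCoord p q (ζ (coordPt n p q))) := (add_sub_cancel_right _ _).symm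
      rw [this]
      exact Submodule.sub_mem _ hr ⟨_, rfl⟩
  refine ⟨U, hpU, N', hN', fun q hq ↦ ?_⟩
  rw [isAlignedAt_iff ht hS hN' hq.1 hq]
  intro z
  have h2 : ((n : ℝ) + 2) * (n - 1) ≠ 0 := by
    have : (2 : ℝ) ≤ n := by exact_mod_cast hn
    exact mul_ne_zero (by linarith) (by linarith)
  rw [coordDefect_transversal_change ht hS hN hN' hq.1 hq z, hinv q hq, toCoord_ofCoord hq.1.1,
    hζ' q hq z, inv_one, mul_one, ← mul_assoc, mul_neg, mul_inv_cancel₀ h2, neg_one_mul]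
  exact add_neg_cancel _

end AffineNormal

/-! ### Existence and uniqueness of the affine normal distribution -/

section AffineNormalDistribution

set_option maxSynthPendingDepth 3

variable {n : ℕ} {S : Type*} [TopologicalSpace S] [ChartedSpace (EuclideanSpace ℝ (Fin n)) S]
  {M : Type*} [TopologicalSpace M] [ChartedSpace (EuclideanSpace ℝ (Fin (n + 1))) M]
  {f : S → M} {N N' : FieldAlong n f} {p q : S} {U U' : Set S}
  {W : Π p : S, Submodule ℝ (TangentSpace (𝓡 (n + 1)) (f p))}

theorem isCompl_range_span (hN : (splitting f N q).IsInvertible) :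
    IsCompl (dAt n f q).toLinearMap.range (Submodule.span ℝ {N q}) := by
  constructor
  · rw [Submodule.disjoint_def]
    rintro v ⟨u, rfl⟩ hv
    obtain ⟨c, hc⟩ := Submodule.mem_span_singleton.1 hv
    have h1 : splitting f N q (u, -c) = splitting f N q (0, 0) := by
      rw [splitting_apply, splitting_apply, neg_smul, hc, map_zero, zero_smul, add_zero]
      exact add_neg_cancel _
    have h2 := congrArg Prod.fst (hN.injective h1)
    change dAt n f q u = 0
    rw [show u = 0 from h2, map_zero]
  · rw [codisjoint_iff, eq_top_iff]
    intro v _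
    rw [← transversal_decomposition hN v]
    exact Submodule.add_mem_sup ⟨_, rfl⟩ (Submodule.smul_mem _ _ (Submodule.mem_span_singleton_self _))

theorem notMem_range_of_isCompl
    (h : IsCompl (dAt n f q).toLinearMap.range (Submodule.span ℝ {N q})) :
    N q ∉ (dAt n f q).toLinearMap.range := by
  intro hr
  have h1 : Submodule.span ℝ {N q} ≤ (dAt n f q).toLinearMap.range :=
    (Submodule.span_singleton_le_iff_mem _ _).2 hr
  have h2 : (dAt n f q).toLinearMap.range = ⊤ := by
    rw [← h.sup_eq_top, sup_eq_left.2 h1]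
  exact not_surjective_of_finrank_lt (V := EuclideanSpace ℝ (Fin n))
      (W := EuclideanSpace ℝ (Fin (n + 1))) (dAt n f q) (by simp) (LinearMap.range_eq_top.1 h2)

variable [IsManifold (𝓡 n) ∞ S] [IsManifold (𝓡 (n + 1)) ∞ M]

/-- A local field spanning a complement of the tangent spaces cannot be tangent or zero, so the
alignment condition applies to it. -/
theorem IsAffineNormalDistribution.exists_transversal {D : ConnOp (n + 1) M}
    (hS : IsNondegenerateImmersion f D) (hW : IsAffineNormalDistribution f D W) (p : S) :
    ∃ U, p ∈ U ∧ ∃ N : FieldAlong n f, IsTransversalOn f N U ∧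
      (∀ q ∈ U, W q = Submodule.span ℝ {N q}) ∧
      ∀ q ∈ U, IsAlignedAt (inducedConnection f D N) (inducedMetric f D N) q := by
  obtain ⟨U, hU, hpU, N, hN, hNW⟩ := hW.1.smooth p
  have hnot : ∀ q ∈ U, N q ∉ (dAt n f q).toLinearMap.range := fun q hq ↦
    notMem_range_of_isCompl (by rw [← hNW q hq]; exact hW.1.isCompl q)
  refine ⟨U, hpU, N, ⟨hU, hN, fun q hq ↦ (isInvertible_splitting_iff
    (hS.injective_differential q)).2 (hnot q hq)⟩, hNW, hW.2 U N hU hN fun q hq ↦ ⟨?_, ?_⟩⟩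
  · rw [hNW q hq]; exact Submodule.mem_span_singleton_self _
  · intro h0
    exact hnot q hq (h0 ▸ Submodule.zero_mem _)

variable [T2Space M] {D : CovariantDerivative (𝓡 (n + 1)) (EuclideanSpace ℝ (Fin (n + 1)))
    (TangentSpace (𝓡 (n + 1)) : M → Type _)}
  [CovariantDerivative.ContMDiffCovariantDerivative D ∞]
  (ht : D.torsion = 0) (hS : IsNondegenerateImmersion f D) (hn : 2 ≤ n)
include ht hS hn

/-- An aligned transversal spans the affine normal distribution. -/
theorem IsAffineNormalDistribution.eq_span (hW : IsAffineNormalDistribution f D W)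
    (hN : IsTransversalOn f N U) (hq : q ∈ U)
    (h : IsAlignedAt (inducedConnection f D N) (inducedMetric f D N) q) :
    W q = Submodule.span ℝ {N q} := by
  obtain ⟨U', hqU', N', hN', hNW, hal⟩ := hW.exists_transversal hS q
  have ho := hN.isOpen.inter hN'.isOpen
  obtain ⟨a, ha, hNN⟩ := eq_smul_of_isAlignedAt ht hS hn (hN.mono ho inter_subset_left)
    (hN'.mono ho inter_subset_right) ⟨hq, hqU'⟩ h (hal q hqU')
  rw [hNW q hqU', hNN]
  exact Submodule.span_singleton_smul_eq (isUnit_iff_ne_zero.2 ha) _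

/-- Local aligned transversals are proportional where they overlap, so their spans form one line
field. The same proportionality identifies any competitor. -/
theorem existsUnique_isAffineNormalDistribution : ∃! W, IsAffineNormalDistribution f D W := by
  choose U hpU N hN hal using exists_aligned_transversal ht hS hn
  have hspan : ∀ p, ∀ q ∈ U p, Submodule.span ℝ {N q q} = Submodule.span ℝ {N p q} := by
    intro p q hq
    have ho := (hN p).isOpen.inter (hN q).isOpen
    obtain ⟨a, ha, h⟩ := eq_smul_of_isAlignedAt ht hS hn ((hN p).mono ho inter_subset_left)
      ((hN q).mono ho inter_subset_right) ⟨hq, hpU q⟩ (hal p q hq) (hal q q (hpU q))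
    rw [h]
    exact Submodule.span_singleton_smul_eq (isUnit_iff_ne_zero.2 ha) _
  refine ⟨fun p ↦ Submodule.span ℝ {N p p}, ⟨⟨fun p ↦ ?_, fun p ↦ ?_⟩, ?_⟩, fun W hW ↦ ?_⟩
  · exact isCompl_range_span ((hN p).isInvertible p (hpU p))
  · exact ⟨U p, (hN p).isOpen, hpU p, N p, (hN p).smooth, hspan p⟩
  -- Near `p`, an arbitrary section of the line field is a nonzero multiple of the aligned
  -- transversal chosen at `p`.
  · intro V N' hV hN' hNW p hp
    have ho := (hN p).isOpen.inter hV
    have hmul : ∀ q ∈ U p ∩ V, ∃ a : ℝ, N' q = a • N p q := by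
      intro q hq
      obtain ⟨a, ha⟩ := Submodule.mem_span_singleton.1
        ((hspan p q hq.1).le (hNW q hq.2).1)
      exact ⟨a, ha.symm⟩
    have hN'' : IsTransversalOn f N' (U p ∩ V) := by
      refine ⟨ho, hN'.mono inter_subset_right, fun q hq ↦ ?_⟩
      rw [isInvertible_splitting_iff (hS.injective_differential q)]
      intro hr
      obtain ⟨a, ha⟩ := hmul q hq
      have ha0 : a ≠ 0 := by
        rintro rfl
        exact (hNW q hq.2).2 (by rw [ha, zero_smul])
      refine (isInvertible_splitting_iff (hS.injective_differential q)).1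
        ((hN p).isInvertible q hq.1) ?_
      have : N p q = a⁻¹ • N' q := by rw [ha, smul_smul, inv_mul_cancel₀ ha0, one_smul]
      rw [this]
      exact Submodule.smul_mem _ _ hr
    obtain ⟨a, ha⟩ := hmul p ⟨hpU p, hp⟩
    exact isAlignedAt_of_smul ht hS ((hN p).mono ho inter_subset_left) hN'' ⟨hpU p, hp⟩
      (hal p p (hpU p)) ha
  · funext p
    exact hW.eq_span ht hS hn (hN p) (hpU p) (hal p p (hpU p))

end AffineNormalDistribution

/-! ### Volume forms in coordinates -/

section VolumeForms

set_option maxSynthPendingDepth 3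

variable {m : ℕ} {M : Type*} [TopologicalSpace M] [ChartedSpace (EuclideanSpace ℝ (Fin m)) M]
  [IsManifold (𝓡 m) ∞ M] {Ψ : Π x : M, TangentSpace (𝓡 m) x [⋀^Fin m]→ₗ[ℝ] ℝ}

/-- The coefficient of a volume form in the chart at `p`. -/
def volumeCoord (Ψ : Π x : M, TangentSpace (𝓡 m) x [⋀^Fin m]→ₗ[ℝ] ℝ) (p : M) :
    EuclideanSpace ℝ (Fin m) → ℝ :=
  coordFun m p fun z ↦ Ψ z fun i ↦ constField p (stdBasis m i) z

/-- Alternating forms of top degree make up a line, spanned by the determinant in the coordinate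
basis. -/
theorem volumeForm_apply {p z : M} (hz : z ∈ chartDom m p) (v : Fin m → TangentSpace (𝓡 m) z) :
    Ψ z v = volumeCoord Ψ p (coordPt m p z) * (stdBasis m).det fun i ↦ toCoord p z (v i) := by
  let b := (stdBasis m).map (coordEquiv hz).symm.toLinearEquiv
  have h := congrArg (fun T ↦ T v) ((Ψ z).eq_smul_basis_det b)
  rw [volumeCoord, coordFun_coordPt hz]
  refine h.trans ?_
  rw [AlternatingMap.smul_apply, smul_eq_mul, Module.Basis.det_map]
  rfl

theorem IsVolumeForm.volumeCoord_ne_zero (hΨ : IsVolumeForm Ψ) {p z : M} (hz : z ∈ chartDom m p) :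
    volumeCoord Ψ p (coordPt m p z) ≠ 0 := by
  intro h
  apply hΨ.ne_zero z
  ext v
  rw [volumeForm_apply hz, h, zero_mul]
  rfl

theorem IsVolumeForm.contDiffAt_volumeCoord (hΨ : IsVolumeForm Ψ) {p z : M}
    (hz : z ∈ chartDom m p) : ContDiffAt ℝ ∞ (volumeCoord Ψ p) (coordPt m p z) := by
  refine (contMDiffAt_iff_coordFun hz).1 ((hΨ.smooth (chartDom m p)
    (chartAt (EuclideanSpace ℝ (Fin m)) p).open_source _ fun i y hy ↦ ?_).contMDiffAt
      (chartDom_mem_nhds hz))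
  exact (contMDiffAt_constField hy _).contMDiffWithinAt

/-- The coordinate expression of `∇Ψ = 0`. -/
theorem PreservesForm.fderiv_volumeCoord {D : ConnOp m M}
    (hD : IsCovariantDerivativeOn (I := 𝓡 m) (EuclideanSpace ℝ (Fin m)) D univ)
    (hΨ : IsVolumeForm Ψ) (h : PreservesForm D Ψ) {p z : M} (hz : z ∈ chartDom m p)
    (w : Fin m → EuclideanSpace ℝ (Fin m)) (u : EuclideanSpace ℝ (Fin m)) :
    fderiv ℝ (volumeCoord Ψ p) (coordPt m p z) u * (stdBasis m).det w =
      volumeCoord Ψ p (coordPt m p z) * ∑ i, (stdBasis m).det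
        (Function.update w i (christoffel D p (coordPt m p z) (w i) u)) := by
  -- On fields with constant coordinates only the coefficient of the form is differentiated, and `∇`
  -- acts through the Christoffel symbols alone.
  have hpar := h z (fun i ↦ constField p (w i)) (fun i ↦ isDiffFieldAt_constField hz (w i))
    (ofCoord p z u)
  have hfun : coordFun m p (fun y ↦ Ψ y fun i ↦ constField p (w i) y) =ᶠ[nhds (coordPt m p z)]
      fun x ↦ volumeCoord Ψ p x * (stdBasis m).det w := by
    filter_upwards [(isOpen_extChartAt_target p).mem_nhds (coordPt_mem_target hz)] with x hx
    have hy := symm_mem_chartDom hx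
    have := volumeForm_apply (Ψ := Ψ) hy fun i ↦ constField p (w i) ((extChartAt (𝓡 m) p).symm x)
    rw [coordPt_symm hx] at this
    refine this.trans ?_
    congr 2
    ext1 i
    exact toCoord_ofCoord hy _
  have hder := ((((hΨ.contDiffAt_volumeCoord hz).differentiableAt (by simp)).hasFDerivAt).mul_const
    ((stdBasis m).det w)).congr_of_eventuallyEq hfun
  rw [mvfderiv_eq_fderiv_coordFun hz ((mdifferentiableAt_iff_coordFun hz).2 hder.differentiableAt),
    hder.fderiv, toCoord_ofCoord hz] at hpar
  have hterm : ∀ i, Ψ z (Function.update (fun j ↦ constField p (w j) z) i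
      (D (constField p (w i)) z (ofCoord p z u))) = volumeCoord Ψ p (coordPt m p z) *
        (stdBasis m).det (Function.update w i (christoffel D p (coordPt m p z) (w i) u)) := by
    intro i
    rw [volumeForm_apply hz, christoffel_eq hD hz]
    congr 2
    ext1 j
    by_cases hj : j = i
    · subst hj; simp
    · simp only [Function.update_of_ne hj]
      exact toCoord_ofCoord hz _
  simp only [hterm] at hpar
  rw [Finset.mul_sum, ← hpar]
  simp [mul_comm]

end VolumeForms

/-! ### Dependence of the densities on the frame and on the scale of the transversal -/

section DensityScaling

set_option maxSynthPendingDepth 3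

/-- The determinant of the Gram matrix is a squared density. -/
theorem gram_det_eq {ι V : Type*} [Fintype ι] [DecidableEq ι] [AddCommGroup V] [Module ℝ V]
    (h : V →ₗ[ℝ] V →ₗ[ℝ] ℝ) (b : Module.Basis ι ℝ V) (y : ι → V) :
    (gram (fun u v ↦ h u v) y).det = (b.det y) ^ 2 * (gram (fun u v ↦ h u v) b).det := by
  have : gram (fun u v ↦ h u v) y =
      (b.toMatrix y).transpose * gram (fun u v ↦ h u v) b * b.toMatrix y := by
    ext i j
    rw [Matrix.mul_apply]
    simp only [gram, Matrix.of_apply, Matrix.mul_apply, Matrix.transpose_apply,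
      Module.Basis.toMatrix_apply]
    conv_lhs => rw [← b.sum_repr (y i), ← b.sum_repr (y j)]
    simp only [map_sum, map_smul, LinearMap.sum_apply, LinearMap.smul_apply, smul_eq_mul,
      Finset.sum_mul, Finset.mul_sum]
    exact Finset.sum_congr rfl fun k _ ↦ Finset.sum_congr rfl fun l _ ↦ by ring
  rw [this, Matrix.det_mul, Matrix.det_mul, Matrix.det_transpose, Module.Basis.det_apply]
  ring

variable {n : ℕ} {E E' : Type*} [NormedAddCommGroup E] [NormedSpace ℝ E]
  [NormedAddCommGroup E'] [NormedSpace ℝ E']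

/-- The coordinate expression of `Ψ(N, dF(y₁), …, dF(y_n))`. -/
def coordVol (μ : E' → ℝ) (B : Module.Basis (Fin (n + 1)) ℝ E') (F N : E → E') (y : Fin n → E)
    (x : E) : ℝ :=
  μ (F x) * B.det (Matrix.vecCons (N x) fun i ↦ fderiv ℝ F x (y i))

/-- For fixed `N` and `x` the expression is an alternating `n`-form in `y`, hence a multiple of the
determinant. -/
theorem coordVol_eq (μ : E' → ℝ) (B : Module.Basis (Fin (n + 1)) ℝ E') (F N : E → E')
    (b : Module.Basis (Fin n) ℝ E) (y : Fin n → E) (x : E) :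
    coordVol μ B F N y x = b.det y * coordVol μ B F N b x := by
  let A : E [⋀^Fin n]→ₗ[ℝ] ℝ := (B.det.curryLeft (N x)).compLinearMap (fderiv ℝ F x).toLinearMap
  have h := congrArg (fun T ↦ T y) (A.eq_smul_basis_det b)
  simp only [AlternatingMap.smul_apply, smul_eq_mul] at h
  have hA : ∀ y : Fin n → E, coordVol μ B F N y x = μ (F x) * A y := fun y ↦ rfl
  rw [hA, hA, h]
  ring

/-- Transversality makes `N, dF(b₁), …, dF(b_n)` a basis of the ambient space. -/
theorem coordVol_ne_zero {μ : E' → ℝ} (B : Module.Basis (Fin (n + 1)) ℝ E') {F N : E → E'}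
    (b : Module.Basis (Fin n) ℝ E) {x : E} (hμ : μ (F x) ≠ 0)
    (hN : (coordSplitting F N x).IsInvertible) : coordVol μ B F N b x ≠ 0 := by
  refine mul_ne_zero hμ ?_
  rw [← isUnit_iff_ne_zero]
  refine (Module.Basis.is_basis_iff_det B).1 ?_
  have hli : LinearIndependent ℝ
      (Matrix.vecCons (N x) fun i ↦ fderiv ℝ F x (b i)) := by
    rw [Fintype.linearIndependent_iff]
    intro g hg
    rw [Fin.sum_univ_succ] at hg
    simp only [Matrix.cons_val_zero, Matrix.cons_val_succ] at hg
    have h1 : coordSplitting F N x (∑ i : Fin n, g i.succ • b i, g 0) = coordSplitting F N x 0 := by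
      rw [coordSplitting_apply, map_zero, ← hg, map_sum, add_comm]
      simp
    have h2 := hN.injective h1
    have h3 := congrArg Prod.fst h2
    have h4 := congrArg Prod.snd h2
    intro i
    refine Fin.cases h4 (fun j ↦ ?_) i
    exact Fintype.linearIndependent_iff.1 b.linearIndependent _ h3 j
  have hfin : FiniteDimensional ℝ E' := Module.Finite.of_basis B
  refine ⟨hli, hli.span_eq_top_of_card_eq_finrank' ?_⟩
  rw [Module.finrank_eq_card_basis B]

theorem coordVol_smul {μ : E' → ℝ} (B : Module.Basis (Fin (n + 1)) ℝ E') {F N N' : E → E'}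
    (y : Fin n → E) {x : E} {a : ℝ} (h : N' x = a • N x) :
    coordVol μ B F N' y x = a * coordVol μ B F N y x := by
  have h1 : B.det (Matrix.vecCons (a • N x) fun i ↦ fderiv ℝ F x (y i)) =
      a * B.det (Matrix.vecCons (N x) fun i ↦ fderiv ℝ F x (y i)) := by
    have := congrArg (fun T : E' [⋀^Fin n]→ₗ[ℝ] ℝ ↦ T fun i ↦ fderiv ℝ F x (y i))
      (B.det.curryLeft.map_smul a (N x))
    exact this
  rw [coordVol, h, h1, coordVol]
  ring

theorem coordGram_det_smul {Γ : E' → E' →L[ℝ] E' →L[ℝ] E'} {F N N' : E → E'} {x : E} {a : ℝ}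
    (hN : (coordSplitting F N x).IsInvertible) (ha : a ≠ 0) (h : N' x = a • N x) (y : Fin n → E) :
    (coordGram Γ F N' y x).det = (a⁻¹) ^ n * (coordGram Γ F N y x).det := by
  have h1 : coordGram Γ F N' y x = a⁻¹ • coordGram Γ F N y x := by
    ext i j
    exact coordMetric_change hN ha (ζ := 0) (by rw [h, map_zero, add_zero]) _ _
  rw [h1, Matrix.det_smul, Fintype.card_fin]

theorem contDiffAt_coordVol [FiniteDimensional ℝ E] [FiniteDimensional ℝ E']
    {Γ : E' → E' →L[ℝ] E' →L[ℝ] E'} {F N : E → E'} {x : E}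
    {Ω : Set E} (hF : IsLocalMap Γ F Ω) (hN : IsLocalTransversal F N Ω) (hx : x ∈ Ω) {μ : E' → ℝ}
    (hμ : ContDiffAt ℝ ∞ μ (F x)) (B : Module.Basis (Fin (n + 1)) ℝ E') (y : Fin n → E) :
    ContDiffAt ℝ ∞ (coordVol μ B F N y) x := by
  refine (hμ.comp x (hF.contDiffAt hx)).mul ?_
  have h1 : ContDiffAt ℝ ∞ (fun z ↦ Matrix.vecCons (N z) fun i ↦ fderiv ℝ F z (y i)) x := by
    rw [contDiffAt_pi]
    intro i
    refine Fin.cases ?_ (fun j ↦ ?_) i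
    · exact hN.smooth.contDiffAt (hF.isOpen.mem_nhds hx)
    · exact (hF.contDiffAt_fderiv hx).clm_apply contDiffAt_const
  exact (ContinuousMultilinearMap.contDiff (continuousDet B)).contDiffAt.comp x h1

end DensityScaling

/-! ### The normalized section of the affine normal distribution -/

section Normalization

set_option maxSynthPendingDepth 3

variable {n : ℕ} {S : Type*} [TopologicalSpace S] [ChartedSpace (EuclideanSpace ℝ (Fin n)) S]
  {M : Type*} [TopologicalSpace M] [ChartedSpace (EuclideanSpace ℝ (Fin (n + 1))) M]
  {f : S → M} {N N' : FieldAlong n f} {p q : S} {U U' : Set S}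

section Side

variable [IsManifold (𝓡 (n + 1)) ∞ M]

/-- Lying on the chosen side becomes the positivity of one linear functional, which is how the
co-orientation is used below. -/
theorem Coorientation.exists_transversal (o : Coorientation n f)
    (hinj : ∀ p, Function.Injective (dAt n f p)) (p : S) :
    ∃ U, p ∈ U ∧ ∃ N : FieldAlong n f, IsTransversalOn f N U ∧ ∀ q ∈ U, ∀ v,
      v ∈ o.side q ↔ 0 < ((splitting f N q).inverse v).2 := by
  obtain ⟨U, hU, hp, N, hN, h⟩ := o.locally_smooth p
  have hinv : ∀ q ∈ U, (splitting f N q).IsInvertible := fun q hq ↦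
    (isInvertible_splitting_iff (hinj q)).2 (h q hq).1
  refine ⟨U, hp, N, ⟨hU, hN, hinv⟩, fun q hq v ↦ ?_⟩
  rw [(h q hq).2]
  constructor
  · rintro ⟨c, hc, X, rfl⟩
    have : (splitting f N q).inverse (c • N q + dAt n f q X) = (X, c) := by
      rw [(hinv q hq).inverse_apply_eq, splitting_apply]
      exact add_comm _ _
    rwa [this]
  · intro hv
    refine ⟨_, hv, ((splitting f N q).inverse v).1, ?_⟩
    have := transversal_decomposition (hinv q hq) v
    exact this.symm.trans (add_comm _ _)

theorem Coorientation.isInvertible_splitting (o : Coorientation n f)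
    (hinj : ∀ p, Function.Injective (dAt n f p)) (hq : N q ∈ o.side q) :
    (splitting f N q).IsInvertible := by
  obtain ⟨U, hqU, N₁, hN₁, h⟩ := o.exists_transversal hinj q
  rw [isInvertible_splitting_iff (hinj q)]
  rintro ⟨u, hu⟩
  have h1 : (splitting f N₁ q).inverse (N q) = (u, 0) := by
    rw [(hN₁.isInvertible q hqU).inverse_apply_eq, splitting_apply, ← hu, zero_smul, add_zero]
    rfl
  have h2 := (h q hqU _).1 hq
  rw [h1] at h2
  exact lt_irrefl _ h2

theorem Coorientation.smul_mem_side_iff (o : Coorientation n f)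
    (hinj : ∀ p, Function.Injective (dAt n f p)) {v : TangentSpace (𝓡 (n + 1)) (f q)}
    (hv : v ∈ o.side q) (a : ℝ) : a • v ∈ o.side q ↔ 0 < a := by
  obtain ⟨U, hqU, N₁, hN₁, h⟩ := o.exists_transversal hinj q
  rw [h q hqU] at hv ⊢
  rw [map_smul, Prod.smul_snd, smul_eq_mul]
  exact mul_pos_iff_of_pos_right hv

end Side

variable [IsManifold (𝓡 n) ∞ S] [IsManifold (𝓡 (n + 1)) ∞ M]

theorem IsTransversalOn.smul (hf : ContMDiff (𝓡 n) (𝓡 (n + 1)) ∞ f)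
    (hinj : ∀ p, Function.Injective (dAt n f p)) (hN : IsTransversalOn f N U) {a : S → ℝ}
    (ha : ∀ q ∈ U, ContMDiffAt (𝓡 n) 𝓘(ℝ, ℝ) ∞ a q) (ha0 : ∀ q ∈ U, a q ≠ 0) :
    IsTransversalOn f (fun q ↦ a q • N q) U := by
  refine ⟨hN.isOpen, fun q hq ↦ ContMDiffAt.contMDiffWithinAt ?_, fun q hq ↦ ?_⟩
  · have hqq := mem_localDom (n := n) f q
    rw [contMDiffAt_along_iff hf hqq]
    have h1 := (contMDiffAt_along_iff hf hqq N).1 (hN.smooth.contMDiffAt (hN.isOpen.mem_nhds hq))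
    refine (((contMDiffAt_iff_coordFun hqq.1).1 (ha q hq)).smul h1).congr_of_eventuallyEq ?_
    refine Filter.Eventually.of_forall fun x ↦ ?_
    exact map_smul (toCoord _ _) _ _
  · rw [isInvertible_splitting_iff (hinj q)]
    intro hr
    refine (isInvertible_splitting_iff (hinj q)).1 (hN.isInvertible q hq) ?_
    have : N q = (a q)⁻¹ • (a q • N q) := by rw [smul_smul, inv_mul_cancel₀ (ha0 q hq), one_smul]
    rw [this]
    exact Submodule.smul_mem _ _ hr

/-- `Ψ(N, df(e₁), …, df(e_n))` for the coordinate frame at `p`. -/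
abbrev localVol (Ψ : Π x : M, TangentSpace (𝓡 (n + 1)) x [⋀^Fin (n + 1)]→ₗ[ℝ] ℝ) (f : S → M)
    (N : FieldAlong n f) (p : S) (y : Fin n → EuclideanSpace ℝ (Fin n)) :
    EuclideanSpace ℝ (Fin n) → ℝ :=
  coordVol (volumeCoord Ψ (f p)) (stdBasis (n + 1)) (localMap n f p) (alongRep f p N) y

/-- The determinant of the induced metric in the coordinate frame at `p`. -/
abbrev localGramDet (D : ConnOp (n + 1) M) (f : S → M)
    (N : FieldAlong n f) (p : S) (y : Fin n → EuclideanSpace ℝ (Fin n))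
    (x : EuclideanSpace ℝ (Fin n)) : ℝ :=
  (coordGram (christoffel D (f p)) (localMap n f p) (alongRep f p N) y x).det

theorem transversalDensity_eq (hf : ContMDiff (𝓡 n) (𝓡 (n + 1)) ∞ f)
    (Ψ : Π x : M, TangentSpace (𝓡 (n + 1)) x [⋀^Fin (n + 1)]→ₗ[ℝ] ℝ) (hq : q ∈ localDom n f p)
    (Y : Fin n → TangentSpace (𝓡 n) q) :
    transversalDensity f Ψ N q Y =
      |localVol Ψ f N p (fun i ↦ toCoord p q (Y i)) (coordPt n p q)| := by
  rw [transversalDensity, volumeForm_apply hq.2, localVol, coordVol, localMap_coordPt hq]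
  congr 3
  ext1 i
  refine Fin.cases ?_ (fun j ↦ ?_) i
  · exact (alongRep_coordPt hq N).symm
  · exact toCoord_dAt hf hq (Y j)

section

variable {D : ConnOp (n + 1) M}
  (hD : IsCovariantDerivativeOn (I := 𝓡 (n + 1)) (EuclideanSpace ℝ (Fin (n + 1))) D univ)
include hD

theorem metricDensity_eq (hf : ContMDiff (𝓡 n) (𝓡 (n + 1)) ∞ f) (hq : q ∈ localDom n f p)
    (hN : (splitting f N q).IsInvertible) (Y : Fin n → TangentSpace (𝓡 n) q) :
    metricDensity (inducedMetric f D N) q Y =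
      √|localGramDet D f N p (fun i ↦ toCoord p q (Y i)) (coordPt n p q)| := by
  simp only [metricDensity, inducedMetric_eq hf hD hq hN]
  rfl

/-- Equality of the two densities at a point can be tested on the coordinate frame. -/
theorem density_eq_iff (hf : ContMDiff (𝓡 n) (𝓡 (n + 1)) ∞ f)
    (Ψ : Π x : M, TangentSpace (𝓡 (n + 1)) x [⋀^Fin (n + 1)]→ₗ[ℝ] ℝ) (hq : q ∈ localDom n f p)
    (hN : (splitting f N q).IsInvertible) :
    transversalDensity f Ψ N q = metricDensity (inducedMetric f D N) q ↔
      localVol Ψ f N p (stdBasis n) (coordPt n p q) ^ 2 =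
        |localGramDet D f N p (stdBasis n) (coordPt n p q)| := by
  constructor
  · intro h
    have h1 := congrFun h fun i ↦ ofCoord p q (stdBasis n i)
    rw [transversalDensity_eq hf Ψ hq, metricDensity_eq hD hf hq hN] at h1
    simp only [toCoord_ofCoord hq.1] at h1
    rw [← sq_abs, h1, Real.sq_sqrt (abs_nonneg _)]
  · intro h
    ext Y
    -- Passing from the coordinate frame to the tuple `Y` multiplies both densities by the same
    -- `|det|`.
    rw [transversalDensity_eq hf Ψ hq, metricDensity_eq hD hf hq hN, localVol,
      coordVol_eq _ _ _ _ (stdBasis n), localGramDet]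
    have := gram_det_eq (coordMetric (christoffel D (f p)) (localMap n f p) (alongRep f p N)
      (coordPt n p q)).toLinearMap₁₂ (stdBasis n) (fun i ↦ toCoord p q (Y i))
    have h2 : (coordGram (christoffel D (f p)) (localMap n f p) (alongRep f p N)
        (fun i ↦ toCoord p q (Y i)) (coordPt n p q)).det = (stdBasis n).det
          (fun i ↦ toCoord p q (Y i)) ^ 2 *
            localGramDet D f N p (stdBasis n) (coordPt n p q) := this
    rw [h2, abs_mul _ (localGramDet D f N p _ _),
      abs_of_nonneg (sq_nonneg ((stdBasis n).det fun i ↦ toCoord p q (Y i))), ← h, ← mul_pow,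
      Real.sqrt_sq_eq_abs]

/-- The normalizing condition for a positive multiple of a transversal. -/
theorem density_smul_eq_iff (hf : ContMDiff (𝓡 n) (𝓡 (n + 1)) ∞ f)
    (hinj : Function.Injective (dAt n f q))
    (Ψ : Π x : M, TangentSpace (𝓡 (n + 1)) x [⋀^Fin (n + 1)]→ₗ[ℝ] ℝ) (hq : q ∈ localDom n f p)
    (hN : (splitting f N q).IsInvertible) {a : ℝ} (ha : 0 < a) (h : N' q = a • N q) :
    transversalDensity f Ψ N' q = metricDensity (inducedMetric f D N') q ↔
      a ^ (n + 2) * localVol Ψ f N p (stdBasis n) (coordPt n p q) ^ 2 =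
        |localGramDet D f N p (stdBasis n) (coordPt n p q)| := by
  have hN' : (splitting f N' q).IsInvertible := by
    rw [isInvertible_splitting_iff hinj] at hN ⊢
    intro hr
    refine hN ?_
    have : N q = a⁻¹ • N' q := by rw [h, smul_smul, inv_mul_cancel₀ ha.ne', one_smul]
    rw [this]
    exact Submodule.smul_mem _ _ hr
  have hrep : alongRep f p N' (coordPt n p q) = a • alongRep f p N (coordPt n p q) := by
    rw [alongRep_coordPt hq, alongRep_coordPt hq, h, map_smul]
  -- The squared volume is multiplied by `a²` and the Gram determinant by `a⁻ⁿ`; hence the exponent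
  -- `n + 2`.
  rw [density_eq_iff hD hf Ψ hq hN', localVol, coordVol_smul _ _ hrep, localGramDet,
    coordGram_det_smul ((isInvertible_splitting_iff_coord hf hq).1 hN) ha.ne' hrep, abs_mul,
    abs_of_pos (pow_pos (inv_pos.2 ha) n), inv_pow, eq_inv_mul_iff_mul_eq₀ (pow_pos ha n).ne',
    mul_pow, ← mul_assoc, ← pow_add]

end

end Normalization

/-! ### Existence and uniqueness of the normalized section -/

section NormalizedSection

set_option maxSynthPendingDepth 3

variable {n : ℕ} {S : Type*} [TopologicalSpace S] [ChartedSpace (EuclideanSpace ℝ (Fin n)) S]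
  {M : Type*} [TopologicalSpace M] [ChartedSpace (EuclideanSpace ℝ (Fin (n + 1))) M]
  {f : S → M} {N N' : FieldAlong n f} {p q : S} {U U' : Set S}
  {W : Π p : S, Submodule ℝ (TangentSpace (𝓡 (n + 1)) (f p))}
  [IsManifold (𝓡 n) ∞ S] [IsManifold (𝓡 (n + 1)) ∞ M]
  [T2Space M] {D : CovariantDerivative (𝓡 (n + 1)) (EuclideanSpace ℝ (Fin (n + 1)))
    (TangentSpace (𝓡 (n + 1)) : M → Type _)}
  [CovariantDerivative.ContMDiffCovariantDerivative D ∞]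
  (ht : D.torsion = 0) (hS : IsNondegenerateImmersion f D)
  (hW : IsAffineNormalDistribution f D W) (o : Coorientation n f)
  {Ψ : Π x : M, TangentSpace (𝓡 (n + 1)) x [⋀^Fin (n + 1)]→ₗ[ℝ] ℝ} (hΨ : IsVolumeForm Ψ)

include ht hS hW in
/-- A transverse line field is locally spanned by a transversal on the chosen side. -/
theorem IsAffineNormalDistribution.exists_cooriented (p : S) :
    ∃ U, p ∈ U ∧ ∃ N : FieldAlong n f, IsTransversalOn f N U ∧ U ⊆ localDom n f p ∧
      ∀ q ∈ U, W q = Submodule.span ℝ {N q} ∧ N q ∈ o.side q := by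
  have hf := hS.smooth
  obtain ⟨U₀, hp₀, N₀, hN₀, hNW, -⟩ := hW.exists_transversal hS p
  obtain ⟨U₁, hp₁, N₁, hN₁, hside⟩ := o.exists_transversal hS.injective_differential p
  set U := localDom n f p ∩ (U₀ ∩ U₁) with hU
  have hUo : IsOpen U :=
    (isOpen_localDom hf.continuous p).inter (hN₀.isOpen.inter hN₁.isOpen)
  have hN₀' := hN₀.mono hUo fun q hq ↦ hq.2.1
  have hN₁' := hN₁.mono hUo fun q hq ↦ hq.2.2
  have hF := isLocalMap_localMap hf D ht p hUo
  have hNt := isLocalTransversal_alongRep hf hUo hN₁'.smooth hN₁'.isInvertible p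
  -- With `σ` the component of `N₀` along the co-oriented `N₁`, the field `σ N₀` has component `σ² >
  -- 0`. This puts it on the chosen side without a discussion of signs.
  let σ : S → ℝ := fun q ↦ ((splitting f N₁ q).inverse (N₀ q)).2
  have hσ0 : ∀ q ∈ U, σ q ≠ 0 := fun q hq ↦ inverse_splitting_snd_ne_zero
    (hS.injective_differential q) (hN₁'.isInvertible q hq) (hN₀'.isInvertible q hq)
  have hσ : ∀ q ∈ U, ContMDiffAt (𝓡 n) 𝓘(ℝ, ℝ) ∞ σ q := by
    intro q hq
    rw [contMDiffAt_iff_coordFun hq.1.1]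
    have hx := coordPt_mem_coordDom hq.1 hq
    refine ((contDiffAt_transversalPart hF hNt hx).clm_apply ((contDiffOn_alongRep hf hUo
      hN₀'.smooth p).contDiffAt (hF.isOpen.mem_nhds hx))).congr_of_eventuallyEq ?_
    refine eventually_of_localDom hf.continuous hq.1 fun r hr ↦ ?_
    rw [coordFun_coordPt hr.1]
    dsimp only [σ]
    rw [alongRep_coordPt hr, inverse_splitting_apply hf hr]
  refine ⟨U, ⟨mem_localDom f p, hp₀, hp₁⟩, _,
    hN₀'.smul hf hS.injective_differential hσ hσ0, fun q hq ↦ hq.1, fun q hq ↦ ⟨?_, ?_⟩⟩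
  · rw [hNW q hq.2.1]
    exact (Submodule.span_singleton_smul_eq (isUnit_iff_ne_zero.2 (hσ0 q hq)) _).symm
  · rw [hside q hq.2.2, map_smul]
    exact mul_self_pos.2 (hσ0 q hq)

omit [T2Space M] [CovariantDerivative.ContMDiffCovariantDerivative D ∞] in
include hS hΨ in
/-- Sections of a line on the same side with equal densities agree. -/
theorem eq_of_density_eq {v : TangentSpace (𝓡 (n + 1)) (f q)} (hN : N q ∈ Submodule.span ℝ {v})
    (hN' : N' q ∈ Submodule.span ℝ {v}) (ho : N q ∈ o.side q) (ho' : N' q ∈ o.side q)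
    (hd : transversalDensity f Ψ N q = metricDensity (inducedMetric f D N) q)
    (hd' : transversalDensity f Ψ N' q = metricDensity (inducedMetric f D N') q) :
    N' q = N q := by
  have hf := hS.smooth
  have hinj := hS.injective_differential
  have hcov := D.isCovariantDerivativeOnUniv
  have hq := mem_localDom (n := n) f q
  have hNi := o.isInvertible_splitting hinj ho
  obtain ⟨a, ha⟩ := Submodule.mem_span_singleton.1 hN
  obtain ⟨a', ha'⟩ := Submodule.mem_span_singleton.1 hN'
  have ha0 : a ≠ 0 := by
    rintro rfl
    refine (isInvertible_splitting_iff (hinj q)).1 hNi ?_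
    rw [← ha, zero_smul]
    exact Submodule.zero_mem _
  have hc : N' q = (a' * a⁻¹) • N q := by
    rw [← ha, ← ha', smul_smul, inv_mul_cancel_right₀ ha0]
  have hpos : 0 < a' * a⁻¹ := (o.smul_mem_side_iff hinj ho _).1 (hc ▸ ho')
  have h1 := (density_eq_iff hcov hf Ψ hq hNi).1 hd
  have h2 := (density_smul_eq_iff hcov hf (hinj q) Ψ hq hNi hpos hc).1 hd'
  have hT : localVol Ψ f N q (stdBasis n) (coordPt n q q) ≠ 0 :=
    coordVol_ne_zero _ _ (by rw [localMap_coordPt hq]; exact hΨ.volumeCoord_ne_zero hq.2)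
      ((isInvertible_splitting_iff_coord hf hq).1 hNi)
  rw [← h1] at h2
  -- The ratio of the two sections is positive and its power with exponent `n + 2` is `1`, so it is
  -- `1`.
  have h3 : (a' * a⁻¹) ^ (n + 2) = 1 :=
    mul_right_cancel₀ (pow_ne_zero 2 hT) (h2.trans (one_mul _).symm)
  have h4 := (pow_eq_one_iff_of_nonneg hpos.le (by simp)).1 h3
  rw [hc, h4, one_smul]

-- A co-oriented transversal `N` in `W` is multiplied by the positive root of order `n + 2` of `|det
-- h| / Ψ(N, …)²`. The quotient never vanishes, so the root is smooth.
include ht hS hW hΨ in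
theorem exists_local_normalizedSection (p : S) :
    ∃ U, p ∈ U ∧ ∃ N : FieldAlong n f, IsTransversalOn f N U ∧ ∀ q ∈ U,
      W q = Submodule.span ℝ {N q} ∧ N q ∈ o.side q ∧
        transversalDensity f Ψ N q = metricDensity (inducedMetric f D N) q := by
  have hf := hS.smooth
  have hinj := hS.injective_differential
  have hcov := D.isCovariantDerivativeOnUniv
  obtain ⟨U, hpU, N, hN, hUp, hU⟩ := hW.exists_cooriented ht hS o p
  have hF := isLocalMap_localMap hf D ht p hN.isOpen
  have hNt := isLocalTransversal_alongRep hf hN.isOpen hN.smooth hN.isInvertible p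
  let T := localVol Ψ f N p (stdBasis n)
  let H := localGramDet (D : ConnOp (n + 1) M) f N p (stdBasis n)
  have hT0 : ∀ q ∈ U, T (coordPt n p q) ≠ 0 := fun q hq ↦ coordVol_ne_zero _ _
    (by rw [localMap_coordPt (hUp hq)]; exact hΨ.volumeCoord_ne_zero (hUp hq).2)
    ((isInvertible_splitting_iff_coord hf (hUp hq)).1 (hN.isInvertible q hq))
  have hH0 : ∀ q ∈ U, H (coordPt n p q) ≠ 0 := fun q hq ↦
    coordGram_det_ne_zero hS hcov (hUp hq) (hN.isInvertible q hq) (stdBasis n)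
  let R : EuclideanSpace ℝ (Fin n) → ℝ := fun x ↦
    (|H x| / T x ^ 2) ^ (((n + 2 : ℕ) : ℝ)⁻¹)
  have hpos : ∀ q ∈ U, 0 < |H (coordPt n p q)| / T (coordPt n p q) ^ 2 := fun q hq ↦
    div_pos (abs_pos.2 (hH0 q hq)) (pow_pos (abs_pos.2 (hT0 q hq)) 2 |>.trans_eq (sq_abs _))
  have hR0 : ∀ q ∈ U, 0 < R (coordPt n p q) := fun q hq ↦ Real.rpow_pos_of_pos (hpos q hq) _
  have hR : ∀ q ∈ U, ContDiffAt ℝ ∞ R (coordPt n p q) := by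
    intro q hq
    have hx := coordPt_mem_coordDom (hUp hq) hq
    have h1 : ContDiffAt ℝ ∞ H (coordPt n p q) :=
      contDiffAt_det (contDiffAt_coordGram hF hNt hx (stdBasis n))
    have h2 : ContDiffAt ℝ ∞ T (coordPt n p q) := contDiffAt_coordVol hF hNt hx
      (by rw [localMap_coordPt (hUp hq)]; exact hΨ.contDiffAt_volumeCoord (hUp hq).2) _ _
    exact ((h1.abs (hH0 q hq)).div (h2.pow 2) (pow_ne_zero 2 (hT0 q hq))).rpow_const_of_ne
      (hpos q hq).ne'
  let r : S → ℝ := fun q ↦ R (coordPt n p q)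
  have hr : ∀ q ∈ U, ContMDiffAt (𝓡 n) 𝓘(ℝ, ℝ) ∞ r q := by
    intro q hq
    rw [contMDiffAt_iff_coordFun (hUp hq).1]
    refine (hR q hq).congr_of_eventuallyEq ?_
    refine eventually_of_localDom hf.continuous (hUp hq) fun s hs ↦ ?_
    rw [coordFun_coordPt hs.1]
  refine ⟨U, hpU, fun q ↦ r q • N q, hN.smul hf hinj hr fun q hq ↦ (hR0 q hq).ne', fun q hq ↦
    ⟨?_, ?_, ?_⟩⟩
  · rw [(hU q hq).1]
    exact (Submodule.span_singleton_smul_eq (isUnit_iff_ne_zero.2 (hR0 q hq).ne') _).symm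
  · exact (o.smul_mem_side_iff hinj (hU q hq).2 _).2 (hR0 q hq)
  · rw [density_smul_eq_iff hcov hf (hinj q) Ψ (hUp hq) (hN.isInvertible q hq) (hR0 q hq) rfl]
    have h1 : R (coordPt n p q) ^ (n + 2) = |H (coordPt n p q)| / T (coordPt n p q) ^ 2 :=
      Real.rpow_inv_natCast_pow (hpos q hq).le (by simp)
    rw [h1]
    exact div_mul_cancel₀ _ (pow_ne_zero 2 (hT0 q hq))

-- The normalization determines the value at each point, so the local sections agree on overlaps and
-- glue to a smooth field.
include ht hS hW hΨ in
theorem existsUnique_isNormalizedSection : ∃! ν, IsNormalizedSection f D Ψ o W ν := by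
  choose U hpU N hN hprop using exists_local_normalizedSection ht hS hW o hΨ
  have heq : ∀ p, ∀ q ∈ U p, N q q = N p q := by
    intro p q hq
    obtain ⟨h1, h2, h3⟩ := hprop p q hq
    obtain ⟨h1', h2', h3'⟩ := hprop q q (hpU q)
    exact eq_of_density_eq hS o hΨ (v := N p q) (Submodule.mem_span_singleton_self _)
      (by rw [← h1, h1']; exact Submodule.mem_span_singleton_self _) h2 h2' h3 h3'
  -- At `q` both densities depend on the transversal only through its value there, so the condition
  -- passes to the glued field.
  have hdens : ∀ (N N' : FieldAlong n f) q, N q = N' q →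
      transversalDensity f Ψ N q = metricDensity (inducedMetric f D N) q →
      transversalDensity f Ψ N' q = metricDensity (inducedMetric f D N') q := by
    intro N N' q h hd
    have h1 : transversalDensity f Ψ N' q = transversalDensity f Ψ N q := by
      ext Y; simp only [transversalDensity, h]
    have h2 : metricDensity (inducedMetric f D N') q = metricDensity (inducedMetric f D N) q := by
      ext Y; simp only [metricDensity, inducedMetric, splitting, h]
    rw [h1, h2, hd]
  refine ⟨fun p ↦ N p p, ⟨fun p _ ↦ ContMDiffAt.contMDiffWithinAt ?_, fun p ↦ ?_, fun p ↦ ?_, ?_⟩,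
    fun ν hν ↦ ?_⟩
  · refine (((hN p).smooth.contMDiffAt
      ((hN p).isOpen.mem_nhds (hpU p)))).congr_of_eventuallyEq ?_
    filter_upwards [(hN p).isOpen.mem_nhds (hpU p)] with q hq
    rw [heq p q hq]
  · rw [(hprop p p (hpU p)).1]; exact Submodule.mem_span_singleton_self _
  · exact (hprop p p (hpU p)).2.1
  · funext q
    exact hdens (N q) _ q rfl (hprop q q (hpU q)).2.2
  · funext q
    obtain ⟨h1, h2, h3⟩ := hprop q q (hpU q)
    exact eq_of_density_eq hS o hΨ (v := N q q) (Submodule.mem_span_singleton_self _)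
      (by rw [← h1]; exact hν.mem_line q) h2 (hν.mem_side q) h3 (congrFun hν.density_eq q)

end NormalizedSection

/-! ### Parallel densities -/

section CubicSymmetry

set_option maxSynthPendingDepth 3

variable {E E' : Type*} [NormedAddCommGroup E] [NormedSpace ℝ E] [FiniteDimensional ℝ E]
  [NormedAddCommGroup E'] [NormedSpace ℝ E']
  {Γ : E' → E' →L[ℝ] E' →L[ℝ] E'} {F N : E → E'} {x : E} {Ω : Set E}
  {ι : Type*} [Fintype ι] [DecidableEq ι]

theorem coordCubic_symm (hF : IsLocalMap Γ F Ω) (hN : IsLocalTransversal F N Ω) (hx : x ∈ Ω)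
    (X Y Z : E) : coordCubic Γ F N x X Y Z = coordCubic Γ F N x X Z Y := by
  have hh := ((contDiffAt_coordMetric hF hN hx).differentiableAt (by simp)).hasFDerivAt
  have h1 : ∀ Y Z, HasFDerivAt (fun y ↦ coordMetric Γ F N y Y Z) _ x := fun Y Z ↦
    (hh.clm_apply (hasFDerivAt_const Y x)).clm_apply (hasFDerivAt_const Z x)
  have h2 : (fun y ↦ coordMetric Γ F N y Y Z) =ᶠ[nhds x] fun y ↦ coordMetric Γ F N y Z Y := by
    filter_upwards [hF.isOpen.mem_nhds hx] with y hy
    exact hF.coordMetric_symm hy Y Z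
  have h3 := DFunLike.congr_fun (((h1 Y Z).congr_of_eventuallyEq h2.symm).unique (h1 Z Y)) X
  have h4 : fderiv ℝ (coordMetric Γ F N) x X Y Z = fderiv ℝ (coordMetric Γ F N) x X Z Y := by
    simpa using h3
  rw [coordCubic, coordCubic, h4, hF.coordMetric_symm hx _ Z, hF.coordMetric_symm hx Y]
  ring

/-- If the curvature is tangential, the Codazzi equation determines the trace of the cubic form
by the connection form and the defect of alignment. -/
theorem trace_codazzi (hF : IsLocalMap Γ F Ω) (hN : IsLocalTransversal F N Ω) (hx : x ∈ Ω)
    (b : Module.Basis ι ℝ E) (hdet : (coordGram Γ F N b x).det ≠ 0)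
    (hR : ∀ X Y Z, transversalPart F N x
      (coordCurvature Γ (F x) (fderiv ℝ F x X) (fderiv ℝ F x Y) (fderiv ℝ F x Z)) = 0) (X : E) :
    ((Fintype.card ι : ℝ) - 1) *
        (contraction (fun u v ↦ coordMetric Γ F N x u v) b (coordCubic Γ F N x X) +
          Fintype.card ι * coordConnForm Γ F N x X) = coordDefect Γ F N b x X := by
  have hs : ∀ u v, (coordMetric Γ F N x).toLinearMap₁₂ u v =
      (coordMetric Γ F N x).toLinearMap₁₂ v u := fun u v ↦ hF.coordMetric_symm hx u v
  -- Codazzi solved for the cubic form with `X` in the differentiating slot, its last two arguments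
  -- being symmetric.
  have hcod : ∀ Y Z, coordCubic Γ F N x X Y Z =
      (coordCubic Γ F N x Y Z X + coordConnForm Γ F N x Y * coordMetric Γ F N x Z X) -
        coordConnForm Γ F N x X * coordMetric Γ F N x Y Z := by
    intro Y Z
    have := codazzi hF hN hx X Y Z
    rw [hR, coordCubic_symm hF hN hx Y X Z, hF.coordMetric_symm hx X Z] at this
    linarith
  -- Contracting over `Y` and `Z`, the term `τ(Y) h(Z, X)` gives `τ(X)` and the term `τ(X) h(Y, Z)`
  -- gives `n τ(X)`.
  have h1 : contraction (fun u v ↦ coordMetric Γ F N x u v) b (coordCubic Γ F N x X) =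
      contraction (fun u v ↦ coordMetric Γ F N x u v) b (fun u v ↦ coordCubic Γ F N x u v X) +
        coordConnForm Γ F N x X - coordConnForm Γ F N x X * Fintype.card ι := by
    have e0 : coordCubic Γ F N x X = fun Y Z ↦
      (coordCubic Γ F N x Y Z X + coordConnForm Γ F N x Y * coordMetric Γ F N x Z X) -
        coordConnForm Γ F N x X * coordMetric Γ F N x Y Z := by
      ext Y Z; exact hcod Y Z
    have e1 := contraction_mul_apply (h := (coordMetric Γ F N x).toLinearMap₁₂) b hdet
      (coordConnForm Γ F N x).toLinearMap X
    have e2 := contraction_self (h := (coordMetric Γ F N x).toLinearMap₁₂) b hdet hs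
    conv_lhs => rw [e0]
    rw [contraction_sub, contraction_add, contraction_const_mul]
    exact congrArg₂ (fun s t : ℝ ↦ _ + s - coordConnForm Γ F N x X * t) e1 e2
  rw [coordDefect, alignmentDefect]
  linear_combination (Fintype.card ι : ℝ) * h1

end CubicSymmetry

/-! ### Covariant derivatives of the two densities on the hypersurface -/

section ParallelDensities

set_option maxSynthPendingDepth 3

variable {n : ℕ} {S : Type*} [TopologicalSpace S] [ChartedSpace (EuclideanSpace ℝ (Fin n)) S]
  {M : Type*} [TopologicalSpace M] [ChartedSpace (EuclideanSpace ℝ (Fin (n + 1))) M]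
  {f : S → M} {N : FieldAlong n f} {p : S} {U : Set S}
  [IsManifold (𝓡 n) ∞ S] [IsManifold (𝓡 (n + 1)) ∞ M]

/-- The connection form of `N` at `p`, in the coordinates at `p`. -/
abbrev connFormAt (D : ConnOp (n + 1) M) (f : S → M) (N : FieldAlong n f) (p : S) :
    EuclideanSpace ℝ (Fin n) →L[ℝ] ℝ :=
  coordConnForm (christoffel D (f p)) (localMap n f p) (alongRep f p N) (coordPt n p p)

/-- The trace `h^{ij} ∇_X h_{ij}` at `p`, in the coordinates at `p`. -/
abbrev cubicTraceAt (D : ConnOp (n + 1) M) (f : S → M) (N : FieldAlong n f) (p : S)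
    (X : EuclideanSpace ℝ (Fin n)) : ℝ :=
  contraction (fun u v ↦ coordMetric (christoffel D (f p)) (localMap n f p) (alongRep f p N)
    (coordPt n p p) u v) (stdBasis n)
      (coordCubic (christoffel D (f p)) (localMap n f p) (alongRep f p N) (coordPt n p p) X)

/-- The coordinates of a frame form a basis. -/
theorem exists_coordBasis {Y : Fin n → TangentSpace (𝓡 n) p} (hY : LinearIndependent ℝ Y) :
    ∃ b : Module.Basis (Fin n) ℝ (EuclideanSpace ℝ (Fin n)), ∀ i, b i = toCoord p p (Y i) := by
  have h1 : LinearIndependent ℝ fun i ↦ toCoord p p (Y i) :=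
    hY.map' (coordEquiv (mem_chartDom p)).toLinearEquiv.toLinearMap
      (LinearMap.ker_eq_bot.2 (coordEquiv (mem_chartDom p)).injective)
  exact ⟨basisOfLinearIndependentOfCardEqFinrank' _ h1 (by simp), fun i ↦ by simp⟩

variable [T2Space M] {D : CovariantDerivative (𝓡 (n + 1)) (EuclideanSpace ℝ (Fin (n + 1)))
    (TangentSpace (𝓡 (n + 1)) : M → Type _)}
  [CovariantDerivative.ContMDiffCovariantDerivative D ∞]
  (ht : D.torsion = 0) (hS : IsNondegenerateImmersion f D) (hN : IsTransversalOn f N U)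
  (hp : p ∈ U)
include ht hS hN hp

omit ht hS hN hp [IsManifold (𝓡 (n + 1)) ∞ M] [T2Space M] in
/-- The matrix of `∇_X` on a frame in coordinates. -/
theorem toCoord_connection_matrix {Y : Fin n → VField n S}
    {c : Matrix (Fin n) (Fin n) ℝ} {v : Fin n → TangentSpace (𝓡 n) p}
    (hc : ∀ j, v j = ∑ i, c i j • Y i p) (j : Fin n) :
    toCoord p p (v j) = ∑ i, c i j • toCoord p p (Y i p) := by
  rw [hc, map_sum]
  exact Finset.sum_congr rfl fun i _ ↦ map_smul _ _ _

/-- This is `∇|ι(N)Ψ| = τ ⊗ |ι(N)Ψ|`: as `Ψ` is parallel, only the component of `∇̂N` along `N`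
survives in the determinant. -/
theorem transversalDensity_derivative
    {Ψ : Π x : M, TangentSpace (𝓡 (n + 1)) x [⋀^Fin (n + 1)]→ₗ[ℝ] ℝ} (hΨ : IsVolumeForm Ψ)
    (hpar : PreservesForm D Ψ) {Y : Fin n → VField n S} (hY : ∀ i, IsDiffFieldAt (Y i) p)
    (hli : LinearIndependent ℝ fun i ↦ Y i p) :
    0 < transversalDensity f Ψ N p (fun i ↦ Y i p) ∧
    MDifferentiableAt (𝓡 n) 𝓘(ℝ, ℝ) (fun q ↦ transversalDensity f Ψ N q fun i ↦ Y i q) p ∧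
    ∀ (X : TangentSpace (𝓡 n) p) (c : Matrix (Fin n) (Fin n) ℝ),
      (∀ j, inducedConnection f D N (Y j) p X = ∑ i, c i j • Y i p) →
      mvfderiv (𝓡 n) (fun q ↦ transversalDensity f Ψ N q fun i ↦ Y i q) p X =
        (connFormAt D f N p (toCoord p p X) + c.trace) *
          transversalDensity f Ψ N p fun i ↦ Y i p := by
  have hf := hS.smooth
  have hcov := D.isCovariantDerivativeOnUniv
  have hpp := mem_localDom (n := n) f p
  have hF := isLocalMap_localMap hf D ht p hN.isOpen
  have hNt := isLocalTransversal_alongRep hf hN.isOpen hN.smooth hN.isInvertible p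
  have hx := coordPt_mem_coordDom hpp hp
  obtain ⟨b, hb⟩ := exists_coordBasis hli
  have hyb : ∀ i, coordField p (Y i) (coordPt n p p) = b i := fun i ↦ by
    rw [hb, coordField_coordPt hpp.1]
  obtain ⟨L, hL, hLX⟩ := hasFDerivAt_volume hF hNt hx (stdBasis (n + 1))
    (μ := volumeCoord Ψ (f p))
    (by rw [localMap_coordPt hpp]
        exact (hΨ.contDiffAt_volumeCoord hpp.2).differentiableAt (by simp))
    (by rw [localMap_coordPt hpp]; exact hpar.fderiv_volumeCoord hcov hΨ hpp.2)
    (y := fun i ↦ coordField p (Y i)) (fun i ↦ (isDiffFieldAt_iff hpp.1 _).1 (hY i))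
    (by simp only [hyb]; exact b.span_eq.ge)
  have hval : volumeCoord Ψ (f p) (localMap n f p (coordPt n p p)) * (stdBasis (n + 1)).det
      (Matrix.vecCons (alongRep f p N (coordPt n p p)) fun i ↦
        fderiv ℝ (localMap n f p) (coordPt n p p) (coordField p (Y i) (coordPt n p p))) ≠ 0 := by
    simp only [hyb]
    exact coordVol_ne_zero _ b (by rw [localMap_coordPt hpp]; exact hΨ.volumeCoord_ne_zero hpp.2)
      (hNt.isInvertible _ hx)
  obtain ⟨L', hL', hLX'⟩ := hasFDerivAt_abs_of_log hL hval
  have hfun : coordFun n p (fun q ↦ transversalDensity f Ψ N q fun i ↦ Y i q)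
      =ᶠ[nhds (coordPt n p p)] fun z ↦ |volumeCoord Ψ (f p) (localMap n f p z) *
        (stdBasis (n + 1)).det (Matrix.vecCons (alongRep f p N z) fun i ↦
          fderiv ℝ (localMap n f p) z (coordField p (Y i) z))| := by
    refine eventually_of_localDom hf.continuous hpp fun r hr ↦ ?_
    rw [coordFun_coordPt hr.1, transversalDensity_eq hf Ψ hr]
    simp only [coordField_coordPt hr.1]
    rfl
  have hder := hL'.congr_of_eventuallyEq hfun
  have hmd := (mdifferentiableAt_iff_coordFun hpp.1).2 hder.differentiableAt
  have hv := hfun.self_of_nhds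
  rw [coordFun_coordPt hpp.1] at hv
  refine ⟨by rw [hv]; exact abs_pos.2 hval, hmd, fun X c hc ↦ ?_⟩
  rw [mvfderiv_eq_fderiv_coordFun hpp.1 hmd, hder.fderiv, hv]
  refine hLX' _ _ (hLX _ c fun j ↦ ?_)
  have h1 := toCoord_connection_matrix hc j
  rw [toCoord_inducedConnection hf hcov hpp (hN.isInvertible p hp) (hY j)] at h1
  simp only [coordField_coordPt hpp.1]
  exact h1

/-- This is `∇|vol_h| = ½ (h^{ij} ∇h_{ij}) ⊗ |vol_h|`, by Jacobi's formula for the Gram determinant.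
-/
theorem metricDensity_derivative {Y : Fin n → VField n S} (hY : ∀ i, IsDiffFieldAt (Y i) p)
    (hli : LinearIndependent ℝ fun i ↦ Y i p) :
    0 < metricDensity (inducedMetric f D N) p (fun i ↦ Y i p) ∧
    MDifferentiableAt (𝓡 n) 𝓘(ℝ, ℝ)
      (fun q ↦ metricDensity (inducedMetric f D N) q fun i ↦ Y i q) p ∧
    ∀ (X : TangentSpace (𝓡 n) p) (c : Matrix (Fin n) (Fin n) ℝ),
      (∀ j, inducedConnection f D N (Y j) p X = ∑ i, c i j • Y i p) →
      mvfderiv (𝓡 n) (fun q ↦ metricDensity (inducedMetric f D N) q fun i ↦ Y i q) p X =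
        (cubicTraceAt D f N p (toCoord p p X) / 2 + c.trace) *
          metricDensity (inducedMetric f D N) p fun i ↦ Y i p := by
  have hf := hS.smooth
  have hcov := D.isCovariantDerivativeOnUniv
  have hpp := mem_localDom (n := n) f p
  have hNp := hN.isInvertible p hp
  have hF := isLocalMap_localMap hf D ht p hN.isOpen
  have hNt := isLocalTransversal_alongRep hf hN.isOpen hN.smooth hN.isInvertible p
  have hx := coordPt_mem_coordDom hpp hp
  obtain ⟨b, hb⟩ := exists_coordBasis hli
  have hyb : (fun i ↦ coordField p (Y i) (coordPt n p p)) = b := by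
    ext1 i
    rw [hb, coordField_coordPt hpp.1]
  have hdet := coordGram_det_ne_zero hS hcov hpp hNp b
  obtain ⟨L, hL, hLX⟩ := hasFDerivAt_det_gram hF hNt hx
    (y := fun i ↦ coordField p (Y i)) (fun i ↦ (isDiffFieldAt_iff hpp.1 _).1 (hY i))
    (by rw [hyb]; exact hdet)
  obtain ⟨L', hL', hLX'⟩ := hasFDerivAt_sqrt_abs_of_log hL (by rw [hyb]; exact hdet)
  have hfun : coordFun n p (fun q ↦ metricDensity (inducedMetric f D N) q fun i ↦ Y i q)
      =ᶠ[nhds (coordPt n p p)] fun z ↦ √|(gram (fun u v ↦ coordMetric (christoffel D (f p))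
        (localMap n f p) (alongRep f p N) z u v) fun i ↦ coordField p (Y i) z).det| := by
    filter_upwards [hF.isOpen.mem_nhds hx] with z hz
    obtain ⟨r, hr, rfl⟩ := exists_of_mem_coordDom hz
    rw [coordFun_coordPt hr.1.1, metricDensity_eq hcov hf hr.1 (hN.isInvertible r hr.2)]
    simp only [coordField_coordPt hr.1.1]
    rfl
  have hder := hL'.congr_of_eventuallyEq hfun
  have hmd := (mdifferentiableAt_iff_coordFun hpp.1).2 hder.differentiableAt
  have hv := hfun.self_of_nhds
  rw [coordFun_coordPt hpp.1] at hv
  have hsymm : ∀ u v, (coordMetric (christoffel D (f p)) (localMap n f p) (alongRep f p N)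
      (coordPt n p p)).toLinearMap₁₂ u v = (coordMetric (christoffel D (f p)) (localMap n f p)
        (alongRep f p N) (coordPt n p p)).toLinearMap₁₂ v u :=
    fun u v ↦ hF.coordMetric_symm hx u v
  refine ⟨?_, hmd, fun X c hc ↦ ?_⟩
  · rw [hv]
    refine Real.sqrt_pos.2 (abs_pos.2 ?_)
    rw [hyb]; exact hdet
  · rw [mvfderiv_eq_fderiv_coordFun hpp.1 hmd, hder.fderiv, hv]
    refine hLX' _ _ ?_
    rw [hLX (toCoord p p X) c fun j ↦ ?_]
    -- The trace was obtained in the given frame with its arguments interchanged; it is carried over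
    -- to the standard basis, in which `cubicTraceAt` is defined.
    · have h1 := contraction_basis_independent
        (h := (coordMetric (christoffel D (f p)) (localMap n f p) (alongRep f p N)
          (coordPt n p p)).toLinearMap₁₂) (stdBasis n)
        (coordGram_det_ne_zero hS hcov hpp hNp (stdBasis n)) hsymm b hdet
        (cubicRight (christoffel D (f p)) (localMap n f p) (alongRep f p N) (coordPt n p p)
          (toCoord p p X))
      have h2 := contraction_swap (ι := Fin n) b hsymm
        (coordCubic (christoffel D (f p)) (localMap n f p) (alongRep f p N)
          (coordPt n p p) (toCoord p p X))
      rw [hyb]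
      congr 1
      refine (congrArg (· + 2 * c.trace) (h2.trans h1)).trans ?_
      rw [mul_add, mul_div_cancel₀ _ two_ne_zero]
      rfl
    · have h1 := toCoord_connection_matrix hc j
      rw [toCoord_inducedConnection hf hcov hpp hNp (hY j)] at h1
      simp only [coordField_coordPt hpp.1]
      exact h1

end ParallelDensities

/-! ### The logarithmic covariant derivative of a density -/

section DensityDerivative

set_option maxSynthPendingDepth 3

variable {n : ℕ} {S : Type*} [TopologicalSpace S] [ChartedSpace (EuclideanSpace ℝ (Fin n)) S]
  [IsManifold (𝓡 n) ∞ S]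

/-- The positive density `μ` satisfies `∇μ = α ⊗ μ` at `p`, where the one-form `α` is given in the
coordinates at `p`. -/
def HasDensityDerivAt (D : ConnOp n S) (μ : DensityField n S) (p : S)
    (α : EuclideanSpace ℝ (Fin n) → ℝ) : Prop :=
  ∀ Y : Fin n → VField n S, (∀ i, IsDiffFieldAt (Y i) p) →
    LinearIndependent ℝ (fun i ↦ Y i p) →
    0 < μ p (fun i ↦ Y i p) ∧
    MDifferentiableAt (𝓡 n) 𝓘(ℝ, ℝ) (fun q ↦ μ q fun i ↦ Y i q) p ∧
    ∀ (X : TangentSpace (𝓡 n) p) (c : Matrix (Fin n) (Fin n) ℝ),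
      (∀ j, D (Y j) p X = ∑ i, c i j • Y i p) →
      mvfderiv (𝓡 n) (fun q ↦ μ q fun i ↦ Y i q) p X =
        (α (toCoord p p X) + c.trace) * μ p fun i ↦ Y i p

variable {D : ConnOp n S} {μ : DensityField n S} {p : S} {α β : EuclideanSpace ℝ (Fin n) → ℝ}

theorem exists_frame (p : S) : ∃ Y : Fin n → VField n S, (∀ i, IsDiffFieldAt (Y i) p) ∧
    LinearIndependent ℝ (fun i ↦ Y i p) ∧ ∀ v : Fin n → TangentSpace (𝓡 n) p,
      ∃ c : Matrix (Fin n) (Fin n) ℝ, ∀ j, v j = ∑ i, c i j • Y i p := by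
  have hp := mem_chartDom (m := n) p
  let b : Module.Basis (Fin n) ℝ (TangentSpace (𝓡 n) p) :=
    (stdBasis n).map (coordEquiv hp).symm.toLinearEquiv
  have hb : (fun i ↦ constField p (stdBasis n i) p) = b := by
    ext1 i
    rw [Module.Basis.map_apply]
    rfl
  refine ⟨fun i ↦ constField p (stdBasis n i), fun i ↦ isDiffFieldAt_constField hp _, ?_,
    fun v ↦ ⟨Matrix.of fun i j ↦ b.repr (v j) i, fun j ↦ ?_⟩⟩
  · rw [hb]; exact b.linearIndependent
  · have h := (b.sum_repr (v j)).symm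
    rw [← hb] at h
    exact h

/-- One frame suffices: both forms compute the same derivative of a positive number, which can be
cancelled. -/
theorem HasDensityDerivAt.unique (h : HasDensityDerivAt D μ p α) (h' : HasDensityDerivAt D μ p β)
    (u : EuclideanSpace ℝ (Fin n)) : α u = β u := by
  obtain ⟨Y, hY, hli, hc⟩ := exists_frame (n := n) p
  obtain ⟨c, hc⟩ := hc fun j ↦ D (Y j) p (ofCoord p p u)
  obtain ⟨hpos, -, h1⟩ := h Y hY hli
  obtain ⟨-, -, h2⟩ := h' Y hY hli
  have := (h1 _ c hc).symm.trans (h2 _ c hc)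
  rw [toCoord_ofCoord (mem_chartDom p)] at this
  exact add_right_cancel (mul_right_cancel₀ hpos.ne' this)

theorem preservesDensity_iff {α : S → EuclideanSpace ℝ (Fin n) → ℝ}
    (h : ∀ p, HasDensityDerivAt D μ p (α p)) : PreservesDensity D μ ↔ ∀ p u, α p u = 0 := by
  constructor
  · intro hμ p u
    refine (h p).unique (β := fun _ ↦ 0) (fun Y hY hli ↦ ⟨((h p) Y hY hli).1, (hμ p Y hY hli).1,
      fun X c hc ↦ ?_⟩) u
    rw [zero_add]
    exact (hμ p Y hY hli).2 X c hc
  · intro h0 p Y hY hli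
    obtain ⟨-, hd, hX⟩ := h p Y hY hli
    refine ⟨hd, fun X c hc ↦ ?_⟩
    rw [hX X c hc, h0, zero_add]

end DensityDerivative

/-! ### Alignment and parallel densities in the projectively flat case -/

section EquiaffineNormal

set_option maxSynthPendingDepth 3

variable {n : ℕ} {S : Type*} [TopologicalSpace S] [ChartedSpace (EuclideanSpace ℝ (Fin n)) S]
  {M : Type*} [TopologicalSpace M] [ChartedSpace (EuclideanSpace ℝ (Fin (n + 1))) M]
  {f : S → M} {N : FieldAlong n f} {p : S} {U : Set S}
  [IsManifold (𝓡 n) ∞ S] [IsManifold (𝓡 (n + 1)) ∞ M]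
  [T2Space M] {D : CovariantDerivative (𝓡 (n + 1)) (EuclideanSpace ℝ (Fin (n + 1)))
    (TangentSpace (𝓡 (n + 1)) : M → Type _)}
  [CovariantDerivative.ContMDiffCovariantDerivative D ∞]
  (ht : D.torsion = 0) (hS : IsNondegenerateImmersion f D)
include ht hS

/-- Projective flatness makes the curvature of tangent vectors tangent, so its transversal part is
absent from the Codazzi equation. -/
theorem IsTransversalOn.trace_codazzi (hN : IsTransversalOn f N U) (hp : p ∈ U)
    (hflat : IsProjectivelyFlat (D : ConnOp (n + 1) M)) (u : EuclideanSpace ℝ (Fin n)) :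
    ((n : ℝ) - 1) * (cubicTraceAt D f N p u + n * connFormAt D f N p u) =
      coordDefect (christoffel (D : ConnOp (n + 1) M) (f p)) (localMap n f p) (alongRep f p N)
        (stdBasis n) (coordPt n p p) u := by
  have hf := hS.smooth
  have hpp := mem_localDom (n := n) f p
  have hF := isLocalMap_localMap hf D ht p hN.isOpen
  have hNt := isLocalTransversal_alongRep hf hN.isOpen hN.smooth hN.isInvertible p
  have hx := coordPt_mem_coordDom hpp hp
  have hL := hNt.isInvertible _ hx
  have h := HypersurfaceGeometry.trace_codazzi hF hNt hx (stdBasis n)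
    (coordGram_det_ne_zero hS D.isCovariantDerivativeOnUniv hpp (hN.isInvertible p hp) _)
    (fun X Y Z ↦ by
      rw [localMap_coordPt hpp]
      obtain ⟨r, s, t, h⟩ := hflat.coordCurvature_eq D ht (f p)
        (fderiv ℝ (localMap n f p) (coordPt n p p) X) (fderiv ℝ (localMap n f p) (coordPt n p p) Y)
        (fderiv ℝ (localMap n f p) (coordPt n p p) Z)
      rw [h]
      simp [transversalPart_fderiv hL]) u
  rw [Fintype.card_fin] at h
  exact h

variable {Ψ : Π x : M, TangentSpace (𝓡 (n + 1)) x [⋀^Fin (n + 1)]→ₗ[ℝ] ℝ} (hΨ : IsVolumeForm Ψ)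
  (hpar : PreservesForm D Ψ)
include hΨ hpar

/-- Equal densities have equal logarithmic derivatives. -/
theorem IsTransversalOn.connForm_eq (hN : IsTransversalOn f N univ)
    (hvol : transversalDensity f Ψ N = metricDensity (inducedMetric f D N)) (p : S)
    (u : EuclideanSpace ℝ (Fin n)) : connFormAt D f N p u = cubicTraceAt D f N p u / 2 := by
  have h1 : HasDensityDerivAt (inducedConnection f D N) (transversalDensity f Ψ N) p
      (connFormAt D f N p) := fun _ hY hli ↦
    transversalDensity_derivative ht hS hN (mem_univ p) hΨ hpar hY hli
  have h2 : HasDensityDerivAt (inducedConnection f D N) (metricDensity (inducedMetric f D N)) p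
      (fun u ↦ cubicTraceAt D f N p u / 2) := fun _ hY hli ↦
    metricDensity_derivative ht hS hN (mem_univ p) hY hli
  rw [← hvol] at h2
  exact h1.unique h2 u

theorem IsTransversalOn.preservesDensity_iff (hN : IsTransversalOn f N univ) :
    PreservesDensity (inducedConnection f D N) (transversalDensity f Ψ N) ↔
      ∀ p u, connFormAt D f N p u = 0 :=
  HypersurfaceGeometry.preservesDensity_iff (α := fun p ↦ connFormAt D f N p)
    fun _ _ hY hli ↦ transversalDensity_derivative ht hS hN (mem_univ _) hΨ hpar hY hli

/-- If the ambient connection is projectively flat, a transversal normalized by a parallel volume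
form is aligned if and only if the induced connection preserves the volume density. -/
theorem IsTransversalOn.isAligned_iff (hn : 2 ≤ n) (hN : IsTransversalOn f N univ)
    (hvol : transversalDensity f Ψ N = metricDensity (inducedMetric f D N))
    (hflat : IsProjectivelyFlat (D : ConnOp (n + 1) M)) :
    (∀ p, IsAlignedAt (inducedConnection f D N) (inducedMetric f D N) p) ↔
      PreservesDensity (inducedConnection f D N) (transversalDensity f Ψ N) := by
  have hn' : (2 : ℝ) ≤ n := by exact_mod_cast hn
  rw [hN.preservesDensity_iff ht hS hΨ hpar]
  refine forall_congr' fun p ↦ ?_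
  rw [isAlignedAt_iff ht hS hN (mem_localDom f p) (mem_univ p)]
  refine forall_congr' fun u ↦ ?_
  -- With `T = 2τ` the defect becomes `(n - 1)(2 + n) τ`, so for `n ≥ 2` it vanishes exactly when
  -- `τ` does.
  rw [← hN.trace_codazzi ht hS (mem_univ p) hflat u,
    show cubicTraceAt D f N p u = 2 * connFormAt D f N p u by
      rw [hN.connForm_eq ht hS hΨ hpar hvol]; ring, ← add_mul, ← mul_assoc, mul_eq_zero]
  exact or_iff_right (mul_pos (by linarith) (by linarith)).ne'

variable {W : Π p : S, Submodule ℝ (TangentSpace (𝓡 (n + 1)) (f p))} {o : Coorientation n f}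

omit ht hΨ hpar [T2Space M] [CovariantDerivative.ContMDiffCovariantDerivative D ∞] in
theorem Coorientation.isTransversalOn (hN : IsSmoothAlongOn f N univ)
    (hside : ∀ p, N p ∈ o.side p) : IsTransversalOn f N univ :=
  ⟨isOpen_univ, hN, fun p _ ↦ o.isInvertible_splitting hS.injective_differential (hside p)⟩

/-- Over a projectively flat ambient connection, the normalized section of the affine normal
distribution is the classical equiaffine normal. -/
theorem isNormalizedSection_iff (hn : 2 ≤ n) (hW : IsAffineNormalDistribution f D W)
    (hflat : IsProjectivelyFlat (D : ConnOp (n + 1) M)) (ν : FieldAlong n f) :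
    IsNormalizedSection f D Ψ o W ν ↔ IsClassicalEquiaffineNormal f D Ψ o ν := by
  constructor
  · intro h
    have hν := Coorientation.isTransversalOn hS h.smooth h.mem_side
    have hpres := (hν.isAligned_iff ht hS hΨ hpar hn h.density_eq hflat).1 fun p ↦
      hW.2 univ ν isOpen_univ h.smooth (fun q _ ↦ ⟨h.mem_line q, fun h0 ↦
        (isInvertible_splitting_iff (hS.injective_differential q)).1
          (hν.isInvertible q (mem_univ q)) (h0 ▸ Submodule.zero_mem _)⟩) p (mem_univ p)
    exact ⟨h.smooth, h.mem_side, h.density_eq, hpres, h.density_eq ▸ hpres⟩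
  · intro h
    have hν := Coorientation.isTransversalOn hS h.smooth h.mem_side
    -- A classical equiaffine normal is aligned, and an aligned transversal spans `W`.
    have hal := (hν.isAligned_iff ht hS hΨ hpar hn h.density_eq hflat).2
      h.preserves_transversalDensity
    refine ⟨h.smooth, fun p ↦ ?_, h.mem_side, h.density_eq⟩
    rw [hW.eq_span ht hS hn hν (mem_univ p) (hal p)]
    exact Submodule.mem_span_singleton_self _

end EquiaffineNormal

/-! ### The flat model -/

section FlatModel

set_option maxSynthPendingDepth 3

variable {m : ℕ}

theorem contDiffOn_of_isSmoothFieldOn {X : VField m (EuclideanSpace ℝ (Fin m))}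
    {U : Set (EuclideanSpace ℝ (Fin m))} (hX : IsSmoothFieldOn X U) :
    ContDiffOn ℝ ∞ (F := EuclideanSpace ℝ (Fin m)) (fun x ↦ X x) U :=
  contMDiffOn_vectorSpace_iff_contDiffOn.1 hX

theorem differentiableAt_of_isDiffFieldAt {X : VField m (EuclideanSpace ℝ (Fin m))}
    {x : EuclideanSpace ℝ (Fin m)} (hX : IsDiffFieldAt X x) :
    DifferentiableAt ℝ (F := EuclideanSpace ℝ (Fin m)) (fun y ↦ X y) x := by
  have := ((mdifferentiableAt_totalSpace _ _).1 hX).2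
  simp only [trivializationAt_model_space_apply] at this
  exact mdifferentiableAt_iff_differentiableAt.1 this

/-- No differentiability is required, since both sides are built from the same `fderiv` terms. -/
theorem mlieBracket_flat (X Y : VField m (EuclideanSpace ℝ (Fin m)))
    (x : EuclideanSpace ℝ (Fin m)) :
    VectorField.mlieBracket (𝓡 m) X Y x =
      flatConnection m Y x (X x) - flatConnection m X x (Y x) := by
  rw [← VectorField.mlieBracketWithin_univ, VectorField.mlieBracketWithin_eq_lieBracketWithin]
  exact congrFun (VectorField.lieBracketWithin_univ (𝕜 := ℝ) (E := EuclideanSpace ℝ (Fin m))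
    (V := X) (W := Y)) x

theorem torsion_flatConnection : (flatConnection m).torsion = 0 :=
  (flatConnection m).torsion_eq_zero_iff.2 fun {X Y x} _ _ ↦ (mlieBracket_flat X Y x).symm

/-- The tangent trivializations of the model space are trivial, so this reduces to the smoothness of
the ordinary derivative. -/
instance contMDiff_flatConnection :
    CovariantDerivative.ContMDiffCovariantDerivative (flatConnection m) ∞ := by
  refine ⟨⟨fun {σ} hσ x _ ↦ ?_⟩⟩
  have h := contDiffOn_of_isSmoothFieldOn (X := σ) hσ
  have h1 : ContDiff ℝ ∞ (fderiv ℝ (F := EuclideanSpace ℝ (Fin m)) fun y ↦ σ y) :=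
    (contDiffOn_univ.1 h).fderiv_right (by simp)
  refine ContMDiffAt.contMDiffWithinAt (contMDiffAt_hom_bundle _ |>.2 ⟨contMDiffAt_id, ?_⟩)
  refine h1.contMDiff.contMDiffAt.congr_of_eventuallyEq (Filter.Eventually.of_forall fun y ↦ ?_)
  exact inCoordinates_tangent_bundle_core_model_space _ _ _ _ _

theorem isVolumeForm_standardVolume : IsVolumeForm (standardVolume m) where
  ne_zero x h := by
    have := congrArg (fun F ↦ F (EuclideanSpace.basisFun (Fin m) ℝ).toBasis) h
    exact one_ne_zero (((EuclideanSpace.basisFun (Fin m) ℝ).toBasis.det_self).symm.trans this)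
  smooth U _ X hX := by
    have h : ContDiffOn ℝ ∞ (fun x ↦ continuousDet (EuclideanSpace.basisFun (Fin m) ℝ).toBasis
        fun i ↦ (X i x : EuclideanSpace ℝ (Fin m))) U :=
      (continuousDet (EuclideanSpace.basisFun (Fin m) ℝ).toBasis).contDiff.comp_contDiffOn
        (contDiffOn_pi.2 fun i ↦ contDiffOn_of_isSmoothFieldOn (hX i))
    exact h.contMDiffOn

theorem preservesForm_standardVolume : PreservesForm (flatConnection m) (standardVolume m) := by
  intro x X hX v
  obtain ⟨L, hL, hLX⟩ := hasFDerivAt_basis_det (EuclideanSpace.basisFun (Fin m) ℝ).toBasis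
    (v := fun i x ↦ (X i x : EuclideanSpace ℝ (Fin m)))
    fun i ↦ (differentiableAt_of_isDiffFieldAt (hX i)).hasFDerivAt
  have h : mvfderiv (𝓡 m) (fun y ↦ standardVolume m y fun i ↦ X i y) x v = L v := by
    have := hL.fderiv
    rw [← mfderiv_eq_fderiv] at this
    exact DFunLike.congr_fun this v
  exact h.trans (hLX v)

theorem isProjectivelyFlat_flatConnection :
    IsProjectivelyFlat (flatConnection m : ConnOp m (EuclideanSpace ℝ (Fin m))) := by
  intro x
  refine ⟨univ, isOpen_univ, mem_univ x, fun _ ↦ 0, fun V _ _ X _ ↦ contMDiffOn_const,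
    fun X Y Z hX hY hZ y _ ↦ ?_⟩
  have h0 : projectiveChange (flatConnection m : ConnOp m (EuclideanSpace ℝ (Fin m)))
      (fun _ ↦ 0) = flatConnection m := by
    funext Y x
    ext1 v
    simp [projectiveChange]
  have hX' := (contDiffOn_univ.1 (contDiffOn_of_isSmoothFieldOn hX)).contDiffAt (x := y)
  have hY' := (contDiffOn_univ.1 (contDiffOn_of_isSmoothFieldOn hY)).contDiffAt (x := y)
  have hZ' := (contDiffOn_univ.1 (contDiffOn_of_isSmoothFieldOn hZ)).contDiffAt (x := y)
  have hdZ : DifferentiableAt ℝ (fderiv ℝ (F := EuclideanSpace ℝ (Fin m)) fun x ↦ Z x) y :=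
    (hZ'.fderiv_right (m := 1) (by norm_cast)).differentiableAt (by simp)
  -- `∇_v ∇_A Z - ∇_{∇_v A} Z` is the second derivative of `Z` in the directions `v` and `A`.
  -- Expanding the bracket as `∇_X Y - ∇_Y X`, the curvature is the antisymmetrization of this, and
  -- vanishes by symmetry of second derivatives.
  have key : ∀ (A : VField m (EuclideanSpace ℝ (Fin m))) (v : EuclideanSpace ℝ (Fin m)),
      ContDiffAt ℝ ∞ (F := EuclideanSpace ℝ (Fin m)) (fun x ↦ A x) y →
      flatConnection m (fun z ↦ flatConnection m Z z (A z)) y v -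
          flatConnection m Z y (flatConnection m A y v) =
        fderiv ℝ (fderiv ℝ (F := EuclideanSpace ℝ (Fin m)) fun x ↦ Z x) y v (A y) := by
    intro A v hA
    have := (hdZ.hasFDerivAt.clm_apply (hA.differentiableAt (by simp)).hasFDerivAt).fderiv
    exact sub_eq_iff_eq_add'.2 (DFunLike.congr_fun this v)
  have hsymm := (hZ'.isSymmSndFDerivAt (by simp; norm_cast)).eq (X y) (Y y)
  rw [h0, curvature, mlieBracket_flat, map_sub]
  exact (sub_sub_sub_comm _ _ _ _).trans
    (sub_eq_zero.2 ((key Y _ hY').trans (hsymm.trans (key X _ hX').symm)))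

end FlatModel

end HypersurfaceGeometry

end

open HypersurfaceGeometry in
theorem theorem2p14 (n : ℕ) (hn : 2 ≤ n) (S : Type*) [TopologicalSpace S] [T2Space S]
    [ChartedSpace (EuclideanSpace ℝ (Fin n)) S] [IsManifold (𝓡 n) ∞ S] :
    (∀ (M : Type*) [TopologicalSpace M] [T2Space M]
      [ChartedSpace (EuclideanSpace ℝ (Fin (n + 1))) M] [IsManifold (𝓡 (n + 1)) ∞ M]
      (D : CovariantDerivative (𝓡 (n + 1)) (EuclideanSpace ℝ (Fin (n + 1)))
        (TangentSpace (𝓡 (n + 1)) : M → Type _))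
      [CovariantDerivative.ContMDiffCovariantDerivative D ∞],
      D.torsion = 0 →
      ∀ f : S → M, IsNondegenerateImmersion f D →
        (∃! W, IsAffineNormalDistribution f D W) ∧
        ∀ W, IsAffineNormalDistribution f D W →
          ∀ (o : Coorientation n f)
            (Ψ : Π x : M, TangentSpace (𝓡 (n + 1)) x [⋀^Fin (n + 1)]→ₗ[ℝ] ℝ),
            IsVolumeForm Ψ → PreservesForm D Ψ →
            (∃! ν, IsNormalizedSection f D Ψ o W ν) ∧
            (IsProjectivelyFlat (D : ConnOp (n + 1) M) →
              ∀ ν, IsNormalizedSection f D Ψ o W ν →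
                PreservesDensity (inducedConnection f D ν) (transversalDensity f Ψ ν) ∧
                PreservesDensity (inducedConnection f D ν)
                  (metricDensity (inducedMetric f D ν)))) ∧
    (∀ f : S → EuclideanSpace ℝ (Fin (n + 1)),
      IsNondegenerateImmersion f (flatConnection (n + 1)) →
      ∀ W, IsAffineNormalDistribution f (flatConnection (n + 1)) W →
        ∀ (o : Coorientation n f) (ν : FieldAlong n f),
          IsNormalizedSection f (flatConnection (n + 1)) (standardVolume (n + 1)) o W ν ↔
            IsClassicalEquiaffineNormal f (flatConnection (n + 1)) (standardVolume (n + 1)) o ν) := by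
  refine ⟨fun M _ _ _ _ D _ ht f hS ↦ ⟨existsUnique_isAffineNormalDistribution ht hS hn,
    fun W hW o Ψ hΨ hpar ↦ ⟨existsUnique_isNormalizedSection ht hS hW o hΨ,
      fun hflat ν hν ↦ ?_⟩⟩, fun f hS W hW o ν ↦ ?_⟩
  -- The preservation of both densities is part of the classical characterization, which holds over
  -- every projectively flat connection and not only in flat space.
  · have h := (isNormalizedSection_iff ht hS hΨ hpar hn hW hflat ν).1 hν
    exact ⟨h.preserves_transversalDensity, h.preserves_metricDensity⟩
  · exact isNormalizedSection_iff torsion_flatConnection hS isVolumeForm_standardVolume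
      preservesForm_standardVolume hn hW isProjectivelyFlat_flatConnection ν
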